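/- Let $(M,g)$ be a $C^\infty$-smooth finite-dimensional Riemannian manifold (without boundary, not assumed complete) with Riemannian distance $d$. A set $C\subset M$ is called convex if every minimizing geodesic (i.e. geodesic of length $d(x,y)$) between any two points $x,y\in C$ lies in $C$. For a closed convex set $C$ and $x\in C$, the tangent cone $K_x=K_xC\subset T_xM$ is the closure of the set of all velocity vectors $\sigma'(0)$ of geodesics $\sigma\colon[0,\varepsilon)\to C$, $\varepsilon>0$, with $\sigma(0)=x$ (constant geodesics are allowed). Similarly, for a subset $K$ of a finite-dimensional real vector space $W$ and $v\in K$, let $K_v[K]\subset W$ be the closure of the set of all $w\in W$ such that $v+tw\in K$ for all $t\in[0,\varepsilon)$, for some $\varepsilon>0$. For $X\in T_pM$ let $R^2_X\colon T_pM\to T_pM$, $R^2_Xv=\operatorname{Rm}(v,X)X$, be the Jacobi operator, where $\operatorname{Rm}$ is the curvature tensor of the Levi-Civita connection $\nabla$, with the sign convention $\operatorname{Rm}(U,V)W=\nabla_U\nabla_VW-\nabla_V\nabla_UW-\nabla_{[U,V]}W$. Let $C\subset M$ be a closed convex set, let $J\subset\mathbb R$ be an open interval, and let $\gamma\colon J\to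 M$ be a geodesic with $\gamma(J)\subset C$. Then: 1. For all $a,b\in J$, the parallel translation $T_{\gamma(a)}M\to T_{\gamma(b)}M$ along $\gamma$ maps $K_{\gamma(a)}C$ bijectively onto $K_{\gamma(b)}C$. 2. For every $a\in J$ and every $v\in K_{\gamma(a)}C$ we have $R^2_{\gamma'(a)}v\in K_v[K_{\gamma(a)}C]$. 3. For every $a\in J$, the cone $K_{\gamma(a)}C$ contains a largest linear subspace $L_{\gamma(a)}C$ of $T_{\gamma(a)}M$, and $L_{\gamma(a)}C$ is invariant under $R^2_{\gamma'(a)}$. -/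

import Mathlib

open Set Manifold
open scoped Manifold ContDiff Topology

noncomputable section

namespace RiemConvex

section Coordinates

variable {E : Type*} [NormedAddCommGroup E] [NormedSpace ℝ E]

/-- The Christoffel symbol `Γ(u, v)` at `y` of the Levi-Civita connection of a Riemannian metric
given in coordinates by `G`: the vector with
`G(Γ(u, v), w) = (∂_u G(v, w) + ∂_v G(u, w) - ∂_w G(u, v)) / 2` for all `w`. -/
def coordChristoffel (G : E → E →L[ℝ] E →L[ℝ] ℝ) (y u v : E) : E :=
  let D : E →L[ℝ] E →L[ℝ] E →L[ℝ] ℝ := fderiv ℝ G y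
  (G y).inverse ((1 / 2 : ℝ) • (D u v + D v u - (D.flip u).flip v))

/-- The curvature tensor `Rm(u, v) w = ∇_u ∇_v w - ∇_v ∇_u w - ∇_[u, v] w` at `y` of the
connection with Christoffel symbols `Γ`, evaluated on constant coordinate fields. -/
def coordCurvature (Γ : E → E → E → E) (y u v w : E) : E :=
  fderiv ℝ (fun z ↦ Γ z v w) y u - fderiv ℝ (fun z ↦ Γ z u w) y v
    + Γ y u (Γ y v w) - Γ y v (Γ y u w)

end Coordinates

end RiemConvex

end

open Bundle

noncomputable section

namespace RiemConvex

section Riemannian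

variable {E : Type*} [NormedAddCommGroup E] [NormedSpace ℝ E]
  {M : Type*} [EMetricSpace M] [ChartedSpace E M]

/-! The tangent space `T_p M` is, by definition in Mathlib, the model space `E`, a vector being
identified with its coordinates in the preferred chart `extChartAt 𝓘(ℝ, E) p` around `p`.  Hence a
vector at `p` which is computed in the preferred chart around `p` *is* an element of `T_p M`;
see `chartDeriv_self`. -/

/-- The differential `dφ : T_x M → E` of the preferred chart `φ` around `p`, at a point `x` of the
domain of `φ`. -/
def chartDeriv (p x : M) : TangentSpace 𝓘(ℝ, E) x →L[ℝ] E :=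
  mfderiv 𝓘(ℝ, E) 𝓘(ℝ, E) (extChartAt 𝓘(ℝ, E) p) x

/-- The identification of `T_p M` with `E` is the differential at `p` of the preferred chart. -/
theorem chartDeriv_self [IsManifold 𝓘(ℝ, E) ∞ M] (p : M) (v : TangentSpace 𝓘(ℝ, E) p) :
    chartDeriv p p v = v := by
  have h : MDifferentiableAt 𝓘(ℝ, E) 𝓘(ℝ, E) (extChartAt 𝓘(ℝ, E) p) p :=
    mdifferentiableAt_extChartAt (mem_chart_source E p)
  have h2 : fderivWithin ℝ (writtenInExtChartAt 𝓘(ℝ, E) 𝓘(ℝ, E) p (extChartAt 𝓘(ℝ, E) p))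
      (range 𝓘(ℝ, E)) (extChartAt 𝓘(ℝ, E) p p) = ContinuousLinearMap.id ℝ E := by
    rw [ModelWithCorners.range_eq_univ, fderivWithin_univ]
    have h3 : writtenInExtChartAt 𝓘(ℝ, E) 𝓘(ℝ, E) p (extChartAt 𝓘(ℝ, E) p)
        =ᶠ[𝓝 (extChartAt 𝓘(ℝ, E) p p)] id := by
      filter_upwards [extChartAt_target_mem_nhds (I := 𝓘(ℝ, E)) p] with z hz
      simpa [writtenInExtChartAt] using! (extChartAt 𝓘(ℝ, E) p).right_inv hz
    rw [h3.fderiv_eq, fderiv_id]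
  unfold chartDeriv
  rw [h.mfderiv]
  erw [h2]
  rfl

/-- The differential `dφ⁻¹ : E → T_{φ⁻¹(y)} M` of the inverse of the preferred chart `φ` around
`p`, at a point `y` of the target of `φ`. -/
def chartDerivSymm (p : M) (y : E) :
    E →L[ℝ] TangentSpace 𝓘(ℝ, E) ((extChartAt 𝓘(ℝ, E) p).symm y) :=
  mfderiv 𝓘(ℝ, E) 𝓘(ℝ, E) (extChartAt 𝓘(ℝ, E) p).symm y

variable [RiemannianBundle (fun (x : M) ↦ TangentSpace 𝓘(ℝ, E) x)]

/-- The metric tensor in the preferred chart `φ` around `p`, at a point `y` of the target of `φ`: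
the bilinear form `(u, v) ↦ g (dφ⁻¹ u) (dφ⁻¹ v)`, see `chartMetric_apply`. -/
def chartMetric (p : M) (y : E) : E →L[ℝ] E →L[ℝ] ℝ :=
  (ContinuousLinearMap.precomp ℝ (chartDerivSymm p y)).comp
    (((RiemannianBundle.g (E := fun x : M ↦ TangentSpace 𝓘(ℝ, E) x)).inner
      ((extChartAt 𝓘(ℝ, E) p).symm y)).comp (chartDerivSymm p y))

theorem chartMetric_apply (p : M) (y u v : E) :
    chartMetric p y u v = inner ℝ (chartDerivSymm p y u) (chartDerivSymm p y v) :=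
  rfl

/-- The Christoffel symbol `Γ(u, v)` of the Levi-Civita connection in the preferred chart around
`p`, at the point `y` of the target of that chart. -/
def christoffel (p : M) (y u v : E) : E :=
  coordChristoffel (chartMetric p) y u v

/-- The curvature tensor `(u, v, w) ↦ Rm(u, v) w` at `p`. -/
def curvature (p : M) (u v w : TangentSpace 𝓘(ℝ, E) p) : TangentSpace 𝓘(ℝ, E) p :=
  coordCurvature (E := E) (christoffel p) (extChartAt 𝓘(ℝ, E) p p) u v w

/-- The Jacobi operator `R²_x : v ↦ Rm(v, x) x` on `T_p M`. -/
def jacobiOperator (p : M) (x v : TangentSpace 𝓘(ℝ, E) p) : TangentSpace 𝓘(ℝ, E) p :=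
  curvature p v x x

/-- The velocity vector `γ'(t)`. -/
def velocity (γ : ℝ → M) (t : ℝ) : TangentSpace 𝓘(ℝ, E) (γ t) :=
  mfderiv 𝓘(ℝ, ℝ) 𝓘(ℝ, E) γ t (1 : ℝ)

/-- The vector field `V` along the curve `γ` is parallel on the open set `J`: at each `t₀ ∈ J`
the field is differentiable and `∇_{γ'} V = V' + Γ(γ', V) = 0`,
read in the preferred chart around `γ t₀`. -/
def IsParallelOn (γ : ℝ → M) (V : ∀ t, TangentSpace 𝓘(ℝ, E) (γ t)) (J : Set ℝ) : Prop :=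
  ∀ t₀ ∈ J, HasDerivAt
    (fun t ↦ chartDeriv (γ t₀) (γ t) (V t))
    (-christoffel (γ t₀) (extChartAt 𝓘(ℝ, E) (γ t₀) (γ t₀))
      (chartDeriv (γ t₀) (γ t₀) (velocity γ t₀)) (chartDeriv (γ t₀) (γ t₀) (V t₀))) t₀

/-- `P` is the parallel translation `T_{γ(a)} M → T_{γ(b)} M` along the curve `γ` on `J`:
it sends `v` to the value at `b` of the (unique) parallel field on `J` with value `v` at `a`. -/
def IsParallelTranslation (γ : ℝ → M) (J : Set ℝ) (a b : ℝ)
    (P : TangentSpace 𝓘(ℝ, E) (γ a) → TangentSpace 𝓘(ℝ, E) (γ b)) : Prop :=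
  ∀ v w, (∃ V : ∀ t, TangentSpace 𝓘(ℝ, E) (γ t), IsParallelOn γ V J ∧ V a = v ∧ V b = w)
    ↔ P v = w

/-- `γ` is a geodesic on the open set `J`, that is, `∇_{γ'} γ' = 0`.  Constant geodesics are
allowed.  (A `C¹` curve with parallel velocity is automatically smooth.) -/
def IsGeodesicOn (γ : ℝ → M) (J : Set ℝ) : Prop :=
  ContMDiffOn 𝓘(ℝ, ℝ) 𝓘(ℝ, E) 1 γ J ∧ IsParallelOn γ (velocity (E := E) γ) J

variable (E) in
/-- The restriction of `γ` to `[0, 1]` is a minimizing geodesic from `x` to `y`.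
(A geodesic on a compact interval always extends to a slightly larger open interval.) -/
def IsMinimizingGeodesic (γ : ℝ → M) (x y : M) : Prop :=
  (∃ δ > 0, IsGeodesicOn (E := E) γ (Ioo (-δ) (1 + δ))) ∧ γ 0 = x ∧ γ 1 = y ∧
    pathELength 𝓘(ℝ, E) γ 0 1 = edist x y

variable (E) in
/-- A set is convex if it contains every minimizing geodesic between any two of its points. -/
def IsConvex (C : Set M) : Prop :=
  ∀ x ∈ C, ∀ y ∈ C, ∀ γ : ℝ → M, IsMinimizingGeodesic E γ x y → ∀ t ∈ Icc (0 : ℝ) 1, γ t ∈ C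

/-- The tangent cone `K_x C ⊆ T_x M`: the closure of the set of all velocity vectors `γ'(0)` of
geodesics `γ` which start at `γ 0 = x` and run in `C` on `[0, ε)` for some `ε > 0`.
(A geodesic on `[0, ε)` always extends to a small interval to the left of `0`.) -/
def tangentCone (C : Set M) (x : M) : Set (TangentSpace 𝓘(ℝ, E) x) :=
  closure {v | ∃ γ : ℝ → M, ∃ ε > 0, IsGeodesicOn (E := E) γ (Ioo (-ε) ε) ∧
    (⟨γ 0, velocity γ 0⟩ : TangentBundle 𝓘(ℝ, E) M) = ⟨x, v⟩ ∧ ∀ t ∈ Ico 0 ε, γ t ∈ C}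

end Riemannian

/-- The tangent cone `K_v[K]` at `v` of a subset `K` of a finite-dimensional real vector space
`W` (whose geodesics are the affinely parametrized straight lines). -/
def vectorTangentCone {W : Type*} [AddCommGroup W] [Module ℝ W] [TopologicalSpace W]
    (K : Set W) (v : W) : Set W :=
  closure {w | ∃ ε > (0 : ℝ), ∀ t ∈ Ico 0 ε, v + t • w ∈ K}

end RiemConvex

end

noncomputable section

namespace RiemConvex

/-! ### A priori estimates for second order equations on the unit interval -/

section Comparison

variable {E : Type*} [NormedAddCommGroup E] [NormedSpace ℝ E]

/-! Everything rests on one variational fact, `IsLocallyConvex.exists_mem_norm_sub_le`. Let c be a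
short geodesic in C and Z a field along c that satisfies the Jacobi equation up to an error H and
whose end values lie in the tangent cones at the ends. Move the two ends of c inside C along curves
with velocities close to these end values, and join the moved points by geodesics, which stay in C
by convexity. To first order this variation differs from Z by at most about 2H, so Z(s) is that
close to the tangent cone at c(s). On a time interval of length l, rescaling to the unit interval
turns H into l²H.

Three choices of Z give the theorem. With c constant and Z affine, midpoints of cone vectors are
cone vectors, so the cone is convex (`IsLocallyConvex.add_mem`). With Z = fW, where W is parallel
and the affine function f falls from 1 to 0 during time 2k, the Jacobi error is a bounded curvature
term; hence W/2 at the midpoint, and so W there, is O(k²)-close to the cone. Cutting a fixed time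
into n such steps leaves a total error O(1/n), and closedness of the cones yields invariance under
parallel translation (`IsGeodesicFrame.step`, `IsGeodesicFrame.transport_mem`). With Z = W + (l² -
(t - t₀)²)/2 · Y, where W(t₀) = v and Y = Rm(v, γ')γ', the added term vanishes at both ends and its
second derivative -Y cancels the curvature term at t₀. So v + l²Y/2 is o(l²)-close to the cone, and
by convexity Y is tangent to the cone at v (`IsGeodesicFrame.curvature_mem`). Finally, the largest
subspace of K is K ∩ -K; for v in it the tangent cone of K at v is contained in K, and the oddness
of the Jacobi operator gives invariance.

The analysis takes place in one chart. The geodesic spray has zero derivative at zero velocity,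
hence is 1/4-Lipschitz nearby, and this smallness makes elementary a priori bounds sufficient. Short
chart geodesics are minimizing because the square root of the energy calibrates length
(`IsMetricSprayOn.speed_le_length`); this is what makes the convexity of C applicable
(`exists_isLocallyConvex`). The local statements are glued along J by connectedness. -/

theorem norm_sub_sub_smul_le {e e' : ℝ → E} {B : ℝ} {w : E}
    (he : ∀ t ∈ Icc (0 : ℝ) 1, HasDerivAt e (e' t) t)
    (hB : ∀ t ∈ Icc (0 : ℝ) 1, ‖e' t - w‖ ≤ B) {s t : ℝ}
    (hs : s ∈ Icc (0 : ℝ) 1) (ht : t ∈ Icc (0 : ℝ) 1) :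
    ‖e t - e s - (t - s) • w‖ ≤ B := by
  have h1 : ∀ x ∈ Icc (0 : ℝ) 1, HasDerivWithinAt (fun x ↦ e x - x • w) (e' x - w) (Icc 0 1) x := by
    intro x hx
    simpa using! ((he x hx).sub ((hasDerivAt_id x).smul_const w)).hasDerivWithinAt
  have h2 := (convex_Icc (0 : ℝ) 1).norm_image_sub_le_of_norm_hasDerivWithin_le h1 hB hs ht
  have h3 : e t - t • w - (e s - s • w) = e t - e s - (t - s) • w := by
    rw [sub_smul]; abel
  rw [h3] at h2
  have hB0 : 0 ≤ B := (norm_nonneg _).trans (hB s hs)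
  refine h2.trans (mul_le_of_le_one_right hB0 ?_)
  rw [Real.norm_eq_abs, abs_le]
  constructor <;> linarith [hs.1, hs.2, ht.1, ht.2]

theorem norm_deriv_sub_le {e e' : ℝ → E} {B : ℝ}
    (he : ∀ t ∈ Icc (0 : ℝ) 1, HasDerivAt e (e' t) t)
    (hB : ∀ t ∈ Icc (0 : ℝ) 1, ‖e' t‖ ≤ B) {s t : ℝ}
    (hs : s ∈ Icc (0 : ℝ) 1) (ht : t ∈ Icc (0 : ℝ) 1) :
    ‖e t - e s‖ ≤ B := by
  simpa using norm_sub_sub_smul_le (w := 0) he (by simpa using hB) hs ht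

/-- If `‖e''‖ ≤ B` then `e'` is `B`-close to the difference of the values at the endpoints. -/
theorem norm_deriv_sub_endpoints_le {e e' e'' : ℝ → E} {B : ℝ}
    (he : ∀ t ∈ Icc (0 : ℝ) 1, HasDerivAt e (e' t) t)
    (he' : ∀ t ∈ Icc (0 : ℝ) 1, HasDerivAt e' (e'' t) t)
    (hB : ∀ t ∈ Icc (0 : ℝ) 1, ‖e'' t‖ ≤ B) {t : ℝ} (ht : t ∈ Icc (0 : ℝ) 1) :
    ‖e' t - (e 1 - e 0)‖ ≤ B := by
  have := norm_sub_sub_smul_le (w := e' t) he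
    (fun s hs ↦ norm_deriv_sub_le he' hB ht hs) (left_mem_Icc.2 zero_le_one)
    (right_mem_Icc.2 zero_le_one)
  rw [norm_sub_rev]
  simpa using this

/-- At a point where the C¹ size of e is maximal, a quarter of that maximum on the right of an
estimate can be absorbed on the left. This takes the place of a Gronwall argument and also works for
boundary values. -/
theorem exists_bound_max {e e' e'' : ℝ → E}
    (he : ∀ t ∈ Icc (0 : ℝ) 1, HasDerivAt e (e' t) t)
    (he' : ∀ t ∈ Icc (0 : ℝ) 1, HasDerivAt e' (e'' t) t) :
    ∃ t₀ ∈ Icc (0 : ℝ) 1, ∀ t ∈ Icc (0 : ℝ) 1, max ‖e t‖ ‖e' t‖ ≤ max ‖e t₀‖ ‖e' t₀‖ := by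
  have hc : ContinuousOn (fun t ↦ max ‖e t‖ ‖e' t‖) (Icc (0 : ℝ) 1) := by
    intro t ht
    exact ContinuousAt.continuousWithinAt
      ((he t ht).continuousAt.norm.max (he' t ht).continuousAt.norm)
  exact isCompact_Icc.exists_isMaxOn ⟨0, left_mem_Icc.2 zero_le_one⟩ hc

/-- A priori bound for the boundary value problem `‖e''‖ ≤ max ‖e‖ ‖e'‖ / 4 + H`. -/
theorem bound_of_boundary_values {e e' e'' : ℝ → E} {H : ℝ}
    (he : ∀ t ∈ Icc (0 : ℝ) 1, HasDerivAt e (e' t) t)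
    (he' : ∀ t ∈ Icc (0 : ℝ) 1, HasDerivAt e' (e'' t) t)
    (hB : ∀ t ∈ Icc (0 : ℝ) 1, ‖e'' t‖ ≤ 1 / 4 * max ‖e t‖ ‖e' t‖ + H) {t : ℝ}
    (ht : t ∈ Icc (0 : ℝ) 1) :
    max ‖e t‖ ‖e' t‖ ≤ 2 * (‖e 0‖ + ‖e 1‖ + H) := by
  obtain ⟨t₀, ht₀, hM⟩ := exists_bound_max he he'
  set M := max ‖e t₀‖ ‖e' t₀‖
  have hB' : ∀ t ∈ Icc (0 : ℝ) 1, ‖e'' t‖ ≤ 1 / 4 * M + H := fun t ht ↦ by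
    linarith [hB t ht, hM t ht]
  have h1 : ∀ t ∈ Icc (0 : ℝ) 1, ‖e' t - (e 1 - e 0)‖ ≤ 1 / 4 * M + H := fun t ht ↦
    norm_deriv_sub_endpoints_le he he' hB' ht
  have h2 : ‖e' t₀‖ ≤ ‖e 0‖ + ‖e 1‖ + (1 / 4 * M + H) := by
    have := norm_add_le (e' t₀ - (e 1 - e 0)) (e 1 - e 0)
    rw [sub_add_cancel] at this
    linarith [h1 t₀ ht₀, norm_sub_le (e 1) (e 0)]
  have h3 : ‖e t₀‖ ≤ ‖e 0‖ + ‖e 1‖ + (1 / 4 * M + H) := by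
    have h4 := norm_sub_sub_smul_le he h1 (left_mem_Icc.2 zero_le_one) ht₀
    have h5 : e t₀ = (e t₀ - e 0 - (t₀ - 0) • (e 1 - e 0)) + ((1 - t₀) • e 0 + t₀ • e 1) := by
      module
    have h6 : ‖(1 - t₀) • e 0 + t₀ • e 1‖ ≤ ‖e 0‖ + ‖e 1‖ := by
      refine (norm_add_le _ _).trans ?_
      rw [norm_smul, norm_smul, Real.norm_of_nonneg ht₀.1, Real.norm_of_nonneg (by linarith [ht₀.2])]
      exact add_le_add (mul_le_of_le_one_left (norm_nonneg _) (by linarith [ht₀.1]))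
        (mul_le_of_le_one_left (norm_nonneg _) ht₀.2)
    have h7 := norm_add_le (e t₀ - e 0 - (t₀ - 0) • (e 1 - e 0)) ((1 - t₀) • e 0 + t₀ • e 1)
    rw [← h5] at h7
    linarith
  have h4 : M ≤ ‖e 0‖ + ‖e 1‖ + (1 / 4 * M + H) := max_le h3 h2
  -- Absorbing M / 4 gives the factor 4/3; since M is nonnegative, so is the sum on the right, and
  -- 4/3 may be relaxed to 2.
  have h0 : 0 ≤ M := (norm_nonneg _).trans (le_max_left _ _)
  linarith [hM t ht]

/-- A priori bound for the initial value problem `‖e''‖ ≤ max ‖e‖ ‖e'‖ / 4`, `e 0 = 0`. -/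
theorem bound_of_initial_values {e e' e'' : ℝ → E}
    (he : ∀ t ∈ Icc (0 : ℝ) 1, HasDerivAt e (e' t) t)
    (he' : ∀ t ∈ Icc (0 : ℝ) 1, HasDerivAt e' (e'' t) t)
    (hB : ∀ t ∈ Icc (0 : ℝ) 1, ‖e'' t‖ ≤ 1 / 4 * max ‖e t‖ ‖e' t‖) (h0 : e 0 = 0) :
    ‖e 1 - e' 0‖ ≤ 1 / 2 * ‖e' 0‖ := by
  obtain ⟨t₀, ht₀, hM⟩ := exists_bound_max he he'
  set M := max ‖e t₀‖ ‖e' t₀‖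
  have z : (0 : ℝ) ∈ Icc (0 : ℝ) 1 := left_mem_Icc.2 zero_le_one
  have hB' : ∀ t ∈ Icc (0 : ℝ) 1, ‖e'' t‖ ≤ 1 / 4 * M := fun t ht ↦ by
    linarith [hB t ht, hM t ht]
  have h1 : ∀ t ∈ Icc (0 : ℝ) 1, ‖e' t - e' 0‖ ≤ 1 / 4 * M := fun t ht ↦
    norm_deriv_sub_le he' hB' z ht
  have h2 : ‖e' t₀‖ ≤ ‖e' 0‖ + 1 / 4 * M := by
    have := norm_add_le (e' t₀ - e' 0) (e' 0)
    rw [sub_add_cancel] at this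
    linarith [h1 t₀ ht₀]
  have h3 : ∀ t ∈ Icc (0 : ℝ) 1, ‖e t - t • e' 0‖ ≤ 1 / 4 * M := fun t ht ↦ by
    simpa [h0] using norm_sub_sub_smul_le he h1 z ht
  have h4 : ‖e t₀‖ ≤ ‖e' 0‖ + 1 / 4 * M := by
    have := norm_add_le (e t₀ - t₀ • e' 0) (t₀ • e' 0)
    rw [sub_add_cancel, norm_smul, Real.norm_of_nonneg ht₀.1] at this
    linarith [h3 t₀ ht₀, mul_le_of_le_one_left (norm_nonneg (e' 0)) ht₀.2]
  have h5 : M ≤ ‖e' 0‖ + 1 / 4 * M := max_le h4 h2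
  -- Here M is at most 4/3 of the initial velocity, so the error M / 4 is at most a third of it.
  have h6 := h3 1 (right_mem_Icc.2 zero_le_one)
  rw [one_smul] at h6
  linarith [norm_nonneg (e' 0)]

end Comparison

/-! ### Spray curves and their comparison -/

section Spray

variable {E : Type*} [NormedAddCommGroup E] [NormedSpace ℝ E]

/-- `c` is a solution of `c'' = -F(c, c')` on `s` with velocity `c'`. -/
def IsSprayCurveOn (F : E × E → E) (c c' : ℝ → E) (s : Set ℝ) : Prop :=
  ∀ t ∈ s, HasDerivAt c (c' t) t ∧ HasDerivAt c' (-F (c t, c' t)) t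

theorem IsSprayCurveOn.mono {F : E × E → E} {c c' : ℝ → E} {s s' : Set ℝ}
    (h : IsSprayCurveOn F c c' s) (hs : s' ⊆ s) : IsSprayCurveOn F c c' s' :=
  fun t ht ↦ h t (hs ht)

theorem isSprayCurveOn_const {F : E × E → E} (x : E) (hx : F (x, 0) = 0) (s : Set ℝ) :
    IsSprayCurveOn F (fun _ ↦ x) (fun _ ↦ 0) s := fun t _ ↦
  ⟨hasDerivAt_const t x, by simpa [hx] using hasDerivAt_const t (0 : E)⟩

/-- Affine reparametrization of spray curves. -/
theorem IsSprayCurveOn.comp_affine {F : E × E → E} {c c' : ℝ → E} {s s' : Set ℝ}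
    (hF : ∀ y u, ∀ a : ℝ, F (y, a • u) = a ^ 2 • F (y, u))
    (h : IsSprayCurveOn F c c' s) (a b : ℝ) (hs : ∀ t ∈ s', a + b * t ∈ s) :
    IsSprayCurveOn F (fun t ↦ c (a + b * t)) (fun t ↦ b • c' (a + b * t)) s' := by
  intro t ht
  have h1 : HasDerivAt (fun t : ℝ ↦ a + b * t) b t := by
    simpa using ((hasDerivAt_id t).const_mul b).const_add a
  obtain ⟨h2, h3⟩ := h _ (hs t ht)
  refine ⟨by simpa using! h2.scomp t h1, ?_⟩
  have := (h3.scomp t h1).const_smul b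
  convert! this using 1
  rw [hF, pow_two, mul_smul, smul_neg, smul_neg]

/-- Comparison of an approximate spray curve `z` with a spray curve `c`. -/
theorem norm_sub_le_of_boundary_values {F : E × E → E} {S : Set (E × E)}
    (hF : LipschitzOnWith (1 / 4) F S) {c c' z z' z'' : ℝ → E} {H : ℝ}
    (hc : IsSprayCurveOn F c c' (Icc 0 1)) (hcS : ∀ t ∈ Icc (0 : ℝ) 1, (c t, c' t) ∈ S)
    (hz : ∀ t ∈ Icc (0 : ℝ) 1, HasDerivAt z (z' t) t)
    (hz' : ∀ t ∈ Icc (0 : ℝ) 1, HasDerivAt z' (z'' t) t)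
    (hzS : ∀ t ∈ Icc (0 : ℝ) 1, (z t, z' t) ∈ S)
    (hH : ∀ t ∈ Icc (0 : ℝ) 1, ‖z'' t + F (z t, z' t)‖ ≤ H) {t : ℝ} (ht : t ∈ Icc (0 : ℝ) 1) :
    max ‖z t - c t‖ ‖z' t - c' t‖ ≤ 2 * (‖z 0 - c 0‖ + ‖z 1 - c 1‖ + H) := by
  refine bound_of_boundary_values (e := fun t ↦ z t - c t) (e' := fun t ↦ z' t - c' t)
    (e'' := fun t ↦ z'' t - -F (c t, c' t)) (fun t ht ↦ (hz t ht).sub (hc t ht).1)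
    (fun t ht ↦ (hz' t ht).sub (hc t ht).2) (fun t ht ↦ ?_) ht
  have h1 := hF.dist_le_mul _ (hcS t ht) _ (hzS t ht)
  rw [dist_comm, dist_comm (c t, c' t), dist_eq_norm, dist_eq_norm, Prod.norm_def] at h1
  have h2 : z'' t - -F (c t, c' t)
      = (z'' t + F (z t, z' t)) - (F (z t, z' t) - F (c t, c' t)) := by abel
  rw [h2]
  refine (norm_sub_le _ _).trans ?_
  have h3 := hH t ht
  have h4 : ((1 / 4 : NNReal) : ℝ) = 1 / 4 := by norm_num
  rw [h4] at h1
  simp only [Prod.fst_sub, Prod.snd_sub] at h1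
  linarith

/-- For a fixed starting point, the time-one map differs from the identity in the initial velocity
by a 1/2-Lipschitz map. This is the contraction that solves the boundary value problem. -/
theorem norm_sub_le_of_initial_values {F : E × E → E} {S : Set (E × E)}
    (hF : LipschitzOnWith (1 / 4) F S) {c c' z z' : ℝ → E}
    (hc : IsSprayCurveOn F c c' (Icc 0 1)) (hcS : ∀ t ∈ Icc (0 : ℝ) 1, (c t, c' t) ∈ S)
    (hz : IsSprayCurveOn F z z' (Icc 0 1)) (hzS : ∀ t ∈ Icc (0 : ℝ) 1, (z t, z' t) ∈ S)
    (h0 : z 0 = c 0) :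
    ‖(z 1 - c 1) - (z' 0 - c' 0)‖ ≤ 1 / 2 * ‖z' 0 - c' 0‖ := by
  refine bound_of_initial_values (e := fun t ↦ z t - c t) (e' := fun t ↦ z' t - c' t)
    (e'' := fun t ↦ -F (z t, z' t) - -F (c t, c' t)) (fun t ht ↦ (hz t ht).1.sub (hc t ht).1)
    (fun t ht ↦ (hz t ht).2.sub (hc t ht).2) (fun t ht ↦ ?_) (by simp [h0])
  have h1 := hF.dist_le_mul _ (hcS t ht) _ (hzS t ht)
  rw [dist_eq_norm, dist_comm (c t, c' t), dist_eq_norm, Prod.norm_def] at h1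
  have h4 : ((1 / 4 : NNReal) : ℝ) = 1 / 4 := by norm_num
  rw [h4] at h1
  have h2 : -F (z t, z' t) - -F (c t, c' t) = F (c t, c' t) - F (z t, z' t) := by abel
  rw [h2]
  exact h1

end Spray

/-! ### Local solvability of initial and boundary value problems for sprays -/

section BoundaryValueProblem

variable {E : Type*} [NormedAddCommGroup E] [NormedSpace ℝ E]

theorem spray_zero {F : E × E → E} (hF : ∀ y u, ∀ a : ℝ, F (y, a • u) = a ^ 2 • F (y, u)) (y : E) :
    F (y, 0) = 0 := by
  simpa using hF y 0 0

/-- Along (p + tw, 0) the spray vanishes identically, and along (p, tu) it is quadratic in t, so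
both partial derivatives vanish. -/
theorem fderiv_spray_zero {F : E × E → E}
    (hF : ∀ y u, ∀ a : ℝ, F (y, a • u) = a ^ 2 • F (y, u)) {p : E}
    (hd : DifferentiableAt ℝ F (p, 0)) : fderiv ℝ F (p, 0) = 0 := by
  have key : ∀ w u : E, ∀ g : ℝ → E, (∀ t : ℝ, F (p + t • w, t • u) = g t) → HasDerivAt g 0 0 →
      fderiv ℝ F (p, 0) (w, u) = 0 := by
    intro w u g hg hg'
    have h1 : HasDerivAt (fun t : ℝ ↦ (p + t • w, t • u)) (w, u) 0 := by
      have h2 : HasDerivAt (fun t : ℝ ↦ p + t • w) w 0 := by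
        simpa using ((hasDerivAt_id (0 : ℝ)).smul_const w).const_add p
      have h3 : HasDerivAt (fun t : ℝ ↦ t • u) u 0 := by
        simpa using (hasDerivAt_id (0 : ℝ)).smul_const u
      exact h2.prodMk h3
    have h4 : HasFDerivAt F (fderiv ℝ F (p, 0)) (p + (0 : ℝ) • w, (0 : ℝ) • u) := by
      simpa using hd.hasFDerivAt
    have h5 := h4.comp_hasDerivAt (0 : ℝ) h1
    have h6 : F ∘ (fun t : ℝ ↦ (p + t • w, t • u)) = g := funext hg
    rw [h6] at h5
    exact h5.unique hg'
  refine ContinuousLinearMap.ext fun ⟨w, u⟩ ↦ ?_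
  have h1 := key w 0 (fun _ ↦ 0) (fun t ↦ by simp [spray_zero hF]) (hasDerivAt_const _ _)
  have h2 := key 0 u (fun t ↦ t ^ 2 • F (p, u)) (fun t ↦ by simp [hF]) (by
      simpa using (hasDerivAt_pow 2 (0 : ℝ)).smul_const (F (p, u)))
  have h3 : (w, u) = (w, (0 : E)) + (0, u) := by simp
  rw [h3, map_add, h1, h2, add_zero, zero_apply]

/-- The strict derivative vanishes at zero velocity, so every positive Lipschitz constant is
available nearby; 1/4 is the one the a priori bounds absorb. -/
theorem exists_lipschitzOnWith_spray {F : E × E → E}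
    (hF : ∀ y u, ∀ a : ℝ, F (y, a • u) = a ^ 2 • F (y, u)) {p : E}
    (hd : ContDiffAt ℝ 1 F (p, 0)) :
    ∃ r > 0, LipschitzOnWith (1 / 4) F (Metric.closedBall (p, 0) r) := by
  have h1 := hd.hasStrictFDerivAt one_ne_zero
  rw [fderiv_spray_zero hF h1.hasFDerivAt.differentiableAt] at h1
  obtain ⟨s, hs, hl⟩ := h1.exists_lipschitzOnWith_of_nnnorm_lt (1 / 4) (by simp)
  obtain ⟨r, hr, hrs⟩ := Metric.nhds_basis_closedBall.mem_iff.1 hs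
  exact ⟨r, hr, hl.mono hrs⟩

theorem mem_closedBall_prod_iff {V : Type*} [NormedAddCommGroup V] {p x u : V} {r : ℝ} :
    (x, u) ∈ Metric.closedBall (p, (0 : V)) r ↔ ‖x - p‖ ≤ r ∧ ‖u‖ ≤ r := by
  rw [← closedBall_prod_same, mem_prod, mem_closedBall_iff_norm, mem_closedBall_iff_norm, sub_zero]

/-- Uniform local solvability of the initial value problem, on a fixed time interval. -/
theorem exists_sprayCurve_initial [CompleteSpace E] {F : E × E → E}
    (hF : ∀ y u, ∀ a : ℝ, F (y, a • u) = a ^ 2 • F (y, u)) {p : E}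
    (hd : ContDiffAt ℝ 1 F (p, 0)) {r : ℝ} (hr : 0 < r) :
    ∃ δ > 0, ∀ x u : E, ‖x - p‖ ≤ δ → ‖u‖ ≤ δ → ∃ c c' : ℝ → E, c 0 = x ∧ c' 0 = u ∧
      IsSprayCurveOn F c c' (Ioo (-1) 2) ∧
      ∀ t ∈ Ioo (-1 : ℝ) 2, (c t, c' t) ∈ Metric.closedBall (p, 0) r := by
  have hX : ContDiffAt ℝ 1 (fun z : E × E ↦ (z.2, -F z)) (p, 0) :=
    contDiffAt_snd.prodMk hd.neg
  obtain ⟨ε, hε, a, ρ, L, K, hρ, hpl⟩ := IsPicardLindelof.of_contDiffAt_one hX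
  obtain ⟨α, hα, hcont⟩ := (hpl 0).exists_forall_mem_closedBall_eq_hasDerivWithinAt_continuousOn
  simp only [zero_sub, zero_add] at hα hcont
  have hε' : (0 : ℝ) ∈ Icc (-ε) ε := by constructor <;> linarith
  have hρ' : (0 : ℝ) < ρ := hρ
  have hnhds : Metric.closedBall ((p, 0) : E × E) ρ ×ˢ Icc (-ε) ε ∈ 𝓝 (((p, 0) : E × E), (0 : ℝ)) :=
    prod_mem_nhds (Metric.closedBall_mem_nhds _ hρ') (Icc_mem_nhds (by linarith) hε)
  have hca : ContinuousAt α ((p, 0), 0) := hcont.continuousAt hnhds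
  have h0 : α ((p, 0), 0) = (p, 0) := (hα _ (Metric.mem_closedBall_self hρ'.le)).1
  have hm : α ⁻¹' Metric.closedBall (p, 0) r ∈ 𝓝 (((p, 0) : E × E), (0 : ℝ)) := by
    apply hca
    rw [h0]
    exact Metric.closedBall_mem_nhds _ hr
  obtain ⟨η, hη, hsub⟩ := Metric.nhds_basis_closedBall.mem_iff.1 (Filter.inter_mem hm hnhds)
  -- Picard–Lindelöf only gives a short time interval. Homogeneity trades time for speed: solve with
  -- velocity u / θ and slow down by θ, so that (-1, 2) is mapped into (-3θ, 3θ).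
  set θ := min (min η ε / 3) 1
  have hθ : 0 < θ := by positivity
  have hθ1 : θ ≤ 1 := min_le_right _ _
  have hθη : 3 * θ ≤ η := by
    have : θ ≤ min η ε / 3 := min_le_left _ _
    linarith [min_le_left η ε]
  have hθε : 3 * θ ≤ ε := by
    have : θ ≤ min η ε / 3 := min_le_left _ _
    linarith [min_le_right η ε]
  refine ⟨θ * min η ρ, by positivity, fun x u hx hu ↦ ?_⟩
  have hv : ‖θ⁻¹ • u‖ ≤ min η ρ := by
    rw [norm_smul, norm_inv, Real.norm_of_nonneg hθ.le, inv_mul_le_iff₀ hθ]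
    exact hu
  have hx' : ‖x - p‖ ≤ min η ρ :=
    hx.trans (mul_le_of_le_one_left (by positivity) hθ1)
  have hball : (x, θ⁻¹ • u) ∈ Metric.closedBall (p, (0 : E)) ρ :=
    mem_closedBall_prod_iff.2 ⟨hx'.trans (min_le_right _ _), hv.trans (min_le_right _ _)⟩
  have hball' : (x, θ⁻¹ • u) ∈ Metric.closedBall (p, (0 : E)) η :=
    mem_closedBall_prod_iff.2 ⟨hx'.trans (min_le_left _ _), hv.trans (min_le_left _ _)⟩
  obtain ⟨hα0, hα1⟩ := hα _ hball
  have htime : ∀ t ∈ Ioo (-1 : ℝ) 2, 0 + θ * t ∈ Ioo (-(3 * θ)) (3 * θ) := by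
    intro t ht
    constructor <;> nlinarith [ht.1, ht.2]
  have hmem : ∀ s ∈ Ioo (-(3 * θ)) (3 * θ),
      α ((x, θ⁻¹ • u), s) ∈ Metric.closedBall (p, (0 : E)) r := by
    intro s hs
    have : (((x, θ⁻¹ • u), s) : (E × E) × ℝ) ∈ Metric.closedBall (((p, 0) : E × E), (0 : ℝ)) η := by
      rw [← closedBall_prod_same, mem_prod]
      refine ⟨hball', ?_⟩
      rw [mem_closedBall_iff_norm, sub_zero, Real.norm_eq_abs, abs_le]
      constructor <;> linarith [hs.1, hs.2]
    exact (hsub this).1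
  have hspray : IsSprayCurveOn F (fun s ↦ (α ((x, θ⁻¹ • u), s)).1)
      (fun s ↦ (α ((x, θ⁻¹ • u), s)).2) (Ioo (-(3 * θ)) (3 * θ)) := by
    intro s hs
    have h1 : HasDerivAt (fun s ↦ α ((x, θ⁻¹ • u), s)) _ s :=
      (hα1 s ⟨by linarith [hs.1], by linarith [hs.2]⟩).hasDerivAt
        (Icc_mem_nhds (by linarith [hs.1]) (by linarith [hs.2]))
    exact ⟨(ContinuousLinearMap.fst ℝ E E).hasFDerivAt.comp_hasDerivAt s h1,
      (ContinuousLinearMap.snd ℝ E E).hasFDerivAt.comp_hasDerivAt s h1⟩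
  refine ⟨_, _, ?_, ?_, hspray.comp_affine hF 0 θ htime, fun t ht ↦ ?_⟩
  · simp [hα0]
  · simp [hα0, smul_smul, hθ.ne']
  · have h1 := mem_closedBall_prod_iff.1 (hmem _ (htime t ht))
    refine mem_closedBall_prod_iff.2 ⟨h1.1, ?_⟩
    rw [norm_smul, Real.norm_of_nonneg hθ.le]
    exact (mul_le_of_le_one_left (norm_nonneg _) hθ1).trans h1.2

theorem Icc_subset_Ioo_neg_one_two : Icc (0 : ℝ) 1 ⊆ Ioo (-1) 2 := fun t ht ↦
  ⟨by linarith [ht.1], by linarith [ht.2]⟩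

/-- Local solvability of the boundary value problem for sprays. -/
theorem exists_sprayCurve_boundary [CompleteSpace E] {F : E × E → E}
    (hF : ∀ y u, ∀ a : ℝ, F (y, a • u) = a ^ 2 • F (y, u)) {p : E}
    (hd : ContDiffAt ℝ 1 F (p, 0)) {r : ℝ} (hr : 0 < r)
    (hl : LipschitzOnWith (1 / 4) F (Metric.closedBall (p, 0) r)) :
    ∃ δ > 0, ∀ x y : E, ‖x - p‖ ≤ δ → ‖y - p‖ ≤ δ → ∃ c c' : ℝ → E, c 0 = x ∧ c 1 = y ∧
      IsSprayCurveOn F c c' (Ioo (-1) 2) ∧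
      ∀ t ∈ Ioo (-1 : ℝ) 2, (c t, c' t) ∈ Metric.closedBall (p, 0) r := by
  obtain ⟨δ, hδ, H⟩ := exists_sprayCurve_initial hF hd hr
  -- The bound δ / 4 makes ‖y - x‖ ≤ δ / 2, which together with the contraction factor 1/2 keeps the
  -- δ-ball of velocities invariant; the bound r makes the constant curve at x admissible for
  -- comparison.
  refine ⟨min (δ / 4) r, by positivity, fun x y hx hy ↦ ?_⟩
  have hxδ : ‖x - p‖ ≤ δ := by linarith [hx.trans (min_le_left _ _)]
  choose! c c' h0 h0' hc hS using fun u ↦ H x u hxδ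
  have comp : ∀ u ∈ Metric.closedBall (0 : E) δ, ∀ v ∈ Metric.closedBall (0 : E) δ,
      ‖(c u 1 - c v 1) - (u - v)‖ ≤ 1 / 2 * ‖u - v‖ := by
    intro u hu v hv
    rw [mem_closedBall_zero_iff] at hu hv
    have := norm_sub_le_of_initial_values hl ((hc v hv).mono Icc_subset_Ioo_neg_one_two)
      (fun t ht ↦ hS v hv t (Icc_subset_Ioo_neg_one_two ht))
      ((hc u hu).mono Icc_subset_Ioo_neg_one_two)
      (fun t ht ↦ hS u hu t (Icc_subset_Ioo_neg_one_two ht)) (by rw [h0 u hu, h0 v hv])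
    rwa [h0' u hu, h0' v hv] at this
  have hzero : (0 : E) ∈ Metric.closedBall (0 : E) δ := Metric.mem_closedBall_self hδ.le
  have hz : ‖(0 : E)‖ ≤ δ := by simpa using hδ.le
  have hc0 : c 0 1 = x := by
    have := norm_sub_le_of_initial_values hl (isSprayCurveOn_const x (spray_zero hF x) (Icc 0 1))
      (fun t ht ↦ mem_closedBall_prod_iff.2 ⟨hx.trans (min_le_right _ _), by simpa using hr.le⟩)
      ((hc 0 hz).mono Icc_subset_Ioo_neg_one_two)
      (fun t ht ↦ hS 0 hz t (Icc_subset_Ioo_neg_one_two ht)) (h0 0 hz)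
    rw [h0' 0 hz] at this
    simpa [sub_eq_zero] using this
  -- A fixed point is an initial velocity whose curve from x ends at y.
  let Ψ : E → E := fun u ↦ u - c u 1 + y
  have hdist : ∀ u ∈ Metric.closedBall (0 : E) δ, ∀ v ∈ Metric.closedBall (0 : E) δ,
      ‖Ψ u - Ψ v‖ ≤ 1 / 2 * ‖u - v‖ := by
    intro u hu v hv
    have : Ψ u - Ψ v = -((c u 1 - c v 1) - (u - v)) := by simp only [Ψ]; abel
    rw [this, norm_neg]
    exact comp u hu v hv
  have hmaps : MapsTo Ψ (Metric.closedBall 0 δ) (Metric.closedBall 0 δ) := by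
    intro u hu
    have h1 := hdist u hu 0 hzero
    have h2 : ‖Ψ 0‖ ≤ δ / 2 := by
      have : Ψ 0 = (y - p) - (x - p) := by simp only [Ψ, hc0]; abel
      rw [this]
      linarith [norm_sub_le (y - p) (x - p), hx.trans (min_le_left _ _), hy.trans (min_le_left _ _)]
    rw [mem_closedBall_zero_iff] at hu ⊢
    rw [sub_zero] at h1
    have h3 := norm_add_le (Ψ u - Ψ 0) (Ψ 0)
    rw [sub_add_cancel] at h3
    linarith
  have hcw : ContractingWith (1 / 2) (hmaps.restrict Ψ _ _) := by
    refine ⟨by rw [← NNReal.coe_lt_coe]; norm_num, LipschitzWith.of_dist_le_mul fun u v ↦ ?_⟩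
    have := hdist u u.2 v v.2
    simpa [Subtype.dist_eq, dist_eq_norm] using this
  obtain ⟨u, hu, hfix, -⟩ := hcw.exists_fixedPoint' Metric.isClosed_closedBall.isComplete hmaps
    hzero (edist_ne_top _ _)
  have hu' : ‖u‖ ≤ δ := by simpa using hu
  refine ⟨c u, c' u, h0 u hu', ?_, hc u hu', hS u hu'⟩
  have h1 : u - c u 1 + y = u := hfix
  have h2 : y - c u 1 = 0 := by
    have : y - c u 1 = (u - c u 1 + y) - u := by abel
    rw [this, h1, sub_self]
  exact (sub_eq_zero.1 h2).symm

/-- Velocity bounds for spray curves in terms of the distance of the endpoints. -/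
theorem norm_deriv_le_of_sprayCurve {F : E × E → E}
    (hF : ∀ y u, ∀ a : ℝ, F (y, a • u) = a ^ 2 • F (y, u)) {p : E} {r : ℝ} (hr : 0 < r)
    (hl : LipschitzOnWith (1 / 4) F (Metric.closedBall (p, 0) r)) {c c' : ℝ → E}
    (hc : IsSprayCurveOn F c c' (Icc 0 1))
    (hS : ∀ t ∈ Icc (0 : ℝ) 1, (c t, c' t) ∈ Metric.closedBall (p, 0) r) {t : ℝ}
    (ht : t ∈ Icc (0 : ℝ) 1) : ‖c' t‖ ≤ 2 * ‖c 1 - c 0‖ := by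
  have hx := (mem_closedBall_prod_iff.1 (hS 0 (left_mem_Icc.2 zero_le_one))).1
  have := norm_sub_le_of_boundary_values hl (H := 0)
    (isSprayCurveOn_const (c 0) (spray_zero hF (c 0)) (Icc 0 1))
    (fun t ht ↦ mem_closedBall_prod_iff.2 ⟨hx, by simpa using hr.le⟩)
    (fun t ht ↦ (hc t ht).1) (fun t ht ↦ (hc t ht).2) hS (by simp) ht
  simpa using (le_max_right _ _).trans this

/-- Rescale u to norm r, apply the Lipschitz bound against F(y, 0) = 0, and scale back by
homogeneity; no bound on u is needed. -/
theorem norm_spray_le {F : E × E → E}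
    (hF : ∀ y u, ∀ a : ℝ, F (y, a • u) = a ^ 2 • F (y, u)) {p : E} {r : ℝ} (hr : 0 < r)
    (hl : LipschitzOnWith (1 / 4) F (Metric.closedBall (p, 0) r)) {y u : E} (hy : ‖y - p‖ ≤ r) :
    ‖F (y, u)‖ ≤ 1 / (4 * r) * ‖u‖ ^ 2 := by
  rcases eq_or_ne u 0 with rfl | hu
  · simp [spray_zero hF]
  have hu' : 0 < ‖u‖ := norm_pos_iff.2 hu
  set a := r / ‖u‖
  have ha : 0 < a := by positivity
  have hau : ‖a • u‖ = r := by
    rw [norm_smul, Real.norm_of_nonneg ha.le, div_mul_cancel₀ _ hu'.ne']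
  have h1 := hl.dist_le_mul (y, a • u) (mem_closedBall_prod_iff.2 ⟨hy, hau.le⟩) (y, 0)
    (mem_closedBall_prod_iff.2 ⟨hy, by simpa using hr.le⟩)
  rw [dist_eq_norm, dist_eq_norm, spray_zero hF, sub_zero, hF, norm_smul, Prod.norm_def] at h1
  simp only [Prod.mk_sub_mk, sub_self, norm_zero, sub_zero, hau, max_eq_right hr.le] at h1
  have h4 : ((1 / 4 : NNReal) : ℝ) = 1 / 4 := by norm_num
  rw [h4, Real.norm_of_nonneg (by positivity)] at h1
  have h5 : ‖F (y, u)‖ = (a ^ 2 * ‖F (y, u)‖) / a ^ 2 := by field_simp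
  rw [h5]
  calc a ^ 2 * ‖F (y, u)‖ / a ^ 2 ≤ (1 / 4 * r) / a ^ 2 := by gcongr
    _ = 1 / (4 * r) * ‖u‖ ^ 2 := by simp only [a]; field_simp

/-- The acceleration is quadratic in the velocity, and the velocity is at most twice the chord, so
velocity and chord agree to second order. This turns small displacements within a convex set into
vectors of the tangent cone. -/
theorem norm_deriv_sub_le_of_sprayCurve {F : E × E → E}
    (hF : ∀ y u, ∀ a : ℝ, F (y, a • u) = a ^ 2 • F (y, u)) {p : E} {r : ℝ} (hr : 0 < r)
    (hl : LipschitzOnWith (1 / 4) F (Metric.closedBall (p, 0) r)) {c c' : ℝ → E}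
    (hc : IsSprayCurveOn F c c' (Icc 0 1))
    (hS : ∀ t ∈ Icc (0 : ℝ) 1, (c t, c' t) ∈ Metric.closedBall (p, 0) r) {t : ℝ}
    (ht : t ∈ Icc (0 : ℝ) 1) : ‖c' t - (c 1 - c 0)‖ ≤ 1 / r * ‖c 1 - c 0‖ ^ 2 := by
  refine norm_deriv_sub_endpoints_le (fun t ht ↦ (hc t ht).1) (fun t ht ↦ (hc t ht).2)
    (fun t ht ↦ ?_) ht
  rw [norm_neg]
  have h1 := norm_deriv_le_of_sprayCurve hF hr hl hc hS ht
  calc ‖F (c t, c' t)‖ ≤ 1 / (4 * r) * ‖c' t‖ ^ 2 :=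
        norm_spray_le hF hr hl (mem_closedBall_prod_iff.1 (hS t ht)).1
    _ ≤ 1 / (4 * r) * (2 * ‖c 1 - c 0‖) ^ 2 := by gcongr
    _ = 1 / r * ‖c 1 - c 0‖ ^ 2 := by field_simp; norm_num

/-- Quadratic Taylor estimate for a `C²` map near a point. -/
theorem exists_taylor_bound {W W' : Type*} [NormedAddCommGroup W] [NormedSpace ℝ W]
    [NormedAddCommGroup W'] [NormedSpace ℝ W'] {f : W → W'} {x : W} (hf : ContDiffAt ℝ 2 f x) :
    ∃ r > 0, ∃ A ≥ 0, (∀ y ∈ Metric.closedBall x r, DifferentiableAt ℝ f y) ∧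
      ∀ y ∈ Metric.closedBall x r, ∀ z ∈ Metric.closedBall x r,
      ‖f z - f y - fderiv ℝ f y (z - y)‖ ≤ A * ‖z - y‖ ^ 2 := by
  have h1 : ContDiffAt ℝ 1 (fderiv ℝ f) x := hf.fderiv_right (by norm_num)
  obtain ⟨K, s, hs, hl⟩ := h1.exists_lipschitzOnWith
  have h2 : ∀ᶠ y in 𝓝 x, DifferentiableAt ℝ f y :=
    (hf.eventually (by simp)).mono fun y hy ↦ hy.differentiableAt (by simp)
  obtain ⟨r, hr, hrs⟩ := Metric.nhds_basis_closedBall.mem_iff.1 (Filter.inter_mem hs h2)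
  refine ⟨r, hr, K, K.2, fun y hy ↦ (hrs hy).2, fun y hy z hz ↦ ?_⟩
  have hseg : segment ℝ y z ⊆ Metric.closedBall x r := (convex_closedBall x r).segment_subset hy hz
  have := (convex_segment y z).norm_image_sub_le_of_norm_hasFDerivWithin_le'
    (f := f) (f' := fderiv ℝ f) (φ := fderiv ℝ f y) (C := K * ‖z - y‖)
    (fun w hw ↦ ((hrs (hseg hw)).2).hasFDerivAt.hasFDerivWithinAt) (fun w hw ↦ ?_)
    (left_mem_segment ℝ y z) (right_mem_segment ℝ y z)
  · rwa [mul_assoc, ← pow_two] at this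
  · have h3 := hl.dist_le_mul w (hrs (hseg hw)).1 y (hrs hy).1
    rw [dist_eq_norm, dist_eq_norm] at h3
    refine h3.trans ?_
    gcongr
    exact norm_sub_le_of_mem_segment hw

end BoundaryValueProblem

/-! ### First variation of energy and the calibration of length -/

section Calibration

variable {E : Type*} [NormedAddCommGroup E] [NormedSpace ℝ E]

theorem hasDerivAt_comp_bilinear {V : Type*} [NormedAddCommGroup V] [NormedSpace ℝ V]
    {G : E → E →L[ℝ] E →L[ℝ] V} {c a b : ℝ → E} {c₁ a₁ b₁ : E} {t : ℝ}
    (hG : DifferentiableAt ℝ G (c t))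
    (hc : HasDerivAt c c₁ t) (ha : HasDerivAt a a₁ t) (hb : HasDerivAt b b₁ t) :
    HasDerivAt (fun t ↦ G (c t) (a t) (b t))
      (fderiv ℝ G (c t) c₁ (a t) (b t) + G (c t) a₁ (b t) + G (c t) (a t) b₁) t := by
  have h1 : HasDerivAt (fun t ↦ G (c t)) (fderiv ℝ G (c t) c₁) t :=
    HasFDerivAt.comp_hasDerivAt (l := G) t hG.hasFDerivAt hc
  have h2 := (h1.clm_apply ha).clm_apply hb
  simpa using h2

theorem continuousAt_of_differentiableAt_bilinear {V : Type*} [NormedAddCommGroup V]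
    [NormedSpace ℝ V] {G : E → E →L[ℝ] E →L[ℝ] V} {y : E} (hG : DifferentiableAt ℝ G y) :
    ContinuousAt G y :=
  hG.continuousAt

/-- `F` is the geodesic spray of the Riemannian metric `G` on `S`. -/
structure IsMetricSprayOn (G : E → E →L[ℝ] E →L[ℝ] ℝ) (F : E × E → E) (S : Set E) : Prop where
  symm : ∀ y ∈ S, ∀ u v, G y u v = G y v u
  pos : ∀ y ∈ S, ∀ u, u ≠ 0 → 0 < G y u u
  diff : ∀ y ∈ S, DifferentiableAt ℝ G y
  geodesic : ∀ y ∈ S, ∀ u w,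
    2 * G y (F (y, u)) w = 2 * fderiv ℝ G y u u w - fderiv ℝ G y w u u

variable {G : E → E →L[ℝ] E →L[ℝ] ℝ} {F : E × E → E} {S S' : Set E}

theorem IsMetricSprayOn.mono (h : IsMetricSprayOn G F S) (hS : S' ⊆ S) : IsMetricSprayOn G F S' :=
  ⟨fun y hy ↦ h.symm y (hS hy), fun y hy ↦ h.pos y (hS hy), fun y hy ↦ h.diff y (hS hy),
    fun y hy ↦ h.geodesic y (hS hy)⟩

theorem IsMetricSprayOn.nonneg (h : IsMetricSprayOn G F S) {y : E} (hy : y ∈ S) (u : E) :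
    0 ≤ G y u u := by
  rcases eq_or_ne u 0 with rfl | hu
  · simp
  · exact (h.pos y hy u hu).le

/-- Cauchy–Schwarz, from the nonnegativity of the form at G(v, v)u - G(u, v)v. -/
theorem IsMetricSprayOn.apply_le_sqrt_mul_sqrt (h : IsMetricSprayOn G F S) {y : E} (hy : y ∈ S)
    (u v : E) : G y u v ≤ √(G y u u) * √(G y v v) := by
  rw [← Real.sqrt_mul (h.nonneg hy u)]
  apply Real.le_sqrt_of_sq_le
  rcases eq_or_ne v 0 with rfl | hv
  · simp
  have h1 := h.nonneg hy (G y v v • u - G y u v • v)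
  simp only [map_sub, map_smul, sub_apply, smul_apply,
    smul_eq_mul, h.symm y hy v u] at h1
  have h2 := h.pos y hy v hv
  have h3 : 0 ≤ G y v v * (G y u u * G y v v - G y u v ^ 2) := by nlinarith
  linarith [nonneg_of_mul_nonneg_right h3 h2]

/-- Geodesics have constant speed. -/
theorem IsMetricSprayOn.speed_eq (h : IsMetricSprayOn G F S) {c c' : ℝ → E}
    (hc : IsSprayCurveOn F c c' (Icc 0 1)) (hS : ∀ t ∈ Icc (0 : ℝ) 1, c t ∈ S)
    {s t : ℝ} (hs : s ∈ Icc (0 : ℝ) 1) (ht : t ∈ Icc (0 : ℝ) 1) :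
    G (c s) (c' s) (c' s) = G (c t) (c' t) (c' t) := by
  have h1 : ∀ t ∈ Icc (0 : ℝ) 1, HasDerivWithinAt (fun t ↦ G (c t) (c' t) (c' t)) 0 (Icc 0 1) t := by
    intro t ht
    have h2 := hasDerivAt_comp_bilinear (V := ℝ) (h.diff _ (hS t ht)) (hc t ht).1 (hc t ht).2 (hc t ht).2
    have h3 := h.geodesic _ (hS t ht) (c' t) (c' t)
    have h4 := h.symm _ (hS t ht) (c' t) (-F (c t, c' t))
    rw [h4] at h2
    simp only [map_neg, neg_apply] at h2
    refine (h2.congr_deriv ?_).hasDerivWithinAt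
    linarith
  have := (convex_Icc (0 : ℝ) 1).norm_image_sub_le_of_norm_hasDerivWithin_le (C := 0) h1
    (by simp) ht hs
  simpa [sub_eq_zero] using this

/-- First variation estimate for the energy of geodesics with a common initial point. -/
theorem IsMetricSprayOn.energy_sub_le {p : E} {r A : ℝ}
    (h : IsMetricSprayOn G F (Metric.closedBall p r))
    (hl : LipschitzOnWith (1 / 4) F (Metric.closedBall (p, 0) r)) (hA : 0 ≤ A)
    (hL : ∀ y ∈ Metric.closedBall (p, (0 : E)) r, ∀ z ∈ Metric.closedBall (p, (0 : E)) r,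
      ‖G z.1 z.2 z.2 - G y.1 y.2 y.2 -
        (fderiv ℝ G y.1 (z.1 - y.1) y.2 y.2 + 2 * G y.1 y.2 (z.2 - y.2))‖ ≤ A * ‖z - y‖ ^ 2)
    {c c' z z' : ℝ → E}
    (hc : IsSprayCurveOn F c c' (Icc 0 1))
    (hcS : ∀ t ∈ Icc (0 : ℝ) 1, (c t, c' t) ∈ Metric.closedBall (p, 0) r)
    (hz : IsSprayCurveOn F z z' (Icc 0 1))
    (hzS : ∀ t ∈ Icc (0 : ℝ) 1, (z t, z' t) ∈ Metric.closedBall (p, 0) r)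
    (h0 : z 0 = c 0) :
    ‖G (z 1) (z' 1) (z' 1) - G (c 1) (c' 1) (c' 1) - 2 * G (c 1) (c' 1) (z 1 - c 1)‖
      ≤ 4 * A * ‖z 1 - c 1‖ ^ 2 := by
  have i0 : (0 : ℝ) ∈ Icc (0 : ℝ) 1 := left_mem_Icc.2 zero_le_one
  have i1 : (1 : ℝ) ∈ Icc (0 : ℝ) 1 := right_mem_Icc.2 zero_le_one
  have hcb : ∀ t ∈ Icc (0 : ℝ) 1, c t ∈ Metric.closedBall p r := fun t ht ↦
    mem_closedBall_iff_norm.2 (mem_closedBall_prod_iff.1 (hcS t ht)).1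
  have hzb : ∀ t ∈ Icc (0 : ℝ) 1, z t ∈ Metric.closedBall p r := fun t ht ↦
    mem_closedBall_iff_norm.2 (mem_closedBall_prod_iff.1 (hzS t ht)).1
  set D := G (z 1) (z' 1) (z' 1) - G (c 1) (c' 1) (c' 1)
  -- Both speeds are constant, so D is the difference of the energy densities at every time. By the
  -- geodesic equation, the derivative of the second term is the linear part of that difference at
  -- c; only the Taylor remainder is left.
  have hψ : ∀ t ∈ Icc (0 : ℝ) 1, HasDerivAt (fun t ↦ t * D - 2 * G (c t) (c' t) (z t - c t))
      (G (z t) (z' t) (z' t) - G (c t) (c' t) (c' t) -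
        (fderiv ℝ G (c t) (z t - c t) (c' t) (c' t) + 2 * G (c t) (c' t) (z' t - c' t))) t := by
    intro t ht
    have h2 := hasDerivAt_comp_bilinear (V := ℝ) (h.diff _ (hcb t ht)) (hc t ht).1 (hc t ht).2
      ((hz t ht).1.sub (hc t ht).1)
    have h3 := ((hasDerivAt_id t).mul_const D).sub (h2.const_mul 2)
    refine h3.congr_deriv ?_
    have h4 := h.geodesic _ (hcb t ht) (c' t) (z t - c t)
    have h5 : D = G (z t) (z' t) (z' t) - G (c t) (c' t) (c' t) := by
      simp only [D]
      rw [h.speed_eq hz hzb ht i1, h.speed_eq hc hcb ht i1]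
    rw [h5]
    simp only [Pi.sub_apply, map_neg, neg_apply]
    linarith
  have hb : ∀ t ∈ Icc (0 : ℝ) 1, ‖G (z t) (z' t) (z' t) - G (c t) (c' t) (c' t) -
        (fderiv ℝ G (c t) (z t - c t) (c' t) (c' t) + 2 * G (c t) (c' t) (z' t - c' t))‖
      ≤ 4 * A * ‖z 1 - c 1‖ ^ 2 := by
    intro t ht
    refine (hL _ (hcS t ht) _ (hzS t ht)).trans ?_
    have := norm_sub_le_of_boundary_values hl (H := 0) hc hcS (fun t ht ↦ (hz t ht).1)
      (fun t ht ↦ (hz t ht).2) hzS (by simp) ht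
    rw [h0, sub_self, norm_zero, zero_add, add_zero] at this
    rw [Prod.norm_def]
    calc A * max ‖z t - c t‖ ‖z' t - c' t‖ ^ 2 ≤ A * (2 * ‖z 1 - c 1‖) ^ 2 := by gcongr
      _ = 4 * A * ‖z 1 - c 1‖ ^ 2 := by ring
  simpa [h0] using norm_deriv_sub_le hψ hb i0 i1

/-- The length of a curve is at least the speed of the geodesic between its endpoints. -/
theorem IsMetricSprayOn.speed_le_length {p x y : E} {r δ A : ℝ} (hδr : δ ≤ r)
    (h : IsMetricSprayOn G F (Metric.closedBall p r))
    (hF : ∀ y u, ∀ a : ℝ, F (y, a • u) = a ^ 2 • F (y, u)) (hr : 0 < r)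
    (hl : LipschitzOnWith (1 / 4) F (Metric.closedBall (p, 0) r)) (hA : 0 ≤ A)
    (hL : ∀ y ∈ Metric.closedBall (p, (0 : E)) r, ∀ z ∈ Metric.closedBall (p, (0 : E)) r,
      ‖G z.1 z.2 z.2 - G y.1 y.2 y.2 -
        (fderiv ℝ G y.1 (z.1 - y.1) y.2 y.2 + 2 * G y.1 y.2 (z.2 - y.2))‖ ≤ A * ‖z - y‖ ^ 2)
    {c c' : E → ℝ → E}
    (hc : ∀ z, ‖z - p‖ ≤ δ → c z 0 = x ∧ c z 1 = z ∧ IsSprayCurveOn F (c z) (c' z) (Icc 0 1) ∧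
      ∀ t ∈ Icc (0 : ℝ) 1, (c z t, c' z t) ∈ Metric.closedBall (p, 0) r)
    {b b' : ℝ → E} (hb : ∀ t ∈ Icc (0 : ℝ) 1, HasDerivWithinAt b (b' t) (Icc 0 1) t)
    (hb' : ContinuousOn b' (Icc 0 1)) (hbδ : ∀ t ∈ Icc (0 : ℝ) 1, ‖b t - p‖ < δ)
    (hb0 : b 0 = x) (hb1 : b 1 = y) :
    √(G y (c' y 1) (c' y 1)) ≤ ∫ t in (0 : ℝ)..1, √(G (b t) (b' t) (b' t)) := by
  have i0 : (0 : ℝ) ∈ Icc (0 : ℝ) 1 := left_mem_Icc.2 zero_le_one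
  have i1 : (1 : ℝ) ∈ Icc (0 : ℝ) 1 := right_mem_Icc.2 zero_le_one
  -- The energy of the geodesic from x to z. Its differential is 2G(c'(1), ·), the Gauss lemma, so
  -- its square root grows along a curve at most as fast as the length.
  let En : E → ℝ := fun z ↦ G z (c' z 1) (c' z 1)
  have hball : ∀ z, ‖z - p‖ ≤ δ → z ∈ Metric.closedBall p r := fun z hz ↦
    mem_closedBall_iff_norm.2 (hz.trans hδr)
  have hEn : ∀ z, ‖z - p‖ < δ → HasFDerivAt En ((2 : ℝ) • G z (c' z 1)) z := by
    intro z hz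
    rw [hasFDerivAt_iff_isLittleO]
    refine Asymptotics.IsBigO.trans_isLittleO ?_ (Asymptotics.isLittleO_pow_sub_sub z one_lt_two)
    apply Asymptotics.IsBigO.of_bound (4 * A)
    have hev : ∀ᶠ w in 𝓝 z, ‖w - p‖ < δ :=
      (continuous_id.sub continuous_const).norm.continuousAt.eventually_lt continuousAt_const hz
    filter_upwards [hev] with w hw
    obtain ⟨z0, z1, zc, zS⟩ := hc z hz.le
    obtain ⟨w0, w1, wc, wS⟩ := hc w hw.le
    have := h.energy_sub_le hl hA hL zc zS wc wS (by rw [z0, w0])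
    rw [z1, w1] at this
    simpa [En] using this
  have hx : ‖x - p‖ < δ := hb0 ▸ hbδ 0 i0
  have hEx : En x = 0 := by
    obtain ⟨x0, x1, xc, xS⟩ := hc x hx.le
    have := norm_deriv_le_of_sprayCurve hF hr hl xc xS i1
    rw [x0, x1, sub_self, norm_zero, mul_zero, norm_le_zero_iff] at this
    simp [En, this]
  have hcont : ContinuousOn (fun t ↦ √(G (b t) (b' t) (b' t))) (Icc 0 1) := by
    have hbc : ContinuousOn b (Icc 0 1) := fun t ht ↦ (hb t ht).continuousWithinAt
    have hGc : ContinuousOn (fun t ↦ G (b t)) (Icc 0 1) := fun t ht ↦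
      (continuousAt_of_differentiableAt_bilinear (V := ℝ)
        (h.diff _ (hball _ (hbδ t ht).le))).comp_continuousWithinAt (hbc t ht)
    exact ((hGc.clm_apply hb').clm_apply hb').sqrt
  -- The curve starts at x, where the energy is zero and the square root is not differentiable,
  -- hence the regularization √(En + ε²).
  have key : ∀ ε > 0, √(En y) ≤ (∫ t in (0 : ℝ)..1, √(G (b t) (b' t) (b' t))) + ε := by
    intro ε hε
    have hEn0 : ∀ t ∈ Icc (0 : ℝ) 1, 0 ≤ En (b t) := fun t ht ↦ h.nonneg (hball _ (hbδ t ht).le) _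
    have hf : ∀ t ∈ Icc (0 : ℝ) 1, HasDerivWithinAt (fun t ↦ √(En (b t) + ε ^ 2))
        ((2 * G (b t) (c' (b t) 1) (b' t)) / (2 * √(En (b t) + ε ^ 2))) (Icc 0 1) t := by
      intro t ht
      have h1 : HasDerivWithinAt (fun t ↦ En (b t)) (2 * G (b t) (c' (b t) 1) (b' t)) (Icc 0 1) t := by
        simpa using! (hEn _ (hbδ t ht)).comp_hasDerivWithinAt t (hb t ht)
      exact (h1.add_const _).sqrt (by have := hEn0 t ht; positivity)
    have h1 := intervalIntegral.sub_le_integral_of_hasDeriv_right_of_le zero_le_one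
      (fun t ht ↦ (hf t ht).continuousWithinAt)
      (fun t ht ↦ ((hf t (Ioo_subset_Icc_self ht)).hasDerivAt
        (Icc_mem_nhds ht.1 ht.2)).hasDerivWithinAt)
      (hcont.integrableOn_Icc) (fun t ht ↦ ?_)
    · rw [hb0, hb1, hEx, zero_add, Real.sqrt_sq hε.le] at h1
      have h2 : √(En y) ≤ √(En y + ε ^ 2) := Real.sqrt_le_sqrt (by nlinarith)
      linarith
    · have ht' := Ioo_subset_Icc_self ht
      have h3 := h.apply_le_sqrt_mul_sqrt (hball _ (hbδ t ht').le) (c' (b t) 1) (b' t)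
      have h4 : 0 < √(En (b t) + ε ^ 2) := Real.sqrt_pos.2 (by have := hEn0 t ht'; positivity)
      rw [mul_div_mul_left _ _ two_ne_zero, div_le_iff₀ h4, mul_comm]
      refine h3.trans ?_
      gcongr
      have : En (b t) ≤ En (b t) + ε ^ 2 := by nlinarith
      exact this
  exact le_of_forall_pos_le_add key

end Calibration

/-! ### Variations of geodesics through a convex set -/

section Variation

variable {E : Type*} [NormedAddCommGroup E] [NormedSpace ℝ E]

/-- A set `S` in a coordinate ball around `p` which is convex with respect to the spray `F`,
together with its tangent cones `K`. -/
structure IsLocallyConvex (F : E × E → E) (p : E) (r δ A : ℝ) (S : Set E) (K : E → Set E) :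
    Prop where
  hom : ∀ y u, ∀ a : ℝ, F (y, a • u) = a ^ 2 • F (y, u)
  r_pos : 0 < r
  δ_pos : 0 < δ
  lip : LipschitzOnWith (1 / 4) F (Metric.closedBall (p, 0) r)
  A_nonneg : 0 ≤ A
  taylor : ∀ y ∈ Metric.closedBall (p, (0 : E)) r, ∀ z ∈ Metric.closedBall (p, (0 : E)) r,
    ‖F z - F y - fderiv ℝ F y (z - y)‖ ≤ A * ‖z - y‖ ^ 2
  exists_geodesic : ∀ x ∈ S, ‖x - p‖ ≤ δ → ∀ y ∈ S, ‖y - p‖ ≤ δ → ∃ c c' : ℝ → E,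
    c 0 = x ∧ c 1 = y ∧ IsSprayCurveOn F c c' (Icc 0 1) ∧
    (∀ t ∈ Icc (0 : ℝ) 1, (c t, c' t) ∈ Metric.closedBall (p, 0) r) ∧
    (∀ t ∈ Icc (0 : ℝ) 1, c t ∈ S) ∧ c' 0 ∈ K x
  isClosed : ∀ x, IsClosed (K x)
  smul_mem : ∀ x, ∀ v ∈ K x, ∀ a : ℝ, 0 ≤ a → a • v ∈ K x
  exists_curve : ∀ x ∈ S, ‖x - p‖ ≤ δ → ∀ v ∈ K x, ∀ ε > 0, ∃ w, ‖w - v‖ < ε ∧ ∃ σ : ℝ → E,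
    HasDerivAt σ w 0 ∧ σ 0 = x ∧ ∀ᶠ t in 𝓝[>] (0 : ℝ), σ t ∈ S

theorem eventually_mul_lt (B : ℝ) {b : ℝ} (hb : 0 < b) : ∀ᶠ t in 𝓝[>] (0 : ℝ), t * B < b := by
  have h : ContinuousAt (fun t : ℝ ↦ t * B) 0 := by fun_prop
  have := h.eventually_lt (continuousAt_const (y := b)) (by simpa using hb)
  exact this.filter_mono nhdsWithin_le_nhds

theorem eventually_norm_sub_le {σ : ℝ → E} {w : E} (h : HasDerivAt σ w 0) {ε : ℝ} (hε : 0 < ε) :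
    ∀ᶠ t in 𝓝[>] (0 : ℝ), ‖σ t - σ 0 - t • w‖ ≤ t * ε := by
  have h1 := (hasDerivAt_iff_isLittleO.1 h).bound hε
  filter_upwards [h1.filter_mono nhdsWithin_le_nhds, self_mem_nhdsWithin] with t ht ht'
  rw [sub_zero, Real.norm_of_nonneg (le_of_lt ht')] at ht
  linarith

/-- Cones along a geodesic: an approximate Jacobi field with values in the tangent cones at the
endpoints is close to the tangent cones in between. -/
theorem IsLocallyConvex.exists_mem_norm_sub_le {F : E × E → E} {p : E} {r δ A : ℝ} {S : Set E}
    {K : E → Set E} (h : IsLocallyConvex F p r δ A S K) {c c' Z Z' Z'' : ℝ → E} {H : ℝ}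
    (hc : IsSprayCurveOn F c c' (Icc 0 1)) (hcS : ∀ t ∈ Icc (0 : ℝ) 1, c t ∈ S)
    (hcp : ∀ t ∈ Icc (0 : ℝ) 1, ‖c t - p‖ ≤ r / 2) (hcδ : ∀ t ∈ Icc (0 : ℝ) 1, ‖c t - p‖ ≤ δ / 2)
    (hcr : ∀ t ∈ Icc (0 : ℝ) 1, ‖c' t‖ ≤ r / 2)
    (hZ : ∀ t ∈ Icc (0 : ℝ) 1, HasDerivAt Z (Z' t) t)
    (hZ' : ∀ t ∈ Icc (0 : ℝ) 1, HasDerivAt Z' (Z'' t) t)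
    (hH : ∀ t ∈ Icc (0 : ℝ) 1, ‖Z'' t + fderiv ℝ F (c t, c' t) (Z t, Z' t)‖ ≤ H)
    (hK₀ : Z 0 ∈ K (c 0)) (hK₁ : Z 1 ∈ K (c 1)) {s : ℝ} (hs : s ∈ Icc (0 : ℝ) 1)
    {ε : ℝ} (hε : 0 < ε) : ∃ u ∈ K (c s), ‖u - Z s‖ ≤ 2 * H + ε := by
  have i0 : (0 : ℝ) ∈ Icc (0 : ℝ) 1 := left_mem_Icc.2 zero_le_one
  have i1 : (1 : ℝ) ∈ Icc (0 : ℝ) 1 := right_mem_Icc.2 zero_le_one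
  have hr := h.r_pos
  have hδ := h.δ_pos
  have hA := h.A_nonneg
  have hH0 : 0 ≤ H := (norm_nonneg _).trans (hH 0 i0)
  obtain ⟨t₀, ht₀, hB⟩ := exists_bound_max hZ hZ'
  set B := max ‖Z t₀‖ ‖Z' t₀‖
  have hB0 : 0 ≤ B := (norm_nonneg _).trans (le_max_left _ _)
  have hZB : ∀ t ∈ Icc (0 : ℝ) 1, ‖Z t‖ ≤ B := fun t ht ↦ (le_max_left _ _).trans (hB t ht)
  have hZB' : ∀ t ∈ Icc (0 : ℝ) 1, ‖Z' t‖ ≤ B := fun t ht ↦ (le_max_right _ _).trans (hB t ht)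
  have hε' : 0 < ε / 24 := by positivity
  -- All first order errors below add up to 11tη, which stays below tε.
  set η := ε / 24
  obtain ⟨w₀, hw₀, σ, hσ, hσ0, hσS⟩ := h.exists_curve _ (hcS 0 i0)
    (by linarith [hcδ 0 i0]) _ hK₀ η hε'
  obtain ⟨w₁, hw₁, τ, hτ, hτ0, hτS⟩ := h.exists_curve _ (hcS 1 i1)
    (by linarith [hcδ 1 i1]) _ hK₁ η hε'
  -- An upper bound, after division by t, for the displacement of the varied geodesic from c.
  set B' := B + 2 * (4 * η + H + A * B ^ 2)
  have hB'0 : 0 ≤ B' := by positivity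
  -- The variation parameter is chosen last: small enough that all points stay in the coordinate
  -- balls and that each error of order t² is at most tη.
  obtain ⟨t, hσS, hτS, hσt, hτt, e1, e2, e3, e4, e5, e6, (ht : 0 < t)⟩ :=
    (hσS.and <| hτS.and <| (eventually_norm_sub_le hσ hε').and <|
      (eventually_norm_sub_le hτ hε').and <|
      (eventually_mul_lt B (half_pos hr)).and <| (eventually_mul_lt (B + 2 * η) (half_pos hδ)).and <|
      (eventually_mul_lt B' (half_pos hδ)).and <| (eventually_mul_lt (A * B ^ 2) hε').and <|
      (eventually_mul_lt (1 / r * B' ^ 2) hε').and <| (eventually_mul_lt 1 zero_lt_one).and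
      self_mem_nhdsWithin).exists
  have hend : ∀ {w v x y : E} {a : E}, ‖w - v‖ < η → ‖y - x - t • w‖ ≤ t * η → x = a →
      ‖a + t • v - y‖ ≤ t * (2 * η) := by
    rintro w v x y a h1 h2 rfl
    have : x + t • v - y = -(y - x - t • w) - t • (w - v) := by module
    rw [this]
    refine (norm_sub_le _ _).trans ?_
    rw [norm_neg, norm_smul, Real.norm_of_nonneg ht.le]
    have := mul_le_mul_of_nonneg_left h1.le ht.le
    linarith
  have hz0 := hend hw₀ hσt hσ0
  have hz1 := hend hw₁ hτt hτ0
  have hnear : ∀ {a v y : E}, ‖a - p‖ ≤ δ / 2 → ‖v‖ ≤ B → ‖a + t • v - y‖ ≤ t * (2 * η) →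
      ‖y - p‖ ≤ δ := by
    intro a v y h1 h2 h3
    have : y - p = (a - p) + t • v - (a + t • v - y) := by abel
    rw [this]
    refine (norm_sub_le _ _).trans ?_
    have h4 := norm_add_le (a - p) (t • v)
    rw [norm_smul, Real.norm_of_nonneg ht.le] at h4
    have := mul_le_mul_of_nonneg_left h2 ht.le
    linarith
  -- The varied geodesic, inside S by convexity. It is compared with c + tZ, which has almost the
  -- same ends and satisfies the spray equation up to tH + O(t²).
  obtain ⟨g, g', g0, g1, hg, hgr, hgS, -⟩ := h.exists_geodesic _ hσS
    (hnear (hcδ 0 i0) (hZB 0 i0) hz0) _ hτS (hnear (hcδ 1 i1) (hZB 1 i1) hz1)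
  have hcr' : ∀ s ∈ Icc (0 : ℝ) 1, (c s, c' s) ∈ Metric.closedBall (p, (0 : E)) r := fun s hs ↦
    mem_closedBall_prod_iff.2 ⟨by linarith [hcp s hs], by linarith [hcr s hs]⟩
  have hzr : ∀ s ∈ Icc (0 : ℝ) 1,
      (c s + t • Z s, c' s + t • Z' s) ∈ Metric.closedBall (p, (0 : E)) r := by
    intro s hs
    have h1 : ∀ v : E, ‖v‖ ≤ B → ‖t • v‖ ≤ r / 2 := fun v hv ↦ by
      rw [norm_smul, Real.norm_of_nonneg ht.le]
      have := mul_le_mul_of_nonneg_left hv ht.le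
      linarith
    refine mem_closedBall_prod_iff.2 ⟨?_, ?_⟩
    · rw [add_sub_right_comm]
      exact (norm_add_le _ _).trans (by linarith [hcp s hs, h1 _ (hZB s hs)])
    · exact (norm_add_le _ _).trans (by linarith [hcr s hs, h1 _ (hZB' s hs)])
  have hres : ∀ s ∈ Icc (0 : ℝ) 1, ‖-F (c s, c' s) + t • Z'' s + F (c s + t • Z s, c' s + t • Z' s)‖
      ≤ t * H + t * (t * (A * B ^ 2)) := by
    intro s hs
    have h1 := h.taylor _ (hcr' s hs) _ (hzr s hs)
    have h2 : ((c s + t • Z s, c' s + t • Z' s) : E × E) - (c s, c' s) = t • (Z s, Z' s) := by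
      ext <;> simp
    rw [h2, map_smul, norm_smul, Real.norm_of_nonneg ht.le, Prod.norm_def] at h1
    have h3 : -F (c s, c' s) + t • Z'' s + F (c s + t • Z s, c' s + t • Z' s) =
        t • (Z'' s + fderiv ℝ F (c s, c' s) (Z s, Z' s)) +
        (F (c s + t • Z s, c' s + t • Z' s) - F (c s, c' s) -
          t • fderiv ℝ F (c s, c' s) (Z s, Z' s)) := by module
    rw [h3]
    refine (norm_add_le _ _).trans (add_le_add ?_ (h1.trans ?_))
    · rw [norm_smul, Real.norm_of_nonneg ht.le]
      exact mul_le_mul_of_nonneg_left (hH s hs) ht.le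
    · have h4 : max ‖Z s‖ ‖Z' s‖ ≤ B := hB s hs
      calc A * (t * max ‖Z s‖ ‖Z' s‖) ^ 2 ≤ A * (t * B) ^ 2 := by gcongr
        _ = t * (t * (A * B ^ 2)) := by ring
  have hcmp := (le_max_left _ _).trans (norm_sub_le_of_boundary_values h.lip hg hgr
    (z := fun s ↦ c s + t • Z s) (z' := fun s ↦ c' s + t • Z' s)
    (z'' := fun s ↦ -F (c s, c' s) + t • Z'' s)
    (fun s hs ↦ (hc s hs).1.add ((hZ s hs).const_smul t))
    (fun s hs ↦ (hc s hs).2.add ((hZ' s hs).const_smul t)) hzr hres hs)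
  rw [g0, g1] at hcmp
  have hq : ‖c s + t • Z s - g s‖ ≤ t * (2 * (4 * η + H + t * (A * B ^ 2))) := by
    linarith
  have hq' : ‖g s - c s‖ ≤ t * B' := by
    have h1 : g s - c s = t • Z s - (c s + t • Z s - g s) := by abel
    rw [h1]
    refine (norm_sub_le _ _).trans ?_
    rw [norm_smul, Real.norm_of_nonneg ht.le]
    have h2 : t * (A * B ^ 2) ≤ A * B ^ 2 := mul_le_of_le_one_left (by positivity) (by linarith)
    calc t * ‖Z s‖ + ‖c s + t • Z s - g s‖
        ≤ t * B + t * (2 * (4 * η + H + A * B ^ 2)) := by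
          refine add_le_add (mul_le_mul_of_nonneg_left (hZB s hs) ht.le) (hq.trans ?_)
          gcongr
      _ = t * B' := by simp only [B']; ring
  have hgp : ‖g s - p‖ ≤ δ := by
    have := norm_add_le (g s - c s) (c s - p)
    rw [sub_add_sub_cancel] at this
    linarith [hcδ s hs]
  -- A second use of convexity: the geodesic from c s to g s has its initial velocity in the cone at
  -- c s. That velocity is g s - c s up to O(t²), so after division by t it approximates Z s.
  obtain ⟨f, f', f0, f1, hf, hfr, -, hfK⟩ := h.exists_geodesic _ (hcS s hs)
    (by linarith [hcδ s hs]) _ (hgS s hs) hgp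
  have hfv := norm_deriv_sub_le_of_sprayCurve h.hom hr h.lip hf hfr i0
  rw [f0, f1] at hfv
  refine ⟨t⁻¹ • f' 0, h.smul_mem _ _ hfK _ (by positivity), ?_⟩
  have h1 : t⁻¹ • f' 0 - Z s
      = t⁻¹ • ((f' 0 - (g s - c s)) - (c s + t • Z s - g s)) := by
    have : Z s = t⁻¹ • (t • Z s) := by rw [smul_smul, inv_mul_cancel₀ ht.ne', one_smul]
    nth_rewrite 1 [this]
    module
  rw [h1, norm_smul, norm_inv, Real.norm_of_nonneg ht.le, inv_mul_le_iff₀ ht]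
  refine (norm_sub_le _ _).trans ?_
  have h2 : ‖f' 0 - (g s - c s)‖ ≤ t * (t * (1 / r * B' ^ 2)) := by
    refine hfv.trans ?_
    calc 1 / r * ‖g s - c s‖ ^ 2 ≤ 1 / r * (t * B') ^ 2 := by gcongr
      _ = t * (t * (1 / r * B' ^ 2)) := by ring
  have h3 : t * (t * (1 / r * B' ^ 2)) ≤ t * η := mul_le_mul_of_nonneg_left e5.le ht.le
  have h4 : t * (2 * (4 * η + H + t * (A * B ^ 2))) ≤ t * (2 * (4 * η + H + η)) := by gcongr
  have h5 : t * η + t * (2 * (4 * η + H + η)) ≤ t * (2 * H + ε) := by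
    have : t * η + t * (2 * (4 * η + H + η)) = t * (2 * H + 11 * η) := by ring
    rw [this]
    gcongr
    simp only [η]
    linarith
  linarith

end Variation

/-! ### Linear differential equations and fundamental solutions -/

section LinearODE

theorem eq_of_hasDerivAt_zero {V : Type*} [NormedAddCommGroup V] [NormedSpace ℝ V] {f : ℝ → V}
    {s : Set ℝ} (hs : Convex ℝ s) (hf : ∀ t ∈ s, HasDerivAt f 0 t) {a b : ℝ} (ha : a ∈ s)
    (hb : b ∈ s) : f a = f b := by
  have := hs.norm_image_sub_le_of_norm_hasDerivWithin_le (C := 0)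
    (fun t ht ↦ (hf t ht).hasDerivWithinAt) (by simp) hb ha
  simpa [sub_eq_zero] using this

/-- Local existence for linear differential equations. -/
theorem exists_hasDerivAt_linear {X : Type*} [NormedAddCommGroup X] [NormedSpace ℝ X]
    [CompleteSpace X] {A : ℝ → X →L[ℝ] X} {t₀ : ℝ} (hA : ∀ᶠ t in 𝓝 t₀, ContinuousAt A t) (x₀ : X) :
    ∃ x : ℝ → X, x t₀ = x₀ ∧ ∀ᶠ t in 𝓝 t₀, HasDerivAt x (A t (x t)) t := by
  set B := ‖A t₀‖ + 1
  have hB : ∀ᶠ t in 𝓝 t₀, ‖A t‖ < B :=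
    hA.self_of_nhds.norm.eventually_lt continuousAt_const (by simp [B])
  obtain ⟨ε, hε, hball⟩ := Metric.nhds_basis_closedBall.mem_iff.1 (hA.and hB)
  have hB0 : 0 < B := by positivity
  have hL0 : 0 < B * (‖x₀‖ + 1) := by positivity
  -- On the unit ball around x₀ the right-hand side is bounded by B (‖x₀‖ + 1), so a solution cannot
  -- leave this ball before time T.
  set T := min ε (1 / (B * (‖x₀‖ + 1)))
  have hT : 0 < T := by positivity
  have hmem : ∀ t ∈ Icc (t₀ - T) (t₀ + T), ContinuousAt A t ∧ ‖A t‖ < B := by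
    intro t ht
    apply hball
    rw [mem_closedBall_iff_norm, Real.norm_eq_abs, abs_le]
    constructor <;> linarith [ht.1, ht.2, min_le_left ε (1 / (B * (‖x₀‖ + 1)))]
  have hpl : IsPicardLindelof (fun t x ↦ A t x) (tmin := t₀ - T) (tmax := t₀ + T)
      ⟨t₀, by constructor <;> linarith⟩ x₀ 1 0 ⟨B * (‖x₀‖ + 1), hL0.le⟩ ⟨B, hB0.le⟩ := by
    refine ⟨fun t ht ↦ ?_, fun x _ t ht ↦ ?_, fun t ht x hx ↦ ?_, ?_⟩
    · refine ((A t).lipschitz.weaken ?_).lipschitzOnWith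
      exact_mod_cast (hmem t ht).2.le
    · exact ((hmem t ht).1.clm_apply continuousAt_const).continuousWithinAt
    · refine ((A t).le_opNorm x).trans ?_
      have h1 : ‖x‖ ≤ ‖x₀‖ + 1 := by
        have h2 : ‖x - x₀‖ ≤ 1 := by simpa [dist_eq_norm] using hx
        have h3 := norm_add_le (x - x₀) x₀
        rw [sub_add_cancel] at h3
        linarith
      exact mul_le_mul (hmem t ht).2.le h1 (norm_nonneg _) hB0.le
    · simp only [add_sub_cancel_left, sub_sub_cancel, max_self, NNReal.coe_one,
        NNReal.coe_zero, sub_zero]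
      calc B * (‖x₀‖ + 1) * T ≤ B * (‖x₀‖ + 1) * (1 / (B * (‖x₀‖ + 1))) := by
            gcongr
            exact min_le_right _ _
        _ = 1 := by field_simp
  obtain ⟨x, hx0, hx⟩ := hpl.exists_eq_forall_mem_Icc_hasDerivWithinAt₀
  refine ⟨x, hx0, ?_⟩
  filter_upwards [Ioo_mem_nhds (show t₀ - T < t₀ by linarith) (show t₀ < t₀ + T by linarith)]
    with t ht
  exact (hx t (Ioo_subset_Icc_self ht)).hasDerivAt (Icc_mem_nhds ht.1 ht.2)

/-- Local existence of a fundamental solution `Φ` with inverse `Ψ` for `W' = -A W`. -/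
theorem exists_frame {E : Type*} [NormedAddCommGroup E] [NormedSpace ℝ E] [FiniteDimensional ℝ E]
    {A : ℝ → E →L[ℝ] E} {t₀ : ℝ} (hA : ∀ᶠ t in 𝓝 t₀, ContinuousAt A t) :
    ∃ T > 0, ∃ Φ Ψ : ℝ → E →L[ℝ] E, ∃ B > 0, Φ t₀ = ContinuousLinearMap.id ℝ E ∧
      ∀ t ∈ Ioo (t₀ - T) (t₀ + T), ‖Φ t‖ ≤ B ∧ ‖Ψ t‖ ≤ B ∧ (∀ u, Ψ t (Φ t u) = u) ∧
        (∀ u, Φ t (Ψ t u) = u) ∧ (∀ u, HasDerivAt (fun t ↦ Φ t u) (-(A t (Φ t u))) t) ∧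
        HasDerivAt Ψ ((Ψ t).comp (A t)) t := by
  have : CompleteSpace E := FiniteDimensional.complete ℝ E
  let L := ContinuousLinearMap.compL ℝ E E E
  obtain ⟨Φ, hΦ0, hΦ⟩ := exists_hasDerivAt_linear (A := fun t ↦ -L (A t)) (t₀ := t₀)
    (hA.mono fun t ht ↦ (L.continuous.continuousAt.comp ht).neg) (ContinuousLinearMap.id ℝ E)
  obtain ⟨Ψ, hΨ0, hΨ⟩ := exists_hasDerivAt_linear (A := fun t ↦ L.flip (A t)) (t₀ := t₀)
    (hA.mono fun t ht ↦ L.flip.continuous.continuousAt.comp ht) (ContinuousLinearMap.id ℝ E)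
  set B := max ‖Φ t₀‖ ‖Ψ t₀‖ + 1
  have hΦB : ∀ᶠ t in 𝓝 t₀, ‖Φ t‖ < B := hΦ.self_of_nhds.continuousAt.norm.eventually_lt
    continuousAt_const (lt_of_le_of_lt (le_max_left _ _) (lt_add_one _))
  have hΨB : ∀ᶠ t in 𝓝 t₀, ‖Ψ t‖ < B := hΨ.self_of_nhds.continuousAt.norm.eventually_lt
    continuousAt_const (lt_of_le_of_lt (le_max_right _ _) (lt_add_one _))
  obtain ⟨T, hT, hball⟩ := Metric.nhds_basis_ball.mem_iff.1 (hΦ.and (hΨ.and (hΦB.and hΨB)))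
  rw [Real.ball_eq_Ioo] at hball
  have hΦu : ∀ t ∈ Ioo (t₀ - T) (t₀ + T), ∀ u, HasDerivAt (fun t ↦ Φ t u) (-(A t (Φ t u))) t := by
    intro t ht u
    simpa [L] using (hball ht).1.clm_apply (hasDerivAt_const t u)
  have hΨ' : ∀ t ∈ Ioo (t₀ - T) (t₀ + T), HasDerivAt Ψ ((Ψ t).comp (A t)) t := by
    intro t ht
    simpa [L] using (hball ht).2.1
  have hinv : ∀ t ∈ Ioo (t₀ - T) (t₀ + T), ∀ u, Ψ t (Φ t u) = u := by
    intro t ht u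
    have h1 : ∀ s ∈ Ioo (t₀ - T) (t₀ + T), HasDerivAt (fun t ↦ Ψ t (Φ t u)) 0 s := by
      intro s hs
      simpa using (hΨ' s hs).clm_apply (hΦu s hs u)
    have h2 := eq_of_hasDerivAt_zero (convex_Ioo _ _) h1 ht
      (show t₀ ∈ Ioo (t₀ - T) (t₀ + T) by constructor <;> linarith)
    simpa [hΦ0, hΨ0] using h2
  refine ⟨T, hT, Φ, Ψ, B, by positivity, hΦ0, fun t ht ↦ ⟨(hball ht).2.2.1.le, (hball ht).2.2.2.le,
    hinv t ht, fun u ↦ ?_, hΦu t ht, hΨ' t ht⟩⟩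
  -- The differential equations only conserve ΨΦ, making Ψ a left inverse; finite dimension makes it
  -- two-sided.
  have hinj : Function.Injective (Φ t : E →ₗ[ℝ] E) :=
    Function.LeftInverse.injective (g := Ψ t) (hinv t ht)
  obtain ⟨v, rfl⟩ := LinearMap.injective_iff_surjective.1 hinj u
  exact congrArg (Φ t) (hinv t ht v)

end LinearODE

/-! ### The Jacobi operator in coordinates -/

section Fields

variable {E : Type*} [NormedAddCommGroup E] [NormedSpace ℝ E]

/-- The geodesic spray `(y, u) ↦ Γ_y(u, u)`. -/
def sprayOf (Γ : E → E →L[ℝ] E →L[ℝ] E) (z : E × E) : E := Γ z.1 z.2 z.2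

theorem sprayOf_hom (Γ : E → E →L[ℝ] E →L[ℝ] E) (y u : E) (a : ℝ) :
    sprayOf Γ (y, a • u) = a ^ 2 • sprayOf Γ (y, u) := by
  simp [sprayOf, smul_smul, pow_two]

/-- The chain rule, for normed spaces. -/
theorem hasFDerivAt_comp_normed {V X : Type*} [NormedAddCommGroup V] [NormedSpace ℝ V]
    [NormedAddCommGroup X] [NormedSpace ℝ X] {G : E → V} {G' : E →L[ℝ] V} {f : X → E} {x : X}
    {f' : X →L[ℝ] E} (hG : HasFDerivAt G G' (f x)) (hf : HasFDerivAt f f' x) :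
    HasFDerivAt (fun q ↦ G (f q)) (G'.comp f') x :=
  hG.comp x hf

theorem hasFDerivAt_bilinear_diag {V : Type*} [NormedAddCommGroup V] [NormedSpace ℝ V]
    {G : E → E →L[ℝ] E →L[ℝ] V} {y : E} (hG : DifferentiableAt ℝ G y) (u : E) :
    ∃ L : E × E →L[ℝ] V, HasFDerivAt (fun z : E × E ↦ G z.1 z.2 z.2) L (y, u) ∧
      ∀ z w, L (z, w) = fderiv ℝ G y z u u + (G y w u + G y u w) := by
  have h1 : HasFDerivAt (fun q : E × E ↦ G q.1) ((fderiv ℝ G y).comp (ContinuousLinearMap.fst ℝ E E))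
      (y, u) := hasFDerivAt_comp_normed (V := E →L[ℝ] E →L[ℝ] V) (G := G) (f := Prod.fst)
        (x := (y, u)) hG.hasFDerivAt hasFDerivAt_fst
  have h2 : HasFDerivAt (fun q : E × E ↦ q.2) (ContinuousLinearMap.snd ℝ E E) (y, u) :=
    hasFDerivAt_snd
  refine ⟨_, (h1.clm_apply h2).clm_apply h2, fun z w ↦ ?_⟩
  simp
  abel

/-- Symmetry of Γ merges the two velocity terms. With (z, w) = (Z, Z') this is the term that Z''
must balance in the linearized geodesic equation, that is, the Jacobi equation. -/
theorem fderiv_sprayOf {Γ : E → E →L[ℝ] E →L[ℝ] E} {y : E} (hΓ : DifferentiableAt ℝ Γ y)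
    (hsymm : ∀ u v, Γ y u v = Γ y v u) (u z w : E) :
    fderiv ℝ (sprayOf Γ) (y, u) (z, w) = fderiv ℝ Γ y z u u + (2 : ℝ) • Γ y u w := by
  obtain ⟨L, hL, hL'⟩ := hasFDerivAt_bilinear_diag hΓ u
  have h3 : HasFDerivAt (sprayOf Γ) L (y, u) := hL
  rw [h3.fderiv, hL', hsymm w u, two_smul]

/-- The curvature tensor of the connection with Christoffel symbols `Γ`. -/
def bilinCurvature (Γ : E → E →L[ℝ] E →L[ℝ] E) (y u v w : E) : E :=
  fderiv ℝ Γ y u v w - fderiv ℝ Γ y v u w + Γ y u (Γ y v w) - Γ y v (Γ y u w)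

/-- The second covariant derivative and curvature term of a product `f W`, `W` parallel. -/
theorem jacobi_residual {Γ : E → E →L[ℝ] E →L[ℝ] E} {c c' W : ℝ → E} {t : ℝ}
    (hΓ : DifferentiableAt ℝ Γ (c t)) (hsymm : ∀ u v, Γ (c t) u v = Γ (c t) v u)
    (hsymm' : ∀ a u v, fderiv ℝ Γ (c t) a u v = fderiv ℝ Γ (c t) a v u)
    (hc : HasDerivAt c (c' t) t) (hc' : HasDerivAt c' (-sprayOf Γ (c t, c' t)) t)
    (hW : HasDerivAt W (-Γ (c t) (c' t) (W t)) t) :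
    ∃ W₂, HasDerivAt (fun t ↦ -Γ (c t) (c' t) (W t)) W₂ t ∧
      W₂ + fderiv ℝ (sprayOf Γ) (c t, c' t) (W t, -Γ (c t) (c' t) (W t)) =
        bilinCurvature Γ (c t) (W t) (c' t) (c' t) := by
  refine ⟨_, (hasDerivAt_comp_bilinear hΓ hc hc' hW).neg, ?_⟩
  rw [fderiv_sprayOf hΓ hsymm, bilinCurvature]
  simp only [sprayOf, map_neg, neg_apply]
  rw [hsymm (W t) (c' t), hsymm (Γ (c t) (c' t) (c' t)) (W t),
    hsymm' (c' t) (c' t) (W t)]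
  module

end Fields

/-! ### Convexity of tangent cones and a single step of parallel translation -/

section Cones

variable {E : Type*} [NormedAddCommGroup E] [NormedSpace ℝ E]

section Spray

variable {F : E × E → E} {p : E} {r δ A : ℝ} {S : Set E} {K : E → Set E}

theorem IsLocallyConvex.zero_mem (h : IsLocallyConvex F p r δ A S K) {x : E} (hx : x ∈ S)
    (hxp : ‖x - p‖ ≤ δ) : (0 : E) ∈ K x := by
  obtain ⟨c, c', -, -, -, -, -, hK⟩ := h.exists_geodesic x hx hxp x hx hxp
  simpa using h.smul_mem x _ hK 0 le_rfl

/-- The variational estimate along the constant geodesic x: the affine interpolation of v and w has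
no residual, because the spray has zero derivative at zero velocity. Hence the midpoint lies in the
closed cone, and doubling it gives the sum. -/
theorem IsLocallyConvex.add_mem (h : IsLocallyConvex F p r δ A S K) {x : E} (hx : x ∈ S)
    (hxr : ‖x - p‖ ≤ r / 2) (hxδ : ‖x - p‖ ≤ δ / 2) {v w : E} (hv : v ∈ K x) (hw : w ∈ K x) :
    v + w ∈ K x := by
  -- Differentiability is not needed: where it fails, `fderiv` is zero by convention.
  have hd : fderiv ℝ F (x, 0) = 0 := by
    by_cases hd : DifferentiableAt ℝ F (x, 0)
    · exact fderiv_spray_zero h.hom hd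
    · exact fderiv_zero_of_not_differentiableAt hd
  have hmid : (1 / 2 : ℝ) • v + (1 / 2 : ℝ) • w ∈ closure (K x) := by
    rw [Metric.mem_closure_iff]
    intro ε hε
    obtain ⟨u, hu, hu'⟩ := h.exists_mem_norm_sub_le (c := fun _ ↦ x) (c' := fun _ ↦ 0)
      (Z := fun t ↦ (1 - t) • v + t • w) (Z' := fun _ ↦ w - v) (Z'' := fun _ ↦ 0) (H := 0)
      (isSprayCurveOn_const x (spray_zero h.hom x) _) (fun _ _ ↦ hx) (fun _ _ ↦ hxr)
      (fun _ _ ↦ hxδ) (fun _ _ ↦ by simpa using (half_pos h.r_pos).le)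
      (fun t _ ↦ by
        have := (((hasDerivAt_id t).const_sub 1).smul_const v).add ((hasDerivAt_id t).smul_const w)
        convert! this using 1
        module)
      (fun t _ ↦ hasDerivAt_const _ _) (fun t _ ↦ by simp [hd]) (by simpa using hv)
      (by simpa using hw) (s := 1 / 2) ⟨by norm_num, by norm_num⟩ (half_pos hε)
    refine ⟨u, hu, ?_⟩
    rw [dist_comm, dist_eq_norm]
    have h1 : (1 - 1 / 2 : ℝ) = 1 / 2 := by norm_num
    rw [h1] at hu'
    linarith
  rw [(h.isClosed x).closure_eq] at hmid
  have := h.smul_mem x _ hmid 2 zero_le_two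
  rwa [← smul_add, smul_smul, show (2 : ℝ) * (1 / 2) = 1 by norm_num, one_smul] at this

end Spray

theorem map_smul_normed {V W : Type*} [NormedAddCommGroup V] [NormedSpace ℝ V]
    [NormedAddCommGroup W] [NormedSpace ℝ W] (D : V →L[ℝ] W) (a : ℝ) (x : V) :
    D (a • x) = a • D x :=
  map_smul D a x

theorem map_add_normed {V W : Type*} [NormedAddCommGroup V] [NormedSpace ℝ V]
    [NormedAddCommGroup W] [NormedSpace ℝ W] (D : V →L[ℝ] W) (x y : V) :
    D (x + y) = D x + D y :=
  map_add D x y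

theorem norm_bilinCurvature_le {Γ : E → E →L[ℝ] E →L[ℝ] E} {y u : E} {a b g : ℝ}
    (ha0 : 0 ≤ a) (hg0 : 0 ≤ g)
    (hD : ∀ x₁ x₂ x₃ : E, ‖fderiv ℝ Γ y x₁ x₂ x₃‖ ≤ a * ‖x₁‖ * ‖x₂‖ * ‖x₃‖)
    (hΓ : ∀ x₁ x₂ : E, ‖Γ y x₁ x₂‖ ≤ g * ‖x₁‖ * ‖x₂‖) (hb : ‖u‖ ≤ b) (w : E) :
    ‖bilinCurvature Γ y w u u‖ ≤ (2 * a * b ^ 2 + 2 * g ^ 2 * b ^ 2) * ‖w‖ := by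
  have hb0 : 0 ≤ b := (norm_nonneg _).trans hb
  have h1 : ‖fderiv ℝ Γ y w u u‖ ≤ a * ‖w‖ * b * b := (hD _ _ _).trans (by gcongr)
  have h2 : ‖fderiv ℝ Γ y u w u‖ ≤ a * b * ‖w‖ * b := (hD _ _ _).trans (by gcongr)
  have h3 : ‖Γ y w (Γ y u u)‖ ≤ g * ‖w‖ * (g * b * b) :=
    (hΓ _ _).trans (mul_le_mul_of_nonneg_left ((hΓ _ _).trans (by gcongr)) (by positivity))
  have h4 : ‖Γ y u (Γ y w u)‖ ≤ g * b * (g * ‖w‖ * b) := by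
    refine (hΓ _ _).trans (mul_le_mul (by gcongr) ((hΓ _ _).trans (by gcongr)) (norm_nonneg _)
      (by positivity))
  rw [bilinCurvature]
  refine (norm_sub_le _ _).trans ?_
  refine (add_le_add_left ((norm_add_le _ _).trans (add_le_add_left (norm_sub_le _ _) _)) _).trans ?_
  linarith

/-- Affine reparametrization of derivatives. -/
theorem hasDerivAt_comp_affine {f : ℝ → E} {f' : E} {α l t : ℝ} (h : HasDerivAt f f' (α + l * t)) :
    HasDerivAt (fun t ↦ f (α + l * t)) (l • f') t := by
  have h1 : HasDerivAt (fun t : ℝ ↦ α + l * t) l t := by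
    simpa using ((hasDerivAt_id t).const_mul l).const_add α
  exact h.scomp t h1

variable {Γ : E → E →L[ℝ] E →L[ℝ] E} {p : E} {r δ A : ℝ} {S : Set E} {K : E → Set E}

/-- Regularity and symmetry of Christoffel symbols on a set. -/
structure IsSymmChristoffelOn (Γ : E → E →L[ℝ] E →L[ℝ] E) (U : Set E) : Prop where
  diff : ∀ y ∈ U, DifferentiableAt ℝ Γ y
  symm : ∀ y ∈ U, ∀ u v, Γ y u v = Γ y v u
  symm_fderiv : ∀ y ∈ U, ∀ a u v, fderiv ℝ Γ y a u v = fderiv ℝ Γ y a v u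

/-- Rescaling a time interval of length |l| to the unit interval multiplies both Z'' and the terms
quadratic in (c', d/dt) by l², and hence also the residual. Errors on short pieces are therefore
quadratic in their length. -/
theorem IsLocallyConvex.exists_mem_norm_sub_le_affine
    (h : IsLocallyConvex (sprayOf Γ) p r δ A S K)
    (hΓ : IsSymmChristoffelOn Γ (Metric.closedBall p r)) {c c' Z Z' Z'' : ℝ → E} {H : ℝ}
    {I : Set ℝ} (hc : IsSprayCurveOn (sprayOf Γ) c c' I) (hcS : ∀ t ∈ I, c t ∈ S)
    (hcp : ∀ t ∈ I, ‖c t - p‖ ≤ r / 2) (hcδ : ∀ t ∈ I, ‖c t - p‖ ≤ δ / 2) {α l : ℝ}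
    (hI : ∀ t ∈ Icc (0 : ℝ) 1, α + l * t ∈ I) (hcr : ∀ t ∈ I, |l| * ‖c' t‖ ≤ r / 2)
    (hZ : ∀ t ∈ I, HasDerivAt Z (Z' t) t) (hZ' : ∀ t ∈ I, HasDerivAt Z' (Z'' t) t)
    (hH : ∀ t ∈ I, ‖Z'' t + fderiv ℝ (sprayOf Γ) (c t, c' t) (Z t, Z' t)‖ ≤ H)
    (hK₀ : Z α ∈ K (c α)) (hK₁ : Z (α + l) ∈ K (c (α + l))) {s : ℝ} (hs : s ∈ Icc (0 : ℝ) 1)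
    {ε : ℝ} (hε : 0 < ε) : ∃ u ∈ K (c (α + l * s)), ‖u - Z (α + l * s)‖ ≤ 2 * (l ^ 2 * H) + ε := by
  refine h.exists_mem_norm_sub_le (c := fun t ↦ c (α + l * t)) (c' := fun t ↦ l • c' (α + l * t))
    (Z := fun t ↦ Z (α + l * t)) (Z' := fun t ↦ l • Z' (α + l * t))
    (Z'' := fun t ↦ l • l • Z'' (α + l * t)) (hc.comp_affine (sprayOf_hom Γ) α l hI)
    (fun t ht ↦ hcS _ (hI t ht)) (fun t ht ↦ hcp _ (hI t ht)) (fun t ht ↦ hcδ _ (hI t ht))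
    (fun t ht ↦ ?_) (fun t ht ↦ hasDerivAt_comp_affine (hZ _ (hI t ht)))
    (fun t ht ↦ (hasDerivAt_comp_affine (hZ' _ (hI t ht))).const_smul l) (fun t ht ↦ ?_)
    (by simpa using hK₀) (by simpa using hK₁) hs hε
  · rw [norm_smul, Real.norm_eq_abs]
    exact hcr _ (hI t ht)
  · have hy : c (α + l * t) ∈ Metric.closedBall p r := by
      rw [mem_closedBall_iff_norm]
      linarith [hcp _ (hI t ht), h.r_pos]
    have h1 := hH _ (hI t ht)
    rw [fderiv_sprayOf (hΓ.diff _ hy) (hΓ.symm _ hy)] at h1 ⊢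
    have h2 : ∀ z z' z'' : E, l • l • z'' + (fderiv ℝ Γ (c (α + l * t)) z (l • c' (α + l * t))
        (l • c' (α + l * t)) + (2 : ℝ) • Γ (c (α + l * t)) (l • c' (α + l * t)) (l • z')) =
        (l ^ 2) • (z'' + (fderiv ℝ Γ (c (α + l * t)) z (c' (α + l * t)) (c' (α + l * t)) +
          (2 : ℝ) • Γ (c (α + l * t)) (c' (α + l * t)) z')) := by
      intro z z' z''
      simp only [map_smul, smul_apply]
      module
    rw [h2, norm_smul, Real.norm_of_nonneg (sq_nonneg l)]
    gcongr

/-- A parallel frame `Φ` with inverse `Ψ` along a geodesic `c` in `S`, with uniform bounds. -/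
structure IsGeodesicFrame (Γ : E → E →L[ℝ] E →L[ℝ] E) (p : E) (r δ : ℝ) (S : Set E)
    (c c' : ℝ → E) (Φ Ψ : ℝ → E →L[ℝ] E) (I : Set ℝ) (b B Q : ℝ) : Prop where
  spray : IsSprayCurveOn (sprayOf Γ) c c' I
  mem : ∀ t ∈ I, c t ∈ S
  near_r : ∀ t ∈ I, ‖c t - p‖ ≤ r / 2
  near_δ : ∀ t ∈ I, ‖c t - p‖ ≤ δ / 2
  speed : ∀ t ∈ I, ‖c' t‖ ≤ b
  norm_le : ∀ t ∈ I, ‖Φ t‖ ≤ B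
  norm_le' : ∀ t ∈ I, ‖Ψ t‖ ≤ B
  left_inv : ∀ t ∈ I, ∀ u, Ψ t (Φ t u) = u
  right_inv : ∀ t ∈ I, ∀ u, Φ t (Ψ t u) = u
  parallel : ∀ t ∈ I, ∀ u, HasDerivAt (fun t ↦ Φ t u) (-Γ (c t) (c' t) (Φ t u)) t
  curv : ∀ t ∈ I, ∀ w, ‖bilinCurvature Γ (c t) w (c' t) (c' t)‖ ≤ Q * ‖w‖

variable {c c' : ℝ → E} {Φ Ψ : ℝ → E →L[ℝ] E} {I : Set ℝ} {b B Q : ℝ}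

/-- Multiply the parallel field Φu by the affine function f that is 1 at s and 0 at s + 2k. Since
f'' = 0, the residual is only f times a curvature term. At the far end the field is 0, which lies in
every cone, so nothing has to be known about the cone there. At the midpoint the field is half the
parallel field, and doubling the nearby cone vector stays in the cone. -/
theorem IsGeodesicFrame.step (hf : IsGeodesicFrame Γ p r δ S c c' Φ Ψ I b B Q)
    (h : IsLocallyConvex (sprayOf Γ) p r δ A S K)
    (hΓ : IsSymmChristoffelOn Γ (Metric.closedBall p r)) (hB : 0 ≤ B) (hQ : 0 ≤ Q) {s k : ℝ}
    (hk : k ≠ 0) (hI : ∀ t ∈ Icc (0 : ℝ) 1, s + 2 * k * t ∈ I) (hkr : 2 * |k| * b ≤ r / 2) {u : E}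
    (hu : Φ s u ∈ K (c s)) :
    ∃ u', Φ (s + k) u' ∈ K (c (s + k)) ∧ ‖u' - u‖ ≤ (B * (16 * Q * B + 1)) * k ^ 2 * (‖u‖ + 1) := by
  set I' := (fun t ↦ s + 2 * k * t) '' Icc (0 : ℝ) 1
  have hI' : I' ⊆ I := by
    rintro _ ⟨t, ht, rfl⟩
    exact hI t ht
  have hball : ∀ t ∈ I', c t ∈ Metric.closedBall p r := fun t ht ↦ by
    rw [mem_closedBall_iff_norm]
    linarith [hf.near_r _ (hI' ht), h.r_pos]
  have hres := fun t ht ↦ jacobi_residual (hΓ.diff _ (hball t ht)) (hΓ.symm _ (hball t ht))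
    (hΓ.symm_fderiv _ (hball t ht)) (hf.spray _ (hI' ht)).1 (hf.spray _ (hI' ht)).2
    (hf.parallel _ (hI' ht) u)
  choose! W₂ hW₂ hW using hres
  let f : ℝ → ℝ := fun t ↦ 1 - (2 * k)⁻¹ * (t - s)
  have hfd : ∀ t, HasDerivAt f (-(2 * k)⁻¹) t := fun t ↦ by
    convert! (((hasDerivAt_id t).sub_const s).const_mul (2 * k)⁻¹).const_sub 1 using 1
    rw [mul_one]
  have hmid : (1 / 2 : ℝ) ∈ Icc (0 : ℝ) 1 := ⟨by norm_num, by norm_num⟩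
  have hk2 : (0 : ℝ) < k ^ 2 := by positivity
  have hend : s + 2 * k ∈ I := by simpa using hI 1 (right_mem_Icc.2 zero_le_one)
  have key := h.exists_mem_norm_sub_le_affine hΓ (hf.spray.mono hI')
    (fun t ht ↦ hf.mem t (hI' ht)) (fun t ht ↦ hf.near_r t (hI' ht))
    (fun t ht ↦ hf.near_δ t (hI' ht)) (α := s) (l := 2 * k) (I := I') (H := Q * (B * ‖u‖))
    (Z := fun t ↦ f t • Φ t u)
    (Z' := fun t ↦ f t • -Γ (c t) (c' t) (Φ t u) + (-(2 * k)⁻¹) • Φ t u)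
    (Z'' := fun t ↦ f t • W₂ t + (-(2 * k)⁻¹) • -Γ (c t) (c' t) (Φ t u) +
      (-(2 * k)⁻¹) • -Γ (c t) (c' t) (Φ t u))
    (fun t ht ↦ ⟨t, ht, rfl⟩) (fun t ht ↦ ?_)
    (fun t ht ↦ (hfd t).smul (hf.parallel t (hI' ht) u))
    (fun t ht ↦ ((hfd t).smul (hW₂ t ht)).add ((hf.parallel t (hI' ht) u).const_smul _))
    (fun t ht ↦ ?_) (by simpa [f] using hu) ?_ (s := 1 / 2) hmid (ε := k ^ 2 / 2) (by positivity)
  · obtain ⟨v, hv, hv'⟩ := key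
    have h1 : s + 2 * k * (1 / 2) = s + k := by ring
    rw [h1] at hv hv'
    have hsk : s + k ∈ I := h1 ▸ hI _ hmid
    have hfs : f (s + k) = 1 / 2 := by
      simp only [f]
      field_simp
      ring
    have h3 : (2 : ℝ) • v ∈ K (c (s + k)) := h.smul_mem _ _ hv _ zero_le_two
    have h4 : Φ (s + k) (Ψ (s + k) ((2 : ℝ) • v)) = (2 : ℝ) • v := hf.right_inv _ hsk _
    refine ⟨Ψ (s + k) ((2 : ℝ) • v), by rwa [h4], ?_⟩
    have h5 : Ψ (s + k) ((2 : ℝ) • v) - u = Ψ (s + k) ((2 : ℝ) • (v - f (s + k) • Φ (s + k) u)) := by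
      rw [hfs, smul_sub, map_sub, smul_smul, show (2 : ℝ) * (1 / 2) = 1 by norm_num, one_smul,
        hf.left_inv _ hsk]
    rw [h5]
    refine ((Ψ (s + k)).le_opNorm _).trans ?_
    rw [norm_smul, Real.norm_two]
    have h6 := norm_nonneg u
    calc ‖Ψ (s + k)‖ * (2 * ‖v - f (s + k) • Φ (s + k) u‖)
        ≤ B * (2 * (2 * ((2 * k) ^ 2 * (Q * (B * ‖u‖))) + k ^ 2 / 2)) := by
          gcongr
          exact hf.norm_le' _ hsk
      _ = k ^ 2 * B * (16 * Q * B * ‖u‖ + 1) := by ring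
      _ ≤ k ^ 2 * B * ((16 * Q * B + 1) * (‖u‖ + 1)) := by
          gcongr
          nlinarith [mul_nonneg (mul_nonneg (by norm_num : (0 : ℝ) ≤ 16) hQ) hB]
      _ = _ := by ring
  · rw [abs_mul, abs_two]
    refine le_trans ?_ hkr
    gcongr
    exact hf.speed t (hI' ht)
  · have h1 : |f t| ≤ 1 := by
      obtain ⟨τ, hτ, rfl⟩ := ht
      have : f (s + 2 * k * τ) = 1 - τ := by
        simp only [f]
        field_simp
        ring
      rw [this, abs_le]
      constructor <;> linarith [hτ.1, hτ.2]
    have h2 := hW t ht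
    rw [fderiv_sprayOf (hΓ.diff _ (hball t ht)) (hΓ.symm _ (hball t ht))] at h2 ⊢
    have h3 : f t • W₂ t + (-(2 * k)⁻¹) • -Γ (c t) (c' t) (Φ t u) +
        (-(2 * k)⁻¹) • -Γ (c t) (c' t) (Φ t u) +
        (fderiv ℝ Γ (c t) (f t • Φ t u) (c' t) (c' t) +
        (2 : ℝ) • Γ (c t) (c' t) (f t • -Γ (c t) (c' t) (Φ t u) + (-(2 * k)⁻¹) • Φ t u)) =
        f t • bilinCurvature Γ (c t) (Φ t u) (c' t) (c' t) := by
      rw [← h2, map_smul_normed (W := E →L[ℝ] E →L[ℝ] E)]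
      simp only [map_smul, map_add, map_neg, smul_apply]
      module
    rw [h3, norm_smul, Real.norm_eq_abs]
    have h4 : ‖Φ t u‖ ≤ B * ‖u‖ := ((Φ t).le_opNorm u).trans (by gcongr; exact hf.norm_le t (hI' ht))
    calc |f t| * ‖bilinCurvature Γ (c t) (Φ t u) (c' t) (c' t)‖ ≤ 1 * (Q * (B * ‖u‖)) := by
          gcongr
          exact (hf.curv t (hI' ht) _).trans (by gcongr)
      _ = _ := one_mul _
  · have : f (s + 2 * k) = 0 := by
      simp only [f, add_sub_cancel_left]
      rw [inv_mul_cancel₀ (by positivity), sub_self]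
    rw [this, zero_smul]
    exact h.zero_mem (hf.mem _ hend) (by linarith [hf.near_δ _ hend, h.δ_pos])

end Cones

/-! ### Parallel invariance of the cones and tangency of the curvature vector -/

section Transport

variable {E : Type*} [NormedAddCommGroup E] [NormedSpace ℝ E]
  {Γ : E → E →L[ℝ] E →L[ℝ] E} {p : E} {r δ A : ℝ} {S : Set E} {K : E → Set E}
  {c c' : ℝ → E} {Φ Ψ : ℝ → E →L[ℝ] E} {b B Q t₀ T : ℝ}

/-- Parallel translation along a short geodesic in `S` preserves the tangent cones of `S`. -/
theorem IsGeodesicFrame.transport_mem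
    (hf : IsGeodesicFrame Γ p r δ S c c' Φ Ψ (Ioo (t₀ - 3 * T) (t₀ + 3 * T)) b B Q)
    (h : IsLocallyConvex (sprayOf Γ) p r δ A S K)
    (hΓ : IsSymmChristoffelOn Γ (Metric.closedBall p r)) (hB : 0 ≤ B) (hQ : 0 ≤ Q) {s t : ℝ}
    (hs : s ∈ Ioo (t₀ - T) (t₀ + T)) (ht : t ∈ Ioo (t₀ - T) (t₀ + T)) {u : E}
    (hu : Φ s u ∈ K (c s)) : Φ t u ∈ K (c t) := by
  rcases eq_or_ne s t with rfl | hst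
  · exact hu
  have hT : 0 < T := by linarith [hs.1, hs.2]
  -- The induction below keeps the current vector within 1 of u, and `IsGeodesicFrame.step` adds
  -- another 1 to its norm.
  set D := (B * (16 * Q * B + 1)) * (‖u‖ + 2)
  have hD : 0 ≤ D := by positivity
  have hsub : Ioo (t₀ - T) (t₀ + T) ⊆ Ioo (t₀ - 3 * T) (t₀ + 3 * T) :=
    Ioo_subset_Ioo (by linarith) (by linarith)
  have key : ∀ ε > 0, ε ≤ 1 → ∃ v, Φ t v ∈ K (c t) ∧ ‖v - u‖ ≤ ε := by
    intro ε hε hε1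
    -- With k = (t - s) / n the n steps cost n · Dk² = D(t - s)² / n. The summand 2 gives |k| < T,
    -- and the last one gives the speed bound required by `IsGeodesicFrame.step`.
    obtain ⟨n, hn⟩ := exists_nat_gt (2 + D * (t - s) ^ 2 / ε + 4 * |t - s| * |b| / r)
    have hr := h.r_pos
    have h1 : 0 ≤ D * (t - s) ^ 2 / ε := by positivity
    have h2 : 0 ≤ 4 * |t - s| * |b| / r := by positivity
    have hn2 : (2 : ℝ) < n := by linarith
    have hn0 : (0 : ℝ) < n := by linarith
    have hnD : D * (t - s) ^ 2 ≤ ε * n := by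
      rw [← div_le_iff₀' hε]
      linarith
    have hnb : 4 * |t - s| * |b| ≤ r * n := by
      rw [← div_le_iff₀' hr]
      linarith
    set k := (t - s) / n
    have hk : k ≠ 0 := div_ne_zero (sub_ne_zero.2 hst.symm) hn0.ne'
    have hnk : n * k = t - s := mul_div_cancel₀ _ hn0.ne'
    have hkabs : n * |k| = |t - s| := by
      rw [← hnk, abs_mul, abs_of_pos hn0]
    have hkT : |k| < T := by
      have h3 : |t - s| < 2 * T := by
        rw [abs_lt]
        constructor <;> linarith [hs.1, hs.2, ht.1, ht.2]
      nlinarith [abs_nonneg k]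
    have hkr : 2 * |k| * b ≤ r / 2 := by
      have h3 : n * (4 * |k| * |b|) ≤ n * r := by
        calc n * (4 * |k| * |b|) = 4 * (n * |k|) * |b| := by ring
          _ ≤ n * r := by rw [hkabs]; linarith
      have h4 := le_of_mul_le_mul_left h3 hn0
      nlinarith [le_abs_self b, abs_nonneg k]
    have hnDk : n * (D * k ^ 2) ≤ ε := by
      have : n * (D * k ^ 2) = D * (t - s) ^ 2 / n := by
        rw [← hnk]
        field_simp
      rw [this, div_le_iff₀ hn0]
      exact hnD
    have ind : ∀ i : ℕ, i ≤ n → ∃ v, Φ (s + i * k) v ∈ K (c (s + i * k)) ∧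
        ‖v - u‖ ≤ i * (D * k ^ 2) := by
      intro i
      induction i with
      | zero => intro _; exact ⟨u, by simpa using hu, by simp⟩
      | succ i ih =>
        intro hi
        obtain ⟨v, hv, hvu⟩ := ih (by omega)
        have hi' : (i : ℝ) ≤ n := by exact_mod_cast (by omega : i ≤ n)
        have hmem : s + i * k ∈ Ioo (t₀ - T) (t₀ + T) := by
          have h5 : s + i * k = (1 - i / n) * s + (i / n) * t := by
            have : t = s + n * k := by linarith
            rw [this]
            field_simp
            ring
          rw [h5]
          exact (convex_Ioo _ _) hs ht (sub_nonneg.2 ((div_le_one hn0).2 hi')) (by positivity)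
            (by ring)
        -- Each step looks ahead by 2|k| < 2T, which is why the frame lives on an interval three
        -- times as long.
        have hI : ∀ τ ∈ Icc (0 : ℝ) 1, s + i * k + 2 * k * τ ∈ Ioo (t₀ - 3 * T) (t₀ + 3 * T) := by
          intro τ hτ
          have h6 : |2 * k * τ| < 2 * T := by
            rw [abs_mul, abs_mul, abs_two, abs_of_nonneg hτ.1]
            nlinarith [abs_nonneg k, hτ.2, hτ.1]
          rw [abs_lt] at h6
          constructor <;> linarith [hmem.1, hmem.2]
        obtain ⟨v', hv', hvv⟩ := hf.step h hΓ hB hQ hk hI hkr hv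
        refine ⟨v', ?_, ?_⟩
        · have : s + ((i + 1 : ℕ) : ℝ) * k = s + i * k + k := by push_cast; ring
          rwa [this]
        · have h7 : (i : ℝ) * (D * k ^ 2) ≤ 1 :=
            (mul_le_mul_of_nonneg_right hi' (by positivity)).trans (hnDk.trans hε1)
          have h8 : ‖v‖ ≤ ‖u‖ + 1 := by
            have := norm_add_le (v - u) u
            rw [sub_add_cancel] at this
            linarith
          have h9 : ‖v' - v‖ ≤ D * k ^ 2 := by
            refine hvv.trans ?_
            calc (B * (16 * Q * B + 1)) * k ^ 2 * (‖v‖ + 1)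
                ≤ (B * (16 * Q * B + 1)) * k ^ 2 * (‖u‖ + 1 + 1) := by gcongr
              _ = D * k ^ 2 := by simp only [D]; ring
          have h10 := norm_add_le (v' - v) (v - u)
          rw [sub_add_sub_cancel] at h10
          push_cast
          linarith
    obtain ⟨v, hv, hvu⟩ := ind n le_rfl
    rw [hnk, add_sub_cancel] at hv
    exact ⟨v, hv, hvu.trans hnDk⟩
  have hu' : u ∈ closure {v | Φ t v ∈ K (c t)} := by
    rw [Metric.mem_closure_iff]
    intro ε hε
    obtain ⟨v, hv, hvu⟩ := key (min (ε / 2) 1) (by positivity) (min_le_right _ _)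
    refine ⟨v, hv, ?_⟩
    rw [dist_comm, dist_eq_norm]
    linarith [min_le_left (ε / 2) 1]
  have hcl : IsClosed {v | Φ t v ∈ K (c t)} := (h.isClosed (c t)).preimage (Φ t).continuous
  rwa [hcl.closure_eq] at hu'

theorem continuousAt_fderiv_comp {W : Type*} [NormedAddCommGroup W] [NormedSpace ℝ W]
    {G : E → W} {c x : ℝ → E} {t : ℝ} (hG : ContDiffAt ℝ 1 G (c t)) (hc : ContinuousAt c t)
    (hx : ContinuousAt x t) : ContinuousAt (fun t ↦ fderiv ℝ G (c t) (x t)) t := by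
  have h0 : ContinuousAt (fderiv ℝ G) (c t) := (hG.fderiv_right (m := 0) (by norm_num)).continuousAt
  have h1 : ContinuousAt (fun t ↦ fderiv ℝ G (c t)) t := h0.comp hc
  exact h1.clm_apply hx

theorem continuousAt_fderiv_bilinear {V : Type*} [NormedAddCommGroup V] [NormedSpace ℝ V]
    {G : E → E →L[ℝ] E →L[ℝ] V} {c x y z : ℝ → E} {t : ℝ} (hG : ContDiffAt ℝ 1 G (c t))
    (hc : ContinuousAt c t) (hx : ContinuousAt x t) (hy : ContinuousAt y t)
    (hz : ContinuousAt z t) : ContinuousAt (fun t ↦ fderiv ℝ G (c t) (x t) (y t) (z t)) t := by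
  have h1 := continuousAt_fderiv_comp (W := E →L[ℝ] E →L[ℝ] V) hG hc hx
  exact (h1.clm_apply hy).clm_apply hz

theorem continuousAt_bilinear {V : Type*} [NormedAddCommGroup V] [NormedSpace ℝ V]
    {G : E → E →L[ℝ] E →L[ℝ] V} {c x y : ℝ → E} {t : ℝ} (hG : ContinuousAt G (c t))
    (hc : ContinuousAt c t) (hx : ContinuousAt x t) (hy : ContinuousAt y t) :
    ContinuousAt (fun t ↦ G (c t) (x t) (y t)) t := by
  have h1 : ContinuousAt (fun t ↦ G (c t)) t := hG.comp hc
  exact (h1.clm_apply hx).clm_apply hy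

/-- The curvature vector `Rm(v, c') c'` is tangent at `v` to the tangent cone. -/
theorem IsGeodesicFrame.curvature_mem
    (hf : IsGeodesicFrame Γ p r δ S c c' Φ Ψ (Ioo (t₀ - 3 * T) (t₀ + 3 * T)) b B Q)
    (h : IsLocallyConvex (sprayOf Γ) p r δ A S K)
    (hΓ : IsSymmChristoffelOn Γ (Metric.closedBall p r)) (hB : 0 ≤ B) (hQ : 0 ≤ Q) (hT : 0 < T)
    (hC1 : ContDiffAt ℝ 1 Γ (c t₀)) (hΦ : Φ t₀ = ContinuousLinearMap.id ℝ E) {v : E}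
    (hv : v ∈ K (c t₀)) :
    bilinCurvature Γ (c t₀) v (c' t₀) (c' t₀) ∈ vectorTangentCone (K (c t₀)) v := by
  have ht₀ : t₀ ∈ Ioo (t₀ - 3 * T) (t₀ + 3 * T) := by constructor <;> linarith
  have hcc := (hf.spray t₀ ht₀).1.continuousAt
  have hcc' := (hf.spray t₀ ht₀).2.continuousAt
  have hΦc := (hf.parallel t₀ ht₀ v).continuousAt
  have hΓc : ContinuousAt Γ (c t₀) := hC1.continuousAt
  set Y := bilinCurvature Γ (c t₀) v (c' t₀) (c' t₀) with hY
  have hcurv : ContinuousAt (fun t ↦ ‖bilinCurvature Γ (c t) (Φ t v) (c' t) (c' t) - Y‖) t₀ := by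
    refine ContinuousAt.norm (ContinuousAt.sub ?_ continuousAt_const)
    exact (((continuousAt_fderiv_bilinear hC1 hcc hΦc hcc' hcc').sub
      (continuousAt_fderiv_bilinear hC1 hcc hcc' hΦc hcc')).add
      (continuousAt_bilinear hΓc hcc hΦc (continuousAt_bilinear hΓc hcc hcc' hcc'))).sub
      (continuousAt_bilinear hΓc hcc hcc' (continuousAt_bilinear hΓc hcc hΦc hcc'))
  have hg₁ := (continuousAt_fderiv_bilinear hC1 hcc (continuousAt_const (y := Y)) hcc' hcc').norm
  have hg₂ := (continuousAt_bilinear hΓc hcc hcc' (continuousAt_const (y := Y))).norm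
  set G₁ := ‖fderiv ℝ Γ (c t₀) Y (c' t₀) (c' t₀)‖ + 1
  set G₂ := ‖Γ (c t₀) (c' t₀) Y‖ + 1
  have hr := h.r_pos
  -- Second order contact of v + (l² / 2)Y with the cone. The constant 9 is 2 · 2² + 1: an interval
  -- of length 2l with residual ε, plus the slack l²ε.
  have key : ∀ ε > 0, ∃ l > 0, ∃ u ∈ K (c t₀), ‖u - (v + (l ^ 2 / 2) • Y)‖ ≤ 9 * l ^ 2 * ε := by
    intro ε hε
    have e1 := hcurv.eventually_lt (continuousAt_const (y := ε / 2)) (by simp [hΦ, ← hY, hε])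
    have e2 := hg₁.eventually_lt (continuousAt_const (y := G₁)) (lt_add_one _)
    have e3 := hg₂.eventually_lt (continuousAt_const (y := G₂)) (lt_add_one _)
    obtain ⟨η, hη, hball⟩ := Metric.nhds_basis_ball.mem_iff.1 (e1.and (e2.and e3))
    obtain ⟨l, f1, f2, f3, f4, (hl : 0 < l)⟩ :=
      ((eventually_mul_lt 1 (lt_min hη hT)).and <|
        (eventually_mul_lt (G₁ + 2 * G₂) (half_pos hε)).and <|
        (eventually_mul_lt (2 * b) (half_pos hr)).and <|
        (eventually_mul_lt 1 zero_lt_one).and self_mem_nhdsWithin).exists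
    rw [mul_one] at f1 f4
    have hlT : l < T := f1.trans_le (min_le_right _ _)
    have hlη : l < η := f1.trans_le (min_le_left _ _)
    set I' := Icc (t₀ - l) (t₀ + l)
    have hI' : I' ⊆ Ioo (t₀ - 3 * T) (t₀ + 3 * T) := fun t ht ↦ by
      constructor <;> linarith [ht.1, ht.2]
    have hIη : ∀ t ∈ I', t ∈ Metric.ball t₀ η := fun t ht ↦ by
      rw [Real.ball_eq_Ioo]
      constructor <;> linarith [ht.1, ht.2]
    have hcball : ∀ t ∈ I', c t ∈ Metric.closedBall p r := fun t ht ↦ by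
      rw [mem_closedBall_iff_norm]
      linarith [hf.near_r _ (hI' ht)]
    have hres := fun t ht ↦ jacobi_residual (hΓ.diff _ (hcball t ht)) (hΓ.symm _ (hcball t ht))
      (hΓ.symm_fderiv _ (hcball t ht)) (hf.spray _ (hI' ht)).1 (hf.spray _ (hI' ht)).2
      (hf.parallel _ (hI' ht) v)
    choose! W₂ hW₂ hW using hres
    -- This f vanishes at t₀ ± l, where Φv + fY is therefore in the cones by parallel invariance. As
    -- f'' = -1, the residual is Rm(Φv, c')c' - Y + O(l), which is small by continuity.
    let f : ℝ → ℝ := fun t ↦ (l ^ 2 - (t - t₀) ^ 2) / 2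
    have hfd : ∀ t, HasDerivAt f (-(t - t₀)) t := fun t ↦ by
      have := ((((hasDerivAt_id t).sub_const t₀).pow 2).const_sub (l ^ 2)).div_const 2
      refine this.congr_deriv ?_
      simp
      ring
    have hfd' : ∀ t, HasDerivAt (fun t ↦ -(t - t₀)) (-1 : ℝ) t := fun t ↦
      ((hasDerivAt_id t).sub_const t₀).neg
    have hK : ∀ t ∈ Ioo (t₀ - T) (t₀ + T), Φ t v ∈ K (c t) := fun t ht ↦
      hf.transport_mem h hΓ hB hQ (s := t₀) (by constructor <;> linarith) ht (by simpa [hΦ] using hv)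
    have hml := h.exists_mem_norm_sub_le_affine hΓ (hf.spray.mono hI')
      (fun t ht ↦ hf.mem t (hI' ht)) (fun t ht ↦ hf.near_r t (hI' ht))
      (fun t ht ↦ hf.near_δ t (hI' ht)) (α := t₀ - l) (l := 2 * l) (I := I') (H := ε)
      (Z := fun t ↦ Φ t v + f t • Y)
      (Z' := fun t ↦ -Γ (c t) (c' t) (Φ t v) + (-(t - t₀)) • Y)
      (Z'' := fun t ↦ W₂ t + (-1 : ℝ) • Y)
      (fun t ht ↦ ⟨by nlinarith [ht.1], by nlinarith [ht.2]⟩) (fun t ht ↦ ?_)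
      (fun t ht ↦ (hf.parallel t (hI' ht) v).add ((hfd t).smul_const Y))
      (fun t ht ↦ (hW₂ t ht).add ((hfd' t).smul_const Y))
      (fun t ht ↦ ?_) ?_ ?_ (s := 1 / 2) ⟨by norm_num, by norm_num⟩ (ε := l ^ 2 * ε) (by positivity)
    · obtain ⟨u, hu, hu'⟩ := hml
      have h1 : t₀ - l + 2 * l * (1 / 2) = t₀ := by ring
      rw [h1] at hu hu'
      refine ⟨l, hl, u, hu, ?_⟩
      have h2 : f t₀ = l ^ 2 / 2 := by simp [f]
      rw [hΦ, h2] at hu'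
      refine hu'.trans (le_of_eq (by ring))
    · rw [abs_mul, abs_two, abs_of_pos hl]
      have := hf.speed t (hI' ht)
      nlinarith
    · have h2 := hW t ht
      obtain ⟨b1, b2, b3⟩ := hball (hIη t ht)
      rw [fderiv_sprayOf (hΓ.diff _ (hcball t ht)) (hΓ.symm _ (hcball t ht))] at h2 ⊢
      have h3 : W₂ t + (-1 : ℝ) • Y + (fderiv ℝ Γ (c t) (Φ t v + f t • Y) (c' t) (c' t) +
          (2 : ℝ) • Γ (c t) (c' t) (-Γ (c t) (c' t) (Φ t v) + (-(t - t₀)) • Y)) =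
          (bilinCurvature Γ (c t) (Φ t v) (c' t) (c' t) - Y) +
          (f t • fderiv ℝ Γ (c t) Y (c' t) (c' t) + (-2 * (t - t₀)) • Γ (c t) (c' t) Y) := by
        rw [← h2, map_add_normed (W := E →L[ℝ] E →L[ℝ] E), map_smul_normed (W := E →L[ℝ] E →L[ℝ] E)]
        simp only [map_smul, map_add, map_neg, smul_apply, add_apply]
        module
      rw [h3]
      have habs : |t - t₀| ≤ l := abs_le.2 ⟨by linarith [ht.1], by linarith [ht.2]⟩
      have hft : |f t| ≤ l := by
        have h4 : (t - t₀) ^ 2 ≤ l ^ 2 := sq_le_sq' (by linarith [ht.1]) (by linarith [ht.2])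
        have h5 : l ^ 2 ≤ l := by nlinarith
        have h6 := sq_nonneg (t - t₀)
        change |(l ^ 2 - (t - t₀) ^ 2) / 2| ≤ l
        rw [abs_le]
        constructor <;> linarith
      have h5 : ‖f t • fderiv ℝ Γ (c t) Y (c' t) (c' t)‖ ≤ l * G₁ := by
        rw [norm_smul, Real.norm_eq_abs]
        exact mul_le_mul hft b2.le (norm_nonneg _) hl.le
      have h6 : ‖(-2 * (t - t₀)) • Γ (c t) (c' t) Y‖ ≤ 2 * l * G₂ := by
        rw [norm_smul, Real.norm_eq_abs, abs_mul, abs_neg, abs_two]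
        exact mul_le_mul (by linarith) b3.le (norm_nonneg _) (by positivity)
      have h7 := norm_add_le (bilinCurvature Γ (c t) (Φ t v) (c' t) (c' t) - Y)
        (f t • fderiv ℝ Γ (c t) Y (c' t) (c' t) + (-2 * (t - t₀)) • Γ (c t) (c' t) Y)
      have h8 := norm_add_le (f t • fderiv ℝ Γ (c t) Y (c' t) (c' t))
        ((-2 * (t - t₀)) • Γ (c t) (c' t) Y)
      linarith
    · have : f (t₀ - l) = 0 := by simp [f]
      rw [this, zero_smul, add_zero]
      exact hK _ (by constructor <;> linarith)
    · have h1 : t₀ - l + 2 * l = t₀ + l := by ring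
      have : f (t₀ + l) = 0 := by simp [f]
      rw [h1, this, zero_smul, add_zero]
      exact hK _ (by constructor <;> linarith)
  rw [vectorTangentCone, Metric.mem_closure_iff]
  intro ε hε
  obtain ⟨l, hl, u, hu, hul⟩ := key (ε / 20) (by positivity)
  -- The segment from v to u lies in the convex cone, so u - v is an admissible direction at v;
  -- scaled by 2 / l² it is close to Y.
  refine ⟨(2 / l ^ 2) • (u - v), ⟨l ^ 2 / 2, by positivity, fun τ hτ ↦ ?_⟩, ?_⟩
  · have h1 : v + τ • (2 / l ^ 2) • (u - v) = (1 - τ * (2 / l ^ 2)) • v + (τ * (2 / l ^ 2)) • u := by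
      module
    have h2 : τ * (2 / l ^ 2) ≤ 1 := by
      rw [mul_div_assoc', div_le_one (by positivity)]
      linarith [hτ.2]
    rw [h1]
    exact h.add_mem (hf.mem _ ht₀) (hf.near_r _ ht₀) (hf.near_δ _ ht₀)
      (h.smul_mem _ _ hv _ (by linarith))
      (h.smul_mem _ _ hu _ (mul_nonneg hτ.1 (by positivity)))
  · rw [dist_comm, dist_eq_norm]
    have h1 : (2 / l ^ 2) • (u - v) - Y = (2 / l ^ 2) • (u - (v + (l ^ 2 / 2) • Y)) := by
      have : Y = (2 / l ^ 2) • (l ^ 2 / 2) • Y := by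
        rw [smul_smul, div_mul_div_cancel₀ (by positivity), div_self two_ne_zero, one_smul]
      nth_rewrite 1 [this]
      module
    rw [h1, norm_smul, Real.norm_of_nonneg (by positivity)]
    calc 2 / l ^ 2 * ‖u - (v + (l ^ 2 / 2) • Y)‖ ≤ 2 / l ^ 2 * (9 * l ^ 2 * (ε / 20)) := by gcongr
      _ = 18 / 20 * ε := by field_simp; norm_num
      _ < ε := by linarith

end Transport

/-! ### Riemannian metrics in coordinates and their Christoffel symbols -/

section CoordMetric

set_option linter.unusedSectionVars false

/-- `G` is a smooth Riemannian metric on the open set `U`. -/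
structure IsMetricOn {E : Type*} [NormedAddCommGroup E] [NormedSpace ℝ E]
    (G : E → E →L[ℝ] E →L[ℝ] ℝ) (U : Set E) : Prop where
  isOpen : IsOpen U
  smooth : ∀ y ∈ U, ContDiffAt ℝ ∞ G y
  symm : ∀ y ∈ U, ∀ u v, G y u v = G y v u
  pos : ∀ y ∈ U, ∀ u, u ≠ 0 → 0 < G y u u

theorem fderiv_apply_apply {E V W X : Type*} [NormedAddCommGroup E] [NormedSpace ℝ E]
    [NormedAddCommGroup V] [NormedSpace ℝ V] [NormedAddCommGroup W] [NormedSpace ℝ W]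
    [NormedAddCommGroup X] [NormedSpace ℝ X]
    {G : E → V →L[ℝ] W →L[ℝ] X} {y : E} (hG : DifferentiableAt ℝ G y) (a : E) (v : V) (w : W) :
    fderiv ℝ (fun z ↦ G z v w) y a = fderiv ℝ G y a v w := by
  have h1 := (hG.hasFDerivAt.clm_apply (hasFDerivAt_const v y)).clm_apply (hasFDerivAt_const w y)
  rw [h1.fderiv]
  simp

/-- A basis of the finite-dimensional space V identifies the operator space with a finite power of
W, where smoothness is componentwise. -/
theorem contDiffAt_clm_of_apply {E V W : Type*} [NormedAddCommGroup E] [NormedSpace ℝ E]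
    [NormedAddCommGroup V] [NormedSpace ℝ V] [NormedAddCommGroup W] [NormedSpace ℝ W]
    [FiniteDimensional ℝ V] {n : WithTop ℕ∞} {f : E → V →L[ℝ] W} {x : E}
    (h : ∀ v, ContDiffAt ℝ n (fun y ↦ f y v) x) : ContDiffAt ℝ n f x := by
  let d := Module.finrank ℝ V
  have hd : d = Module.finrank ℝ (Fin d → ℝ) := (Module.finrank_fin_fun ℝ).symm
  let e₁ := ContinuousLinearEquiv.ofFinrankEq hd
  let e₂ := (e₁.arrowCongr (1 : W ≃L[ℝ] W)).trans (ContinuousLinearEquiv.piRing (Fin d))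
  rw [← Function.id_comp f, ← e₂.symm_comp_self]
  exact e₂.symm.contDiff.contDiffAt.comp x (contDiffAt_pi.mpr fun i ↦ h _)

variable {E : Type*} [NormedAddCommGroup E] [NormedSpace ℝ E] [FiniteDimensional ℝ E]
  {G : E → E →L[ℝ] E →L[ℝ] ℝ} {U : Set E} {y : E}

set_option synthInstance.maxHeartbeats 200000 in
/-- The Christoffel symbol as a continuous bilinear map. -/
def christoffelMap (G : E → E →L[ℝ] E →L[ℝ] ℝ) (y : E) : E →L[ℝ] E →L[ℝ] E :=
  LinearMap.toContinuousBilinearMap <|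
    LinearMap.mk₂ ℝ (coordChristoffel G y)
      (fun u u' v ↦ by
        simp only [coordChristoffel]
        rw [← map_add, map_add_normed (W := E →L[ℝ] E →L[ℝ] ℝ)]
        congr 1
        ext w
        simp [map_add_normed (W := E →L[ℝ] E →L[ℝ] ℝ)]
        ring)
      (fun a u v ↦ by
        simp only [coordChristoffel]
        rw [← map_smul, map_smul_normed (W := E →L[ℝ] E →L[ℝ] ℝ)]
        congr 1
        ext w
        simp
        ring)
      (fun u v v' ↦ by
        simp only [coordChristoffel]
        rw [← map_add, map_add_normed (W := E →L[ℝ] E →L[ℝ] ℝ)]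
        congr 1
        ext w
        simp
        ring)
      (fun a u v ↦ by
        simp only [coordChristoffel]
        rw [← map_smul, map_smul_normed (W := E →L[ℝ] E →L[ℝ] ℝ)]
        congr 1
        ext w
        simp
        ring)

theorem christoffelMap_apply (u v : E) : christoffelMap G y u v = coordChristoffel G y u v := rfl

theorem IsMetricOn.differentiableAt {E : Type*} [NormedAddCommGroup E] [NormedSpace ℝ E]
    {G : E → E →L[ℝ] E →L[ℝ] ℝ} {U : Set E} {y : E} (h : IsMetricOn G U) (hy : y ∈ U) : DifferentiableAt ℝ G y :=
  (h.smooth y hy).differentiableAt (by simp)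

theorem IsMetricOn.eq_of_forall (h : IsMetricOn G U) (hy : y ∈ U) {a b : E}
    (hab : ∀ w, G y a w = G y b w) : a = b := by
  by_contra hne
  have := h.pos y hy _ (sub_ne_zero.2 hne)
  rw [map_sub (G y) a b, sub_apply, hab, sub_self] at this
  exact this.false

/-- Definiteness gives injectivity, and a dimension count does the rest. Thus the `inverse` in
`coordChristoffel` is a true inverse and not the default value 0. -/
theorem IsMetricOn.exists_equiv (h : IsMetricOn G U) (hy : y ∈ U) :
    ∃ e : E ≃L[ℝ] (E →L[ℝ] ℝ), (e : E →L[ℝ] (E →L[ℝ] ℝ)) = G y := by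
  have hinj : Function.Injective (G y) := fun a b hab ↦ h.eq_of_forall hy fun w ↦ by rw [hab]
  have hrank : Module.finrank ℝ E = Module.finrank ℝ (E →L[ℝ] ℝ) := by
    rw [← (LinearMap.toContinuousLinearMap (𝕜 := ℝ) (E := E) (F' := ℝ)).finrank_eq]
    exact (Subspace.dual_finrank_eq (K := ℝ) (V := E)).symm
  refine ⟨(LinearEquiv.ofInjectiveOfFinrankEq (G y : E →ₗ[ℝ] (E →L[ℝ] ℝ)) hinj
    hrank).toContinuousLinearEquiv, ?_⟩
  ext u
  rfl

theorem IsMetricOn.christoffelMap_spec (h : IsMetricOn G U) (hy : y ∈ U) (u v w : E) :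
    2 * G y (christoffelMap G y u v) w =
      fderiv ℝ G y u v w + fderiv ℝ G y v u w - fderiv ℝ G y w u v := by
  obtain ⟨e, he⟩ := h.exists_equiv hy
  rw [christoffelMap_apply, coordChristoffel, ← he, ContinuousLinearMap.inverse_equiv]
  simp

theorem IsMetricOn.symm_fderiv (h : IsMetricOn G U) (hy : y ∈ U) (a u v : E) :
    fderiv ℝ G y a u v = fderiv ℝ G y a v u := by
  rw [← fderiv_apply_apply (h.differentiableAt hy), ← fderiv_apply_apply (h.differentiableAt hy)]
  have : (fun z ↦ G z u v) =ᶠ[𝓝 y] fun z ↦ G z v u := by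
    filter_upwards [h.isOpen.mem_nhds hy] with z hz using h.symm z hz u v
  rw [this.fderiv_eq]

theorem IsMetricOn.christoffelMap_symm (h : IsMetricOn G U) (hy : y ∈ U) (u v : E) :
    christoffelMap G y u v = christoffelMap G y v u :=
  h.eq_of_forall hy fun w ↦ by
    linarith [h.christoffelMap_spec hy u v w, h.christoffelMap_spec hy v u w,
      h.symm_fderiv hy w u v]

theorem IsMetricOn.contDiffAt_christoffelMap (h : IsMetricOn G U) (hy : y ∈ U) :
    ContDiffAt ℝ ∞ (christoffelMap G) y := by
  have hD : ∀ u v w : E, ContDiffAt ℝ ∞ (fun z ↦ fderiv ℝ G z u v w) y := by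
    intro u v w
    have h1 : ContDiffAt ℝ ∞ (fun z ↦ G z v w) y :=
      ((h.smooth y hy).clm_apply contDiffAt_const).clm_apply contDiffAt_const
    have h2 : ContDiffAt ℝ ∞ (fun z ↦ fderiv ℝ (fun z ↦ G z v w) z u) y :=
      (h1.fderiv_right (m := ∞) (by simp)).clm_apply contDiffAt_const
    refine h2.congr_of_eventuallyEq ?_
    filter_upwards [h.isOpen.mem_nhds hy] with z hz
    rw [fderiv_apply_apply (h.differentiableAt hz)]
  obtain ⟨e, he⟩ := h.exists_equiv hy
  have hinv : ContDiffAt ℝ ∞ (fun z ↦ (G z).inverse) y := by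
    have h1 : ContDiffAt ℝ ∞ ContinuousLinearMap.inverse (G y) := by
      have : CompleteSpace E := FiniteDimensional.complete ℝ E
      rw [← he]
      exact contDiffAt_map_inverse e
    exact h1.comp y (h.smooth y hy)
  refine contDiffAt_clm_of_apply fun u ↦ contDiffAt_clm_of_apply fun v ↦ ?_
  refine hinv.clm_apply (contDiffAt_clm_of_apply fun w ↦ ?_)
  have h3 := (((hD u v w).add (hD v u w)).sub (hD w u v)).const_smul (1 / 2 : ℝ)
  refine h3.congr_of_eventuallyEq (Filter.Eventually.of_forall fun z ↦ ?_)
  simp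

theorem IsMetricOn.isSymmChristoffelOn (h : IsMetricOn G U) :
    IsSymmChristoffelOn (christoffelMap G) U where
  diff y hy := (h.contDiffAt_christoffelMap hy).differentiableAt (by simp)
  symm y hy := h.christoffelMap_symm hy
  symm_fderiv y hy a u v := by
    have hd := (h.contDiffAt_christoffelMap hy).differentiableAt (by simp)
    rw [← fderiv_apply_apply hd, ← fderiv_apply_apply hd]
    have : (fun z ↦ christoffelMap G z u v) =ᶠ[𝓝 y] fun z ↦ christoffelMap G z v u := by
      filter_upwards [h.isOpen.mem_nhds hy] with z hz using h.christoffelMap_symm hz u v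
    rw [this.fderiv_eq]

theorem IsMetricOn.isMetricSprayOn (h : IsMetricOn G U) :
    IsMetricSprayOn G (sprayOf (christoffelMap G)) U where
  symm := h.symm
  pos := h.pos
  diff y hy := h.differentiableAt hy
  geodesic y hy u w := by
    rw [sprayOf, h.christoffelMap_spec hy]
    ring

theorem IsMetricOn.coordCurvature_eq (h : IsMetricOn G U) (hy : y ∈ U) (u v w : E) :
    coordCurvature (coordChristoffel G) y u v w = bilinCurvature (christoffelMap G) y u v w := by
  have hd := (h.contDiffAt_christoffelMap hy).differentiableAt (by simp)
  rw [bilinCurvature, ← fderiv_apply_apply hd, ← fderiv_apply_apply hd]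
  rfl

theorem IsMetricOn.contDiffAt_sprayOf (h : IsMetricOn G U) (hy : y ∈ U) (u : E) :
    ContDiffAt ℝ ∞ (sprayOf (christoffelMap G)) (y, u) :=
  (((h.contDiffAt_christoffelMap hy).comp (y, u) contDiffAt_fst).clm_apply
    contDiffAt_snd).clm_apply contDiffAt_snd

/-- The quadratic Taylor estimate for the energy density (x, u) ↦ G_x(u, u) near zero velocity, in
the form used by the calibration argument. -/
theorem IsMetricOn.exists_energy_bound (h : IsMetricOn G U) (hy : y ∈ U) :
    ∃ r > 0, ∃ A ≥ 0, ∀ x ∈ Metric.closedBall (y, (0 : E)) r,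
      ∀ z ∈ Metric.closedBall (y, (0 : E)) r,
      ‖G z.1 z.2 z.2 - G x.1 x.2 x.2 -
        (fderiv ℝ G x.1 (z.1 - x.1) x.2 x.2 + 2 * G x.1 x.2 (z.2 - x.2))‖ ≤ A * ‖z - x‖ ^ 2 := by
  have h1 : ContDiffAt ℝ ∞ (fun z : E × E ↦ G z.1 z.2 z.2) (y, 0) :=
    (((h.smooth y hy).comp (y, (0 : E)) contDiffAt_fst).clm_apply
    contDiffAt_snd).clm_apply contDiffAt_snd
  obtain ⟨r₁, hr₁, A, hA, -, H⟩ := exists_taylor_bound (h1.of_le (m := 2) (WithTop.coe_le_coe.2 (le_top : (2 : ℕ∞) ≤ ⊤)))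
  obtain ⟨r₂, hr₂, hU⟩ := Metric.nhds_basis_closedBall.mem_iff.1 (h.isOpen.mem_nhds hy)
  refine ⟨min r₁ r₂, by positivity, A, hA, fun x hx z hz ↦ ?_⟩
  have hxU : x.1 ∈ U := hU <| by
    rw [← closedBall_prod_same, mem_prod] at hx
    exact Metric.closedBall_subset_closedBall (min_le_right _ _) hx.1
  have h2 := H x (Metric.closedBall_subset_closedBall (min_le_left _ _) hx) z
    (Metric.closedBall_subset_closedBall (min_le_left _ _) hz)
  obtain ⟨L, hL, hL'⟩ := hasFDerivAt_bilinear_diag (V := ℝ) (h.differentiableAt hxU) x.2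
  have h3 : fderiv ℝ (fun z : E × E ↦ G z.1 z.2 z.2) x (z - x) =
      fderiv ℝ G x.1 (z.1 - x.1) x.2 x.2 + 2 * G x.1 x.2 (z.2 - x.2) := by
    rw [hL.fderiv, show z - x = (z.1 - x.1, z.2 - x.2) from rfl, hL',
      h.symm _ hxU (z.2 - x.2) x.2, two_mul]
  rwa [h3] at h2

end CoordMetric

/-! ### Differentials of charts and the metric in a chart -/

section Charts

set_option linter.unusedSectionVars false

variable {E : Type*} [NormedAddCommGroup E] [NormedSpace ℝ E]
  {M : Type*} [EMetricSpace M] [ChartedSpace E M] [IsManifold 𝓘(ℝ, E) ∞ M] {p q x : M} {y : E}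

theorem hasMFDerivAt_chart (hx : x ∈ (extChartAt 𝓘(ℝ, E) p).source) :
    HasMFDerivAt 𝓘(ℝ, E) 𝓘(ℝ, E) (extChartAt 𝓘(ℝ, E) p) x (chartDeriv p x) := by
  rw [extChartAt_source] at hx
  exact (mdifferentiableAt_extChartAt hx).hasMFDerivAt

theorem contMDiffAt_chart_symm (hy : y ∈ (extChartAt 𝓘(ℝ, E) p).target) :
    ContMDiffAt 𝓘(ℝ, E) 𝓘(ℝ, E) ∞ (extChartAt 𝓘(ℝ, E) p).symm y :=
  (contMDiffOn_extChartAt_symm p).contMDiffAt ((isOpen_extChartAt_target p).mem_nhds hy)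

theorem chartDeriv_chartDerivSymm (hy : y ∈ (extChartAt 𝓘(ℝ, E) p).target) (u : E) :
    chartDeriv p ((extChartAt 𝓘(ℝ, E) p).symm y) (chartDerivSymm p y u) = u := by
  have h := mfderiv_extChartAt_comp_mfderivWithin_extChartAt_symm (I := 𝓘(ℝ, E)) hy
  rw [ModelWithCorners.range_eq_univ, mfderivWithin_univ] at h
  exact congrArg (fun L : E →L[ℝ] E ↦ L u) h

theorem chartDerivSymm_chartDeriv (hy : y ∈ (extChartAt 𝓘(ℝ, E) p).target)
    (v : TangentSpace 𝓘(ℝ, E) ((extChartAt 𝓘(ℝ, E) p).symm y)) :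
    chartDerivSymm p y (chartDeriv p ((extChartAt 𝓘(ℝ, E) p).symm y) v) = v := by
  have h := mfderivWithin_extChartAt_symm_comp_mfderiv_extChartAt (I := 𝓘(ℝ, E)) hy
  rw [ModelWithCorners.range_eq_univ, mfderivWithin_univ] at h
  exact congrArg (fun L : E →L[ℝ] E ↦ L v) h

theorem exists_eq_symm (hx : x ∈ (extChartAt 𝓘(ℝ, E) p).source) :
    ∃ y ∈ (extChartAt 𝓘(ℝ, E) p).target, x = (extChartAt 𝓘(ℝ, E) p).symm y :=
  ⟨_, (extChartAt 𝓘(ℝ, E) p).map_source hx, ((extChartAt 𝓘(ℝ, E) p).left_inv hx).symm⟩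

theorem chartDeriv_bijective (hx : x ∈ (extChartAt 𝓘(ℝ, E) p).source) :
    Function.Bijective (chartDeriv (E := E) p x) := by
  obtain ⟨y, hy, rfl⟩ := exists_eq_symm hx
  exact ⟨Function.LeftInverse.injective (chartDerivSymm_chartDeriv hy),
    Function.RightInverse.surjective (chartDeriv_chartDerivSymm hy)⟩

theorem hasDerivAt_chart {γ : ℝ → M} {t : ℝ} (hγ : MDifferentiableAt 𝓘(ℝ, ℝ) 𝓘(ℝ, E) γ t)
    (ht : γ t ∈ (extChartAt 𝓘(ℝ, E) p).source) :
    HasDerivAt (fun s ↦ extChartAt 𝓘(ℝ, E) p (γ s)) (chartDeriv p (γ t) (velocity γ t)) t := by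
  have h : HasFDerivAt (fun s ↦ extChartAt 𝓘(ℝ, E) p (γ s))
      ((chartDeriv p (γ t)).comp (mfderiv 𝓘(ℝ, ℝ) 𝓘(ℝ, E) γ t) : ℝ →L[ℝ] E) t :=
    hasMFDerivAt_iff_hasFDerivAt.1 ((hasMFDerivAt_chart ht).comp t hγ.hasMFDerivAt)
  exact h.hasDerivAt

theorem mdifferentiableAt_chart_symm {c : ℝ → E} {c' : E} {t : ℝ} (hc : HasDerivAt c c' t)
    (ht : c t ∈ (extChartAt 𝓘(ℝ, E) p).target) :
    MDifferentiableAt 𝓘(ℝ, ℝ) 𝓘(ℝ, E) (fun s ↦ (extChartAt 𝓘(ℝ, E) p).symm (c s)) t :=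
  ((contMDiffAt_chart_symm ht).mdifferentiableAt (by simp)).comp t
    hc.differentiableAt.mdifferentiableAt

theorem chartDeriv_velocity {c : ℝ → E} {c' : E} {t : ℝ} (hc : HasDerivAt c c' t)
    (ht : c t ∈ (extChartAt 𝓘(ℝ, E) p).target) :
    chartDeriv p ((extChartAt 𝓘(ℝ, E) p).symm (c t))
      (velocity (E := E) (fun s ↦ (extChartAt 𝓘(ℝ, E) p).symm (c s)) t) = c' := by
  have h := hasDerivAt_chart (mdifferentiableAt_chart_symm hc ht)
    ((extChartAt 𝓘(ℝ, E) p).map_target ht)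
  refine h.unique (hc.congr_of_eventuallyEq ?_)
  filter_upwards [hc.continuousAt.eventually_mem ((isOpen_extChartAt_target p).mem_nhds ht)]
    with s hs using (extChartAt 𝓘(ℝ, E) p).right_inv hs

/-- The coordinate change from the preferred chart around `q` to the one around `p`. -/
def transition (q p : M) (y : E) : E := extChartAt 𝓘(ℝ, E) p ((extChartAt 𝓘(ℝ, E) q).symm y)

theorem contDiffAt_transition (hy : y ∈ (extChartAt 𝓘(ℝ, E) q).target)
    (hp : (extChartAt 𝓘(ℝ, E) q).symm y ∈ (extChartAt 𝓘(ℝ, E) p).source) :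
    ContDiffAt ℝ ∞ (transition (E := E) q p) y := by
  rw [extChartAt_source] at hp
  exact ((contMDiffAt_extChartAt' hp).comp y (contMDiffAt_chart_symm hy)).contDiffAt

theorem chartDeriv_eq_fderiv_transition (hq : x ∈ (extChartAt 𝓘(ℝ, E) q).source)
    (hp : x ∈ (extChartAt 𝓘(ℝ, E) p).source) (v : TangentSpace 𝓘(ℝ, E) x) :
    chartDeriv p x v =
      fderiv ℝ (transition (E := E) q p) (extChartAt 𝓘(ℝ, E) q x) (chartDeriv q x v) := by
  have h1 : HasFDerivAt (transition (E := E) q p) _ (extChartAt 𝓘(ℝ, E) q x) :=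
    ((contDiffAt_transition (p := p) ((extChartAt 𝓘(ℝ, E) q).map_source hq)
      (by rwa [(extChartAt 𝓘(ℝ, E) q).left_inv hq])).differentiableAt (by simp)).hasFDerivAt
  have h2 := (hasMFDerivAt_iff_hasFDerivAt.2 h1).comp x (hasMFDerivAt_chart hq)
  have h3 : HasMFDerivAt 𝓘(ℝ, E) 𝓘(ℝ, E) (extChartAt 𝓘(ℝ, E) p) x
      ((fderiv ℝ (transition (E := E) q p) (extChartAt 𝓘(ℝ, E) q x)).comp (chartDeriv q x)) := by
    refine h2.congr_of_eventuallyEq ?_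
    filter_upwards [(isOpen_extChartAt_source q).mem_nhds hq] with z hz
    rw [Function.comp_apply, transition, (extChartAt 𝓘(ℝ, E) q).left_inv hz]
  exact congrArg (fun L : E →L[ℝ] E ↦ L v) h3.mfderiv

variable [RiemannianBundle (fun (x : M) ↦ TangentSpace 𝓘(ℝ, E) x)]

theorem chartMetric_chartDeriv (hx : x ∈ (extChartAt 𝓘(ℝ, E) p).source)
    (v w : TangentSpace 𝓘(ℝ, E) x) :
    chartMetric p (extChartAt 𝓘(ℝ, E) p x) (chartDeriv p x v) (chartDeriv p x w) =
      inner ℝ v w := by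
  obtain ⟨y, hy, rfl⟩ := exists_eq_symm hx
  rw [(extChartAt 𝓘(ℝ, E) p).right_inv hy, chartMetric_apply, chartDerivSymm_chartDeriv hy,
    chartDerivSymm_chartDeriv hy]

theorem enorm_eq_ofReal_sqrt (hx : x ∈ (extChartAt 𝓘(ℝ, E) p).source)
    (v : TangentSpace 𝓘(ℝ, E) x) :
    ‖v‖ₑ = ENNReal.ofReal (√(chartMetric p (extChartAt 𝓘(ℝ, E) p x) (chartDeriv p x v)
      (chartDeriv p x v))) := by
  rw [chartMetric_chartDeriv hx, real_inner_self_eq_norm_sq, Real.sqrt_sq (norm_nonneg _),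
    ofReal_norm]

/-- The coordinate fields dφ⁻¹u are smooth sections of the tangent bundle, so the bundle metric is
smooth on them; definiteness follows because dφ inverts dφ⁻¹. -/
theorem isMetricOn_chartMetric [FiniteDimensional ℝ E]
    [IsContMDiffRiemannianBundle 𝓘(ℝ, E) ∞ E (fun (x : M) ↦ TangentSpace 𝓘(ℝ, E) x)] (p : M) :
    IsMetricOn (chartMetric (E := E) p) (extChartAt 𝓘(ℝ, E) p).target where
  isOpen := isOpen_extChartAt_target p
  smooth y hy := by
    refine contDiffAt_clm_of_apply fun u ↦ contDiffAt_clm_of_apply fun v ↦ ?_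
    have hs : ∀ u : E, ContMDiffAt 𝓘(ℝ, E) (𝓘(ℝ, E).prod 𝓘(ℝ, E)) ∞
        (fun z ↦ (⟨(extChartAt 𝓘(ℝ, E) p).symm z, chartDerivSymm p z u⟩ :
          TangentBundle 𝓘(ℝ, E) M)) y := by
      intro u
      have hU : UniqueMDiffOn 𝓘(ℝ, E) (extChartAt 𝓘(ℝ, E) p).target :=
        (isOpen_extChartAt_target p).uniqueMDiffOn
      have h1 := (contMDiffOn_extChartAt_symm (I := 𝓘(ℝ, E)) (n := ∞)
        p).contMDiffOn_tangentMapWithin (m := ∞) (by simp) hU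
      have h2 : ContMDiff 𝓘(ℝ, E) 𝓘(ℝ, E).tangent ∞
          (fun z : E ↦ (⟨z, u⟩ : TangentBundle 𝓘(ℝ, E) E)) :=
        contMDiff_vectorSpace_iff_contDiff.2 (contDiff_const (c := u))
      have h3 := (ContMDiffOn.comp (f := fun z : E ↦ (⟨z, u⟩ : TangentBundle 𝓘(ℝ, E) E))
        (s := (extChartAt 𝓘(ℝ, E) p).target) h1 h2.contMDiffOn (fun z hz ↦ hz)).contMDiffAt ((isOpen_extChartAt_target p).mem_nhds hy)
      refine h3.congr_of_eventuallyEq ?_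
      filter_upwards [(isOpen_extChartAt_target p).mem_nhds hy] with z hz
      simp only [Function.comp_def, tangentMapWithin]
      rw [mfderivWithin_of_mem_nhds ((isOpen_extChartAt_target p).mem_nhds hz)]
      rfl
    have h4 : ContMDiffAt 𝓘(ℝ, E) 𝓘(ℝ, ℝ) ∞
        (fun z ↦ inner ℝ (chartDerivSymm p z u) (chartDerivSymm p z v)) y := by
      apply ContMDiffAt.inner_bundle (E := fun x : M ↦ TangentSpace 𝓘(ℝ, E) x) (F := E)
        (IB := 𝓘(ℝ, E))
      · exact hs u
      · exact hs v
    exact h4.contDiffAt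
  symm y hy u v := by
    rw [chartMetric_apply, chartMetric_apply, real_inner_comm]
  pos y hy u hu := by
    rw [chartMetric_apply, real_inner_self_pos]
    intro h0
    apply hu
    rw [← chartDeriv_chartDerivSymm hy u, h0, map_zero]

end Charts

/-! ### Independence of the chart for parallel fields and geodesics -/

section ChangeOfChart

set_option linter.unusedSectionVars false

variable {E : Type*} [NormedAddCommGroup E] [NormedSpace ℝ E] [FiniteDimensional ℝ E]

theorem hasDerivAt_line (y a : E) : HasDerivAt (fun s : ℝ ↦ y + s • a) a 0 := by
  simpa using ((hasDerivAt_id (0 : ℝ)).smul_const a).const_add y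

/-- The transformation rule of Christoffel symbols under a local isometry. -/
theorem IsMetricOn.fderiv_christoffelMap {G G' : E → E →L[ℝ] E →L[ℝ] ℝ} {U U' : Set E} {τ : E → E}
    {y : E} (h : IsMetricOn G U) (h' : IsMetricOn G' U') (hy : y ∈ U') (hτy : τ y ∈ U)
    (hτ : ContDiffAt ℝ ∞ τ y) (hpull : ∀ᶠ z in 𝓝 y, ∀ u v,
      G' z u v = G (τ z) (fderiv ℝ τ z u) (fderiv ℝ τ z v))
    (hsurj : Function.Surjective (fderiv ℝ τ y)) (u v : E) :
    fderiv ℝ τ y (christoffelMap G' y u v) =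
      christoffelMap G (τ y) (fderiv ℝ τ y u) (fderiv ℝ τ y v) +
        fderiv ℝ (fderiv ℝ τ) y u v := by
  have hD2 : DifferentiableAt ℝ (fderiv ℝ τ) y :=
    (hτ.fderiv_right (m := ∞) (by simp)).differentiableAt (by simp)
  have hD1 : DifferentiableAt ℝ τ y := hτ.differentiableAt (by simp)
  have hD : ∀ a u v : E, fderiv ℝ G' y a u v =
      fderiv ℝ G (τ y) (fderiv ℝ τ y a) (fderiv ℝ τ y u) (fderiv ℝ τ y v) +
        G (τ y) (fderiv ℝ (fderiv ℝ τ) y a u) (fderiv ℝ τ y v) +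
        G (τ y) (fderiv ℝ τ y u) (fderiv ℝ (fderiv ℝ τ) y a v) := by
    intro a u v
    have hl := hasDerivAt_line y a
    have h0 : y + (0 : ℝ) • a = y := by simp
    have hc : HasDerivAt (fun s : ℝ ↦ τ (y + s • a)) (fderiv ℝ τ y a) 0 :=
      HasFDerivAt.comp_hasDerivAt (l := τ) 0 (by rw [h0]; exact hD1.hasFDerivAt) hl
    have hdc : ∀ u : E, HasDerivAt (fun s : ℝ ↦ fderiv ℝ τ (y + s • a) u)
        (fderiv ℝ (fderiv ℝ τ) y a u) 0 := by
      intro u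
      have h1 : HasDerivAt (fun s : ℝ ↦ fderiv ℝ τ (y + s • a)) (fderiv ℝ (fderiv ℝ τ) y a) 0 :=
        HasFDerivAt.comp_hasDerivAt (l := fderiv ℝ τ) 0 (by rw [h0]; exact hD2.hasFDerivAt) hl
      simpa using h1.clm_apply (hasDerivAt_const (0 : ℝ) u)
    have h1 := hasDerivAt_comp_bilinear (V := ℝ) (G := G) (t := 0)
      (by rw [h0]; exact h.differentiableAt hτy) hc (hdc u) (hdc v)
    have h2 := hasDerivAt_comp_bilinear (V := ℝ) (G := G') (t := 0)
      (by rw [h0]; exact h'.differentiableAt hy) hl (hasDerivAt_const 0 u) (hasDerivAt_const 0 v)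
    have h3 : (fun s : ℝ ↦ G' (y + s • a) u v) =ᶠ[𝓝 0] fun s ↦ G (τ (y + s • a))
        (fderiv ℝ τ (y + s • a) u) (fderiv ℝ τ (y + s • a) v) := by
      have h4 := hl.continuousAt.tendsto
      rw [h0] at h4
      exact (h4.eventually hpull).mono fun s hs ↦ hs u v
    have h5 := (h1.congr_of_eventuallyEq h3).unique h2
    simpa only [h0, map_zero, zero_apply, add_zero] using h5.symm
  have hsymm : ∀ u v, fderiv ℝ (fderiv ℝ τ) y u v = fderiv ℝ (fderiv ℝ τ) y v u := by
    have : IsSymmSndFDerivAt ℝ τ y := hτ.isSymmSndFDerivAt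
      (by simpa using WithTop.coe_le_coe.2 (le_top : (2 : ℕ∞) ≤ ⊤))
    exact fun u v ↦ this u v
  -- Test against dτ(w) and insert the differentiated isometry relation into the Koszul formula. By
  -- symmetry of D²τ, its six second order terms reduce to 2G(D²τ(u, v), dτ(w)).
  refine h.eq_of_forall hτy fun w' ↦ ?_
  obtain ⟨w, rfl⟩ := hsurj w'
  have e1 := h'.christoffelMap_spec hy u v w
  have e2 := h.christoffelMap_spec hτy (fderiv ℝ τ y u) (fderiv ℝ τ y v) (fderiv ℝ τ y w)
  rw [hpull.self_of_nhds, hD u v w, hD v u w, hD w u v, hsymm v u, hsymm w u, hsymm w v] at e1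
  rw [map_add (G (τ y)), add_apply]
  have e3 := h.symm _ hτy (fderiv ℝ τ y v) (fderiv ℝ (fderiv ℝ τ) y u w)
  linarith

variable {M : Type*} [EMetricSpace M] [ChartedSpace E M] [IsManifold 𝓘(ℝ, E) ∞ M] {p q x : M}
  [RiemannianBundle (fun (x : M) ↦ TangentSpace 𝓘(ℝ, E) x)]
  [IsContMDiffRiemannianBundle 𝓘(ℝ, E) ∞ E (fun (x : M) ↦ TangentSpace 𝓘(ℝ, E) x)]
  {γ : ℝ → M} {V : ∀ t, TangentSpace 𝓘(ℝ, E) (γ t)} {t₀ : ℝ} {J : Set ℝ}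

/-- The bilinear Christoffel symbols in the preferred chart around `p`. -/
def chartChristoffel (p : M) : E → E →L[ℝ] E →L[ℝ] E := christoffelMap (chartMetric p)

variable (p γ V t₀) in
/-- The equation of parallel fields at the time `t₀`, in the preferred chart around `p`. -/
def IsParallelInChart : Prop :=
  HasDerivAt (fun t ↦ chartDeriv p (γ t) (V t))
    (-chartChristoffel p (extChartAt 𝓘(ℝ, E) p (γ t₀))
      (chartDeriv p (γ t₀) (velocity γ t₀)) (chartDeriv p (γ t₀) (V t₀))) t₀

/-- `IsParallelOn` reads each instant in its own chart, whereas the analysis needs one chart for a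
whole interval. Differentiating dτ(V) produces a term D²τ(γ', V), which is the inhomogeneous term of
the transformation rule for Christoffel symbols. -/
theorem IsParallelInChart.change (h : IsParallelInChart q γ V t₀)
    (hγ : MDifferentiableAt 𝓘(ℝ, ℝ) 𝓘(ℝ, E) γ t₀)
    (hq : γ t₀ ∈ (extChartAt 𝓘(ℝ, E) q).source) (hp : γ t₀ ∈ (extChartAt 𝓘(ℝ, E) p).source) :
    IsParallelInChart p γ V t₀ := by
  set τ := transition (E := E) q p
  set y := extChartAt 𝓘(ℝ, E) q (γ t₀) with hy
  have hyt : y ∈ (extChartAt 𝓘(ℝ, E) q).target := (extChartAt 𝓘(ℝ, E) q).map_source hq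
  have hsymm : (extChartAt 𝓘(ℝ, E) q).symm y = γ t₀ := (extChartAt 𝓘(ℝ, E) q).left_inv hq
  have hτ : ContDiffAt ℝ ∞ τ y := contDiffAt_transition hyt (by rwa [hsymm])
  have hτy : τ y = extChartAt 𝓘(ℝ, E) p (γ t₀) := by simp only [τ, transition, hsymm]
  have hD2 : DifferentiableAt ℝ (fderiv ℝ τ) y :=
    (hτ.fderiv_right (m := ∞) (by simp)).differentiableAt (by simp)
  have hc := hasDerivAt_chart hγ hq
  have h1 : HasDerivAt (fun t ↦ fderiv ℝ τ (extChartAt 𝓘(ℝ, E) q (γ t)))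
      (fderiv ℝ (fderiv ℝ τ) y (chartDeriv q (γ t₀) (velocity γ t₀))) t₀ :=
    HasFDerivAt.comp_hasDerivAt (l := fderiv ℝ τ) t₀ hD2.hasFDerivAt hc
  have h2 := h1.clm_apply h
  have hev : (fun t ↦ chartDeriv p (γ t) (V t)) =ᶠ[𝓝 t₀] fun t ↦
      fderiv ℝ τ (extChartAt 𝓘(ℝ, E) q (γ t)) (chartDeriv q (γ t) (V t)) := by
    filter_upwards [hγ.continuousAt.eventually_mem ((isOpen_extChartAt_source q).mem_nhds hq),
      hγ.continuousAt.eventually_mem ((isOpen_extChartAt_source p).mem_nhds hp)] with t h3 h4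
      using chartDeriv_eq_fderiv_transition h3 h4 (V t)
  refine (h2.congr_of_eventuallyEq hev).congr_deriv ?_
  have hpull : ∀ᶠ z in 𝓝 y, ∀ u v, chartMetric q z u v =
      chartMetric p (τ z) (fderiv ℝ τ z u) (fderiv ℝ τ z v) := by
    have hcont : ContinuousAt (extChartAt 𝓘(ℝ, E) q).symm y :=
      (contMDiffAt_chart_symm hyt).continuousAt
    filter_upwards [(isOpen_extChartAt_target q).mem_nhds hyt,
      hcont.eventually_mem ((isOpen_extChartAt_source p).mem_nhds (by rwa [hsymm]))]
      with z hz hzp u v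
    have hzq := (extChartAt 𝓘(ℝ, E) q).map_target hz
    have h5 := chartDeriv_eq_fderiv_transition hzq hzp (chartDerivSymm q z u)
    have h6 := chartDeriv_eq_fderiv_transition hzq hzp (chartDerivSymm q z v)
    rw [chartDeriv_chartDerivSymm hz, (extChartAt 𝓘(ℝ, E) q).right_inv hz] at h5 h6
    rw [chartMetric_apply, ← h5, ← h6]
    exact (chartMetric_chartDeriv hzp _ _).symm
  have hsurj : Function.Surjective (fderiv ℝ τ y) := by
    intro w
    obtain ⟨v, hv⟩ := (chartDeriv_bijective hp).2 w
    exact ⟨chartDeriv q (γ t₀) v, by rw [← hv]; exact (chartDeriv_eq_fderiv_transition hq hp v).symm⟩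
  have key := (isMetricOn_chartMetric p).fderiv_christoffelMap (isMetricOn_chartMetric q) hyt
    (by rw [hτy]; exact (extChartAt 𝓘(ℝ, E) p).map_source hp) hτ hpull hsurj
    (chartDeriv q (γ t₀) (velocity γ t₀)) (chartDeriv q (γ t₀) (V t₀))
  rw [chartDeriv_eq_fderiv_transition hq hp (velocity γ t₀),
    chartDeriv_eq_fderiv_transition hq hp (V t₀), ← hy, ← hτy, map_neg]
  simp only [chartChristoffel]
  rw [key]
  abel

theorem isParallelOn_iff (hγ : ∀ t ∈ J, MDifferentiableAt 𝓘(ℝ, ℝ) 𝓘(ℝ, E) γ t)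
    (hp : ∀ t ∈ J, γ t ∈ (extChartAt 𝓘(ℝ, E) p).source) :
    IsParallelOn γ V J ↔ ∀ t₀ ∈ J, IsParallelInChart p γ V t₀ :=
  forall₂_congr fun t ht ↦ ⟨fun h ↦ IsParallelInChart.change (q := γ t) h (hγ t ht) (mem_extChartAt_source _) (hp t ht),
    fun h ↦ IsParallelInChart.change (q := p) h (hγ t ht) (hp t ht) (mem_extChartAt_source _)⟩

theorem IsGeodesicOn.mdifferentiableAt (h : IsGeodesicOn (E := E) γ J) (hJ : IsOpen J) {t : ℝ}
    (ht : t ∈ J) : MDifferentiableAt 𝓘(ℝ, ℝ) 𝓘(ℝ, E) γ t :=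
  (h.1.contMDiffAt (hJ.mem_nhds ht)).mdifferentiableAt one_ne_zero

/-- Geodesics in a chart are spray curves. -/
theorem IsGeodesicOn.isSprayCurveOn (h : IsGeodesicOn (E := E) γ J) (hJ : IsOpen J)
    (hp : ∀ t ∈ J, γ t ∈ (extChartAt 𝓘(ℝ, E) p).source) :
    IsSprayCurveOn (sprayOf (chartChristoffel p)) (fun t ↦ extChartAt 𝓘(ℝ, E) p (γ t))
      (fun t ↦ chartDeriv p (γ t) (velocity γ t)) J := fun t ht ↦
  ⟨hasDerivAt_chart (h.mdifferentiableAt hJ ht) (hp t ht),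
    (isParallelOn_iff (fun _ ht ↦ h.mdifferentiableAt hJ ht) hp).1 h.2 t ht⟩

/-- Spray curves in a chart are geodesics. -/
theorem IsSprayCurveOn.isGeodesicOn {c c' : ℝ → E}
    (h : IsSprayCurveOn (sprayOf (chartChristoffel p)) c c' J) (hJ : IsOpen J)
    (hp : ∀ t ∈ J, c t ∈ (extChartAt 𝓘(ℝ, E) p).target) :
    IsGeodesicOn (E := E) (fun t ↦ (extChartAt 𝓘(ℝ, E) p).symm (c t)) J := by
  have hm : ∀ t ∈ J, MDifferentiableAt 𝓘(ℝ, ℝ) 𝓘(ℝ, E)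
      (fun t ↦ (extChartAt 𝓘(ℝ, E) p).symm (c t)) t := fun t ht ↦
    mdifferentiableAt_chart_symm (h t ht).1 (hp t ht)
  constructor
  · have hc : ContDiffOn ℝ 1 c J := by
      rw [show (1 : WithTop ℕ∞) = 0 + 1 from rfl, contDiffOn_succ_iff_deriv_of_isOpen hJ]
      refine ⟨fun t ht ↦ (h t ht).1.differentiableAt.differentiableWithinAt, by simp,
        contDiffOn_zero.2 ?_⟩
      have : ContinuousOn c' J := fun t ht ↦ (h t ht).2.continuousAt.continuousWithinAt
      exact this.congr fun t ht ↦ (h t ht).1.deriv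
    exact ((contMDiffOn_extChartAt_symm p).of_le (WithTop.coe_le_coe.2 (le_top : (1 : ℕ∞) ≤ ⊤))).comp hc.contMDiffOn hp
  · refine (isParallelOn_iff hm fun t ht ↦ (extChartAt 𝓘(ℝ, E) p).map_target (hp t ht)).2
      fun t ht ↦ ?_
    have hv : ∀ t ∈ J, chartDeriv p ((extChartAt 𝓘(ℝ, E) p).symm (c t))
      (velocity (E := E) (fun s ↦ (extChartAt 𝓘(ℝ, E) p).symm (c s)) t) = c' t := fun t ht ↦
      chartDeriv_velocity (h t ht).1 (hp t ht)
    have h1 := (h t ht).2.congr_of_eventuallyEq (Filter.eventuallyEq_of_mem (hJ.mem_nhds ht) hv)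
    refine h1.congr_deriv ?_
    rw [hv t ht, (extChartAt 𝓘(ℝ, E) p).right_inv (hp t ht)]
    rfl

end ChangeOfChart

/-! ### Short geodesics minimize length -/

section Minimizing

set_option linter.unusedSectionVars false

open MeasureTheory

variable {E : Type*} [NormedAddCommGroup E] [NormedSpace ℝ E] [FiniteDimensional ℝ E]
  {M : Type*} [EMetricSpace M] [ChartedSpace E M] [IsManifold 𝓘(ℝ, E) ∞ M] {p : M}
  [RiemannianBundle (fun (x : M) ↦ TangentSpace 𝓘(ℝ, E) x)]
  [IsContMDiffRiemannianBundle 𝓘(ℝ, E) ∞ E (fun (x : M) ↦ TangentSpace 𝓘(ℝ, E) x)]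

/-- The length of a `C¹` path in a chart. -/
theorem pathELength_eq_ofReal_integral {b : ℝ → M}
    (hb : ContMDiffOn 𝓘(ℝ, ℝ) 𝓘(ℝ, E) 1 b (Icc 0 1))
    (hp : ∀ t ∈ Icc (0 : ℝ) 1, b t ∈ (extChartAt 𝓘(ℝ, E) p).source) :
    ∃ β' : ℝ → E, (∀ t ∈ Icc (0 : ℝ) 1,
        HasDerivWithinAt (fun t ↦ extChartAt 𝓘(ℝ, E) p (b t)) (β' t) (Icc 0 1) t) ∧
      ContinuousOn β' (Icc 0 1) ∧
      pathELength 𝓘(ℝ, E) b 0 1 = ENNReal.ofReal (∫ t in (0 : ℝ)..1,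
        √(chartMetric p (extChartAt 𝓘(ℝ, E) p (b t)) (β' t) (β' t))) := by
  have hu : UniqueDiffOn ℝ (Icc (0 : ℝ) 1) := uniqueDiffOn_Icc zero_lt_one
  let β : ℝ → E := fun t ↦ extChartAt 𝓘(ℝ, E) p (b t)
  let β' : ℝ → E := fun t ↦ chartDeriv p (b t) (mfderivWithin 𝓘(ℝ, ℝ) 𝓘(ℝ, E) b (Icc 0 1) t (1 : ℝ))
  have hd : ∀ t ∈ Icc (0 : ℝ) 1, HasDerivWithinAt β (β' t) (Icc 0 1) t := by
    intro t ht
    have h : HasFDerivWithinAt β ((chartDeriv p (b t)).comp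
        (mfderivWithin 𝓘(ℝ, ℝ) 𝓘(ℝ, E) b (Icc 0 1) t) : ℝ →L[ℝ] E) (Icc 0 1) t :=
      hasMFDerivWithinAt_iff_hasFDerivWithinAt.1 ((hasMFDerivAt_chart (hp t ht)).comp_hasMFDerivWithinAt
        t ((hb t ht).mdifferentiableWithinAt one_ne_zero).hasMFDerivWithinAt)
    exact h.hasDerivWithinAt
  have hβ : ContDiffOn ℝ 1 β (Icc 0 1) := by
    have h1 : ContMDiffOn 𝓘(ℝ, E) 𝓘(ℝ, E) 1 (extChartAt 𝓘(ℝ, E) p) (chartAt E p).source :=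
      contMDiffOn_extChartAt
    refine (h1.comp hb fun t ht ↦ ?_).contDiffOn
    simpa using hp t ht
  have hβ' : ContinuousOn β' (Icc 0 1) :=
    (hβ.continuousOn_derivWithin hu le_rfl).congr fun t ht ↦ ((hd t ht).derivWithin (hu t ht)).symm
  refine ⟨β', hd, hβ', ?_⟩
  have hcont : ContinuousOn (fun t ↦ √(chartMetric p (β t) (β' t) (β' t))) (Icc 0 1) := by
    have h1 : ContinuousOn (fun t ↦ chartMetric p (β t)) (Icc 0 1) := fun t ht ↦
      ContinuousAt.comp_continuousWithinAt (f := β) (g := chartMetric p)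
        (((isMetricOn_chartMetric p).smooth _
          ((extChartAt 𝓘(ℝ, E) p).map_source (hp t ht))).continuousAt)
        (hd t ht).continuousWithinAt
    exact ((h1.clm_apply hβ').clm_apply hβ').sqrt
  rw [pathELength_eq_lintegral_mfderivWithin_Icc, intervalIntegral.integral_of_le zero_le_one,
    ← integral_Icc_eq_integral_Ioc, ofReal_integral_eq_lintegral_ofReal hcont.integrableOn_Icc
      (Filter.Eventually.of_forall fun t ↦ Real.sqrt_nonneg _)]
  refine setLIntegral_congr_fun measurableSet_Icc fun t ht ↦ ?_
  exact enorm_eq_ofReal_sqrt (hp t ht) _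

/-- The length of a geodesic in a chart. -/
theorem pathELength_of_isSprayCurveOn {c c' : ℝ → E} {J : Set ℝ} (hJ : Icc 0 1 ⊆ J)
    (hc : IsSprayCurveOn (sprayOf (chartChristoffel p)) c c' J)
    (hp : ∀ t ∈ J, c t ∈ (extChartAt 𝓘(ℝ, E) p).target) :
    pathELength 𝓘(ℝ, E) (fun t ↦ (extChartAt 𝓘(ℝ, E) p).symm (c t)) 0 1 =
      ENNReal.ofReal (√(chartMetric p (c 1) (c' 1) (c' 1))) := by
  rw [pathELength_eq_lintegral_mfderiv_Icc]
  have h1 : ∀ t ∈ Icc (0 : ℝ) 1, ‖velocity (E := E) (fun t ↦ (extChartAt 𝓘(ℝ, E) p).symm (c t)) t‖ₑ =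
      ENNReal.ofReal (√(chartMetric p (c 1) (c' 1) (c' 1))) := by
    intro t ht
    rw [enorm_eq_ofReal_sqrt ((extChartAt 𝓘(ℝ, E) p).map_target (hp t (hJ ht))),
      chartDeriv_velocity (hc t (hJ ht)).1 (hp t (hJ ht)),
      (extChartAt 𝓘(ℝ, E) p).right_inv (hp t (hJ ht)),
      (isMetricOn_chartMetric p).isMetricSprayOn.speed_eq (hc.mono hJ) (fun t ht ↦ hp t (hJ ht)) ht
        (right_mem_Icc.2 zero_le_one)]
  refine (setLIntegral_congr_fun measurableSet_Icc h1).trans ?_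
  simp

/-- Short geodesics are minimizing. -/
theorem pathELength_eq_edist_of_isSprayCurveOn [IsRiemannianManifold 𝓘(ℝ, E) M]
    {x y : E} {r δ A : ℝ} (hδr : δ ≤ r) (hr : 0 < r)
    (hrt : Metric.closedBall (extChartAt 𝓘(ℝ, E) p p) r ⊆ (extChartAt 𝓘(ℝ, E) p).target)
    (hl : LipschitzOnWith (1 / 4) (sprayOf (chartChristoffel p))
      (Metric.closedBall (extChartAt 𝓘(ℝ, E) p p, 0) r)) (hA : 0 ≤ A)
    (hL : ∀ y ∈ Metric.closedBall (extChartAt 𝓘(ℝ, E) p p, (0 : E)) r,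
      ∀ z ∈ Metric.closedBall (extChartAt 𝓘(ℝ, E) p p, (0 : E)) r,
      ‖chartMetric p z.1 z.2 z.2 - chartMetric p y.1 y.2 y.2 -
        (fderiv ℝ (chartMetric p) y.1 (z.1 - y.1) y.2 y.2 +
          2 * chartMetric p y.1 y.2 (z.2 - y.2))‖ ≤ A * ‖z - y‖ ^ 2)
    {c c' : E → ℝ → E}
    (hc : ∀ z, ‖z - extChartAt 𝓘(ℝ, E) p p‖ ≤ δ → c z 0 = x ∧ c z 1 = z ∧
      IsSprayCurveOn (sprayOf (chartChristoffel p)) (c z) (c' z) (Ioo (-1) 2) ∧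
      ∀ t ∈ Ioo (-1 : ℝ) 2, (c z t, c' z t) ∈ Metric.closedBall (extChartAt 𝓘(ℝ, E) p p, 0) r)
    {ρ₁ ρ₂ ρ : ENNReal} (hρ : ρ₁ + ρ₂ ≤ ρ)
    (hball : ∀ q : M, edist q p < ρ → q ∈ (extChartAt 𝓘(ℝ, E) p).source ∧
      ‖extChartAt 𝓘(ℝ, E) p q - extChartAt 𝓘(ℝ, E) p p‖ < δ)
    (hx : x ∈ (extChartAt 𝓘(ℝ, E) p).target) (hy : ‖y - extChartAt 𝓘(ℝ, E) p p‖ ≤ δ)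
    (hxp : edist ((extChartAt 𝓘(ℝ, E) p).symm x) p < ρ₁)
    (hlen : ENNReal.ofReal (√(chartMetric p y (c' y 1) (c' y 1))) ≤ ρ₂) :
    pathELength 𝓘(ℝ, E) (fun t ↦ (extChartAt 𝓘(ℝ, E) p).symm (c y t)) 0 1 =
      edist ((extChartAt 𝓘(ℝ, E) p).symm x) ((extChartAt 𝓘(ℝ, E) p).symm y) := by
  have hIcc : Icc (0 : ℝ) 1 ⊆ Ioo (-1) 2 := Icc_subset_Ioo_neg_one_two
  obtain ⟨hc0, hc1, hcy, hcS⟩ := hc y hy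
  have hct : ∀ t ∈ Ioo (-1 : ℝ) 2, c y t ∈ (extChartAt 𝓘(ℝ, E) p).target := fun t ht ↦
    hrt (mem_closedBall_iff_norm.2 (mem_closedBall_prod_iff.1 (hcS t ht)).1)
  have hlen' := pathELength_of_isSprayCurveOn hIcc hcy hct
  rw [hc1] at hlen'
  apply le_antisymm
  · by_contra! hlt
    rw [hlen', IsRiemannianManifold.out (I := 𝓘(ℝ, E))] at hlt
    obtain ⟨b, hb0, hb1, hb, hbl⟩ := exists_lt_of_riemannianEDist_lt hlt
    -- A shorter competitor may a priori leave the chart. Its length is below ρ₂ and it starts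
    -- within ρ₁ of p, so it stays in the ρ-ball, where the calibration applies.
    have hbp : ∀ t ∈ Icc (0 : ℝ) 1, edist (b t) p < ρ := by
      intro t ht
      have h1 : edist (b 0) (b t) < ρ₂ := by
        rw [IsRiemannianManifold.out (I := 𝓘(ℝ, E))]
        refine lt_of_le_of_lt (riemannianEDist_le_pathELength
          (hb.mono (Icc_subset_Icc le_rfl ht.2)) rfl rfl ht.1) ?_
        exact lt_of_le_of_lt (pathELength_mono le_rfl ht.2) (hbl.trans_le hlen)
      rw [hb0] at h1
      calc edist (b t) p ≤ edist (b t) ((extChartAt 𝓘(ℝ, E) p).symm x) +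
            edist ((extChartAt 𝓘(ℝ, E) p).symm x) p := edist_triangle _ _ _
        _ < ρ₂ + ρ₁ := by
            rw [edist_comm]
            exact ENNReal.add_lt_add h1 hxp
        _ ≤ ρ := by rwa [add_comm]
    obtain ⟨β', hβ, hβ', hlb⟩ := pathELength_eq_ofReal_integral hb fun t ht ↦ (hball _ (hbp t ht)).1
    have hxi := (extChartAt 𝓘(ℝ, E) p).right_inv hx
    have hyt : y ∈ (extChartAt 𝓘(ℝ, E) p).target :=
      hrt (mem_closedBall_iff_norm.2 (hy.trans hδr))
    have hyi := (extChartAt 𝓘(ℝ, E) p).right_inv hyt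
    have key := ((isMetricOn_chartMetric p).isMetricSprayOn.mono hrt).speed_le_length hδr
      (sprayOf_hom _) hr hl hA hL (x := x) (y := y) (c := c) (c' := c')
      (fun z hz ↦ ⟨(hc z hz).1, (hc z hz).2.1, (hc z hz).2.2.1.mono hIcc,
        fun t ht ↦ (hc z hz).2.2.2 t (hIcc ht)⟩) hβ hβ' (fun t ht ↦ (hball _ (hbp t ht)).2)
      (by rw [hb0, hxi]) (by rw [hb1, hyi])
    rw [hlb] at hbl
    exact absurd (ENNReal.ofReal_le_ofReal key) (not_le.2 hbl)
  · rw [IsRiemannianManifold.out (I := 𝓘(ℝ, E))]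
    have hg := (hcy.isGeodesicOn isOpen_Ioo hct).1.mono hIcc
    exact riemannianEDist_le_pathELength hg (by rw [hc0]) (by rw [hc1]) zero_le_one

end Minimizing

/-! ### Tangent cones and local convexity in a chart -/

section ChartCone

set_option linter.unusedSectionVars false

variable {E : Type*} [NormedAddCommGroup E] [NormedSpace ℝ E] [FiniteDimensional ℝ E]
  {M : Type*} [EMetricSpace M] [ChartedSpace E M] [IsManifold 𝓘(ℝ, E) ∞ M] {p : M}

theorem eventually_norm_lt {X V : Type*} [TopologicalSpace X] [NormedAddCommGroup V]
    {f : X → V} {x : X} (hf : ContinuousAt f x) : ∀ᶠ y in 𝓝 x, ‖f y‖ < ‖f x‖ + 1 :=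
  hf.norm.eventually_lt continuousAt_const (lt_add_one _)

theorem totalSpace_mk_eq_mk {x₁ x₂ : M} (h : x₁ = x₂)
    (hp : x₁ ∈ (extChartAt 𝓘(ℝ, E) p).source) {v₁ : TangentSpace 𝓘(ℝ, E) x₁}
    {v₂ : TangentSpace 𝓘(ℝ, E) x₂} (hv : chartDeriv p x₁ v₁ = chartDeriv p x₂ v₂) :
    (⟨x₁, v₁⟩ : TangentBundle 𝓘(ℝ, E) M) = ⟨x₂, v₂⟩ := by
  subst h
  rw [(chartDeriv_bijective hp).1 hv]

/-- The image of a set in the preferred chart around `p`. -/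
def chartSet (C : Set M) (p : M) : Set E :=
  {y ∈ (extChartAt 𝓘(ℝ, E) p).target | (extChartAt 𝓘(ℝ, E) p).symm y ∈ C}

theorem map_mem_chartSet {C : Set M} {x : M} (hx : x ∈ (extChartAt 𝓘(ℝ, E) p).source)
    (hC : x ∈ C) : extChartAt 𝓘(ℝ, E) p x ∈ chartSet (E := E) C p :=
  ⟨(extChartAt 𝓘(ℝ, E) p).map_source hx, by rwa [(extChartAt 𝓘(ℝ, E) p).left_inv hx]⟩

variable [RiemannianBundle (fun (x : M) ↦ TangentSpace 𝓘(ℝ, E) x)]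

/-- The velocities at `y` of geodesics in `C`, in the preferred chart around `p`. -/
def chartVelocities (C : Set M) (p : M) (y : E) : Set E :=
  {u | ∃ ε > 0, ∃ c c' : ℝ → E, IsSprayCurveOn (sprayOf (chartChristoffel p)) c c' (Ioo (-ε) ε) ∧
    (∀ t ∈ Ioo (-ε) ε, c t ∈ (extChartAt 𝓘(ℝ, E) p).target) ∧ c 0 = y ∧ c' 0 = u ∧
    ∀ t ∈ Ico 0 ε, (extChartAt 𝓘(ℝ, E) p).symm (c t) ∈ C}

/-- The tangent cone of `C`, in the preferred chart around `p`. -/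
def chartCone (C : Set M) (p : M) (y : E) : Set E := closure (chartVelocities C p y)

theorem smul_mem_chartCone {C : Set M} {y v : E} (hv : v ∈ chartCone C p y) {a : ℝ} (ha : 0 ≤ a) :
    a • v ∈ chartCone C p y := by
  refine map_mem_closure (continuous_const_smul a) hv ?_
  rintro _ ⟨ε, hε, c, c', hc, hct, rfl, rfl, hC⟩
  -- Dividing by a + 1 instead of a also covers a = 0.
  have hmap : ∀ t ∈ Ioo (-(ε / (a + 1))) (ε / (a + 1)), 0 + a * t ∈ Ioo (-ε) ε := by
    intro t ht
    have h1 : |t| < ε / (a + 1) := abs_lt.2 ht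
    rw [lt_div_iff₀ (by positivity)] at h1
    rw [zero_add, mem_Ioo, ← abs_lt, abs_mul, abs_of_nonneg ha]
    nlinarith [abs_nonneg t]
  refine ⟨ε / (a + 1), by positivity, _, _, hc.comp_affine (sprayOf_hom _) 0 a hmap,
    fun t ht ↦ hct _ (hmap t ht), by simp, by simp, fun t ht ↦ hC _ ⟨?_, ?_⟩⟩
  · have := mul_nonneg ha ht.1
    linarith
  · exact (hmap t ⟨by linarith [ht.1, show 0 < ε / (a + 1) by positivity], ht.2⟩).2

variable [IsContMDiffRiemannianBundle 𝓘(ℝ, E) ∞ E (fun (x : M) ↦ TangentSpace 𝓘(ℝ, E) x)]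

theorem chartDeriv_mem_chartVelocities_iff {C : Set M} {x : M}
    (hx : x ∈ (extChartAt 𝓘(ℝ, E) p).source) (v : TangentSpace 𝓘(ℝ, E) x) :
    chartDeriv p x v ∈ chartVelocities C p (extChartAt 𝓘(ℝ, E) p x) ↔
      ∃ γ : ℝ → M, ∃ ε > 0, IsGeodesicOn (E := E) γ (Ioo (-ε) ε) ∧
        (⟨γ 0, velocity γ 0⟩ : TangentBundle 𝓘(ℝ, E) M) = ⟨x, v⟩ ∧ ∀ t ∈ Ico 0 ε, γ t ∈ C := by
  constructor
  · rintro ⟨ε, hε, c, c', hc, hct, hc0, hc0', hC⟩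
    have h0 : (0 : ℝ) ∈ Ioo (-ε) ε := by constructor <;> linarith
    refine ⟨_, ε, hε, hc.isGeodesicOn isOpen_Ioo hct, ?_, hC⟩
    refine totalSpace_mk_eq_mk (p := p) ?_ ((extChartAt 𝓘(ℝ, E) p).map_target (hct 0 h0)) ?_
    · rw [hc0, (extChartAt 𝓘(ℝ, E) p).left_inv hx]
    · rw [chartDeriv_velocity (hc 0 h0).1 (hct 0 h0), hc0']
  · rintro ⟨γ, ε, hε, hγ, hv, hC⟩
    obtain rfl : γ 0 = x := congrArg TotalSpace.proj hv
    obtain rfl : velocity γ 0 = v := by simpa using hv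
    have h0 : (0 : ℝ) ∈ Ioo (-ε) ε := by constructor <;> linarith
    have hcont := (hγ.mdifferentiableAt isOpen_Ioo h0).continuousAt
    obtain ⟨η, hη, hηs⟩ := Metric.mem_nhds_iff.1 (hcont.eventually_mem
      ((isOpen_extChartAt_source p).mem_nhds hx))
    have hη' : ∀ t ∈ Ioo (-min ε η) (min ε η), γ t ∈ (extChartAt 𝓘(ℝ, E) p).source := by
      intro t ht
      refine hηs ?_
      rw [Real.ball_eq_Ioo]
      constructor <;> linarith [ht.1, ht.2, min_le_right ε η]
    have hsub : Ioo (-min ε η) (min ε η) ⊆ Ioo (-ε) ε := fun t ht ↦ by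
      constructor <;> linarith [ht.1, ht.2, min_le_left ε η]
    have hγ' : IsGeodesicOn (E := E) γ (Ioo (-min ε η) (min ε η)) :=
      ⟨hγ.1.mono hsub, fun t ht ↦ hγ.2 t (hsub ht)⟩
    refine ⟨min ε η, by positivity, _, _, hγ'.isSprayCurveOn isOpen_Ioo hη',
      fun t ht ↦ (extChartAt 𝓘(ℝ, E) p).map_source (hη' t ht), rfl, rfl, fun t ht ↦ ?_⟩
    rw [(extChartAt 𝓘(ℝ, E) p).left_inv
      (hη' t ⟨by linarith [ht.1, show 0 < min ε η by positivity], ht.2⟩)]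
    exact hC t ⟨ht.1, ht.2.trans_le (min_le_left _ _)⟩

theorem mem_tangentCone_iff {C : Set M} {x : M}
    (hx : x ∈ (extChartAt 𝓘(ℝ, E) p).source) (v : TangentSpace 𝓘(ℝ, E) x) :
    v ∈ tangentCone C x ↔ chartDeriv p x v ∈ chartCone C p (extChartAt 𝓘(ℝ, E) p x) := by
  obtain ⟨e, he⟩ : ∃ e : TangentSpace 𝓘(ℝ, E) x ≃L[ℝ] E,
    (e : TangentSpace 𝓘(ℝ, E) x →L[ℝ] E) = chartDeriv p x := isInvertible_mfderiv_extChartAt hx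
  have he' : ∀ v, e v = chartDeriv p x v := fun v ↦
    congrArg (fun L : TangentSpace 𝓘(ℝ, E) x →L[ℝ] E ↦ L v) he
  have h1 := e.toHomeomorph.preimage_closure (chartVelocities C p (extChartAt 𝓘(ℝ, E) p x))
  rw [chartCone, tangentCone, ← he']
  refine Iff.trans ?_ (Set.ext_iff.1 h1 v).symm
  suffices h2 : {v : TangentSpace 𝓘(ℝ, E) x | ∃ γ : ℝ → M, ∃ ε > 0,
      IsGeodesicOn (E := E) γ (Ioo (-ε) ε) ∧
      (⟨γ 0, velocity γ 0⟩ : TangentBundle 𝓘(ℝ, E) M) = ⟨x, v⟩ ∧ ∀ t ∈ Ico 0 ε, γ t ∈ C} =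
      e.toHomeomorph ⁻¹' chartVelocities C p (extChartAt 𝓘(ℝ, E) p x) by rw [h2]
  ext w
  exact (chartDeriv_mem_chartVelocities_iff hx w).symm.trans (by rw [← he' w]; rfl)

/-- A convex set is locally convex in charts. -/
theorem exists_isLocallyConvex [IsRiemannianManifold 𝓘(ℝ, E) M] {C : Set M}
    (hC : IsConvex E C) (p : M) :
    ∃ r δ A : ℝ, Metric.closedBall (extChartAt 𝓘(ℝ, E) p p) r ⊆ (extChartAt 𝓘(ℝ, E) p).target ∧
      IsLocallyConvex (sprayOf (chartChristoffel p)) (extChartAt 𝓘(ℝ, E) p p) r δ A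
        (chartSet C p) (chartCone C p) := by
  have : CompleteSpace E := FiniteDimensional.complete ℝ E
  set P := extChartAt 𝓘(ℝ, E) p p with hP
  have hm := isMetricOn_chartMetric (E := E) p
  have hPt : P ∈ (extChartAt 𝓘(ℝ, E) p).target := mem_extChartAt_target p
  have hcd := hm.contDiffAt_sprayOf hPt 0
  have hcd1 := hcd.of_le (WithTop.coe_le_coe.2 (le_top : (1 : ℕ∞) ≤ ⊤))
  have hhom := sprayOf_hom (chartChristoffel (E := E) p)
  obtain ⟨r₁, hr₁, A, hA, -, htaylor⟩ :=
    exists_taylor_bound (hcd.of_le (WithTop.coe_le_coe.2 (le_top : (2 : ℕ∞) ≤ ⊤)))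
  obtain ⟨r₂, hr₂, hlip⟩ := exists_lipschitzOnWith_spray hhom hcd1
  obtain ⟨r₃, hr₃, A', hA', hen⟩ := hm.exists_energy_bound hPt
  obtain ⟨r₄, hr₄, hrt⟩ := Metric.nhds_basis_closedBall.mem_iff.1 (hm.isOpen.mem_nhds hPt)
  obtain ⟨r, hr, h1, h2, h3, h4⟩ : ∃ r > 0, r ≤ r₁ ∧ r ≤ r₂ ∧ r ≤ r₃ ∧ r ≤ r₄ :=
    ⟨min (min r₁ r₂) (min r₃ r₄), by positivity, (min_le_left _ _).trans (min_le_left _ _),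
      (min_le_left _ _).trans (min_le_right _ _), (min_le_right _ _).trans (min_le_left _ _),
      (min_le_right _ _).trans (min_le_right _ _)⟩
  replace htaylor := fun y hy z hz ↦ htaylor y (Metric.closedBall_subset_closedBall h1 hy) z
    (Metric.closedBall_subset_closedBall h1 hz)
  replace hlip := hlip.mono (Metric.closedBall_subset_closedBall h2)
  replace hen := fun y hy z hz ↦ hen y (Metric.closedBall_subset_closedBall h3 hy) z
    (Metric.closedBall_subset_closedBall h3 hz)
  replace hrt := (Metric.closedBall_subset_closedBall h4).trans hrt
  obtain ⟨δ₁, hδ₁, hbvp⟩ := exists_sprayCurve_boundary hhom hcd1 hr hlip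
  choose! c c' hc0 hc1 hc hcS using hbvp
  set δ₂ := min δ₁ r with hδ₂
  have hδ₂0 : 0 < δ₂ := by positivity
  have hnhds : {q : M | q ∈ (extChartAt 𝓘(ℝ, E) p).source ∧
      ‖extChartAt 𝓘(ℝ, E) p q - P‖ < δ₂} ∈ 𝓝 p := by
    have hcont : ContinuousAt (fun q ↦ ‖extChartAt 𝓘(ℝ, E) p q - P‖) p :=
      ((continuousAt_extChartAt p).sub continuousAt_const).norm
    exact Filter.Eventually.and (extChartAt_source_mem_nhds p)
      (hcont.eventually_lt continuousAt_const (by rw [← hP, sub_self, norm_zero]; exact hδ₂0))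
  obtain ⟨ρ, hρ, hball⟩ := EMetric.mem_nhds_iff.1 hnhds
  -- One half of ρ is for the distance of the starting point from p, the other for the length of the
  -- geodesic.
  have hρ2 : 0 < ρ / 2 := ENNReal.half_pos hρ.ne'
  obtain ⟨η, hη0, hη⟩ := ENNReal.lt_iff_exists_nnreal_btwn.1 hρ2
  have hη0' : 0 < (η : ℝ) := by exact_mod_cast hη0
  set N := ‖chartMetric p P‖ + 1
  have hN0 : 0 < N := by positivity
  have hnear : ∀ᶠ y in 𝓝 P, edist ((extChartAt 𝓘(ℝ, E) p).symm y) p < ρ / 2 ∧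
      ‖chartMetric p y‖ < N := by
    have e1 : ContinuousAt (fun y ↦ edist ((extChartAt 𝓘(ℝ, E) p).symm y) p) P :=
      (contMDiffAt_chart_symm hPt).continuousAt.edist continuousAt_const
    exact (e1.eventually_lt continuousAt_const (by simpa [hP] using hρ2)).and
      (eventually_norm_lt (V := E →L[ℝ] E →L[ℝ] ℝ) (hm.smooth P hPt).continuousAt)
  obtain ⟨δ₃, hδ₃, hδ₃s⟩ := Metric.nhds_basis_closedBall.mem_iff.1 hnear
  -- The last bound controls the length of the geodesic: its coordinate velocity is at most 4δ and
  -- the metric has norm at most N, so the length is at most 4δ(N + 1) ≤ η < ρ / 2.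
  obtain ⟨δ, hδ, d2, d3, d4⟩ : ∃ δ > 0, δ ≤ δ₂ ∧ δ ≤ δ₃ ∧ δ ≤ η / (4 * (N + 1)) :=
    ⟨min δ₂ (min δ₃ (η / (4 * (N + 1)))), by positivity, min_le_left _ _,
      (min_le_right _ _).trans (min_le_left _ _), (min_le_right _ _).trans (min_le_right _ _)⟩
  have hIcc : Icc (0 : ℝ) 1 ⊆ Ioo (-1) 2 := Icc_subset_Ioo_neg_one_two
  have i1 : (1 : ℝ) ∈ Icc (0 : ℝ) 1 := right_mem_Icc.2 zero_le_one
  have dδ₁ : δ₂ ≤ δ₁ := min_le_left _ _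
  refine ⟨r, δ, A, hrt, hhom, hr, hδ, hlip, hA, htaylor, fun x hx hxδ y hy hyδ ↦ ?_,
    fun _ ↦ isClosed_closure, fun x v hv a ha ↦ smul_mem_chartCone hv ha, ?_⟩
  · have hx1 := hxδ.trans (d2.trans dδ₁)
    have hy1 := hyδ.trans (d2.trans dδ₁)
    have hct : ∀ t ∈ Ioo (-1 : ℝ) 2, c x y t ∈ (extChartAt 𝓘(ℝ, E) p).target := fun t ht ↦
      hrt (mem_closedBall_iff_norm.2 (mem_closedBall_prod_iff.1 (hcS x y hx1 hy1 t ht)).1)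
    have hlen : ENNReal.ofReal (√(chartMetric p y (c' x y 1) (c' x y 1))) ≤ ρ / 2 := by
      have g1 := norm_deriv_le_of_sprayCurve hhom hr hlip ((hc x y hx1 hy1).mono hIcc)
        (fun t ht ↦ hcS x y hx1 hy1 t (hIcc ht)) i1
      rw [hc0 x y hx1 hy1, hc1 x y hx1 hy1] at g1
      have g2 : ‖y - x‖ ≤ 2 * δ := by
        have := norm_sub_le (y - P) (x - P)
        rw [sub_sub_sub_cancel_right] at this
        linarith
      have g3 : ‖c' x y 1‖ ≤ 4 * δ := by linarith
      have g4 := (hδ₃s (mem_closedBall_iff_norm.2 (hyδ.trans d3))).2.le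
      have g5 : chartMetric p y (c' x y 1) (c' x y 1) ≤ N * (4 * δ) * (4 * δ) :=
        calc chartMetric p y (c' x y 1) (c' x y 1)
            ≤ ‖chartMetric p y (c' x y 1) (c' x y 1)‖ := Real.le_norm_self _
          _ ≤ ‖chartMetric p y‖ * ‖c' x y 1‖ * ‖c' x y 1‖ :=
              (chartMetric p y).le_opNorm₂ _ _
          _ ≤ N * (4 * δ) * (4 * δ) := by gcongr
      have g6 : δ * (4 * (N + 1)) ≤ η := (le_div_iff₀ (by positivity)).1 d4
      have g7 : √(chartMetric p y (c' x y 1) (c' x y 1)) ≤ η := by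
        rw [Real.sqrt_le_left hη0'.le]
        refine g5.trans ?_
        calc N * (4 * δ) * (4 * δ) ≤ (δ * (4 * (N + 1))) ^ 2 := by
              have : 0 ≤ δ ^ 2 * (N ^ 2 + N + 1) := by positivity
              nlinarith
          _ ≤ (η : ℝ) ^ 2 := by gcongr
      calc ENNReal.ofReal _ ≤ ENNReal.ofReal η := ENNReal.ofReal_le_ofReal g7
        _ ≤ ρ / 2 := by rw [ENNReal.ofReal_coe_nnreal]; exact hη.le
    have hmin := pathELength_eq_edist_of_isSprayCurveOn (p := p) (x := x) (y := y) (r := r)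
      (δ := δ₂) (c := c x) (c' := c' x) (min_le_right _ _) hr hrt hlip hA' hen
      (fun z hz ↦ ⟨hc0 x z hx1 (hz.trans dδ₁), hc1 x z hx1 (hz.trans dδ₁),
        hc x z hx1 (hz.trans dδ₁), hcS x z hx1 (hz.trans dδ₁)⟩)
      (ENNReal.add_halves ρ).le (fun q hq ↦ hball hq) hx.1 (hyδ.trans d2)
      (hδ₃s (mem_closedBall_iff_norm.2 (hxδ.trans d3))).1 hlen
    have hgeo := (hc x y hx1 hy1).isGeodesicOn isOpen_Ioo hct
    have hCt : ∀ t ∈ Icc (0 : ℝ) 1, (extChartAt 𝓘(ℝ, E) p).symm (c x y t) ∈ C := by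
      -- The geodesic is minimizing, so convexity places it in C; its domain (-1, 2) is (-δ, 1 + δ)
      -- with δ = 1.
      refine hC _ hx.2 _ hy.2 _ ⟨⟨1, one_pos, ?_⟩, ?_, ?_, hmin⟩
      · rwa [one_add_one_eq_two]
      · exact congrArg (extChartAt 𝓘(ℝ, E) p).symm (hc0 x y hx1 hy1)
      · exact congrArg (extChartAt 𝓘(ℝ, E) p).symm (hc1 x y hx1 hy1)
    have hsub : Ioo (-1 : ℝ) 1 ⊆ Ioo (-1) 2 := Ioo_subset_Ioo_right one_le_two
    exact ⟨c x y, c' x y, hc0 x y hx1 hy1, hc1 x y hx1 hy1, (hc x y hx1 hy1).mono hIcc,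
      fun t ht ↦ hcS x y hx1 hy1 t (hIcc ht), fun t ht ↦ ⟨hct t (hIcc ht), hCt t ht⟩,
      subset_closure ⟨1, one_pos, c x y, c' x y, (hc x y hx1 hy1).mono hsub,
        fun t ht ↦ hct t (hsub ht), hc0 x y hx1 hy1, rfl, fun t ht ↦ hCt t ⟨ht.1, ht.2.le⟩⟩⟩
  · intro x hx hxδ v hv ε hε
    obtain ⟨w, ⟨ε', hε', σ, σ', hσ, hσt, hσ0, rfl, hσC⟩, hw⟩ := Metric.mem_closure_iff.1 hv ε hε
    refine ⟨σ' 0, by rwa [dist_comm, dist_eq_norm] at hw, σ,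
      (hσ 0 ⟨by linarith, hε'⟩).1, hσ0, ?_⟩
    filter_upwards [Ioo_mem_nhdsGT hε'] with t ht
    exact ⟨hσt t ⟨by linarith [ht.1], ht.2⟩, hσC t ⟨ht.1.le, ht.2⟩⟩

end ChartCone

/-! ### Parallel frames along geodesics in the convex set -/

section LocalFrame

set_option linter.unusedSectionVars false

theorem exists_fderiv_bound {E W : Type*} [NormedAddCommGroup E] [NormedSpace ℝ E]
    [NormedAddCommGroup W] [NormedSpace ℝ W] {G : E → W} {y : E} (hG : ContDiffAt ℝ 1 G y) :
    ∃ a ≥ 0, ∀ᶠ z in 𝓝 y, ∀ x, ‖fderiv ℝ G z x‖ ≤ a * ‖x‖ := by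
  refine ⟨‖fderiv ℝ G y‖ + 1, by positivity, ?_⟩
  have h0 : ContinuousAt (fderiv ℝ G) y := (hG.fderiv_right (m := 0) (by norm_num)).continuousAt
  filter_upwards [eventually_norm_lt h0] with z hz x
  exact (fderiv ℝ G z).le_of_opNorm_le hz.le x

theorem exists_bilinCurvature_bound {E : Type*} [NormedAddCommGroup E] [NormedSpace ℝ E]
    {Γ : E → E →L[ℝ] E →L[ℝ] E} {y : E} (hΓ : ContDiffAt ℝ 1 Γ y) {b : ℝ} :
    ∃ Q ≥ 0, ∀ᶠ z in 𝓝 y, ∀ u w, ‖u‖ ≤ b → ‖bilinCurvature Γ z w u u‖ ≤ Q * ‖w‖ := by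
  obtain ⟨a, ha, hD⟩ := exists_fderiv_bound (W := E →L[ℝ] E →L[ℝ] E) hΓ
  refine ⟨2 * a * b ^ 2 + 2 * (‖Γ y‖ + 1) ^ 2 * b ^ 2, by positivity, ?_⟩
  have hΓ' := eventually_norm_lt (V := E →L[ℝ] E →L[ℝ] E) hΓ.continuousAt
  filter_upwards [hD, hΓ'] with z hz hz' u w hu
  refine norm_bilinCurvature_le ha (by positivity) (fun x₁ x₂ x₃ ↦ ?_) (fun x₁ x₂ ↦ ?_) hu w
  · refine ((fderiv ℝ Γ z x₁).le_opNorm₂ x₂ x₃).trans ?_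
    gcongr
    exact hz x₁
  · refine ((Γ z).le_opNorm₂ x₁ x₂).trans ?_
    gcongr

variable {E : Type*} [NormedAddCommGroup E] [NormedSpace ℝ E] [FiniteDimensional ℝ E]
  {M : Type*} [EMetricSpace M] [ChartedSpace E M] [IsManifold 𝓘(ℝ, E) ∞ M]
  [RiemannianBundle (fun (x : M) ↦ TangentSpace 𝓘(ℝ, E) x)]
  [IsContMDiffRiemannianBundle 𝓘(ℝ, E) ∞ E (fun (x : M) ↦ TangentSpace 𝓘(ℝ, E) x)]
  {C : Set M} {J : Set ℝ} {γ : ℝ → M} {t₀ : ℝ}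

/-- In a fixed chart, parallel translation is a linear equation with coefficient Γ(c', ·). Its
fundamental solution is the frame, and shrinking the interval makes all bounds uniform. -/
theorem exists_isGeodesicFrame (hJ : IsOpen J) (hγ : IsGeodesicOn (E := E) γ J)
    (hγC : ∀ t ∈ J, γ t ∈ C) (ht₀ : t₀ ∈ J) {r δ : ℝ} (hr : 0 < r) (hδ : 0 < δ) :
    ∃ T > 0, ∃ Φ Ψ : ℝ → E →L[ℝ] E, ∃ b B Q : ℝ, 0 ≤ B ∧ 0 ≤ Q ∧
      Φ t₀ = ContinuousLinearMap.id ℝ E ∧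
      IsGeodesicFrame (chartChristoffel (γ t₀)) (extChartAt 𝓘(ℝ, E) (γ t₀) (γ t₀)) r δ
        (chartSet C (γ t₀)) (fun t ↦ extChartAt 𝓘(ℝ, E) (γ t₀) (γ t))
        (fun t ↦ chartDeriv (γ t₀) (γ t) (velocity γ t)) Φ Ψ
        (Ioo (t₀ - 3 * T) (t₀ + 3 * T)) b B Q ∧
      ∀ t ∈ Ioo (t₀ - 3 * T) (t₀ + 3 * T), t ∈ J ∧
        γ t ∈ (extChartAt 𝓘(ℝ, E) (γ t₀)).source ∧
        HasDerivAt Ψ ((Ψ t).comp (chartChristoffel (γ t₀) (extChartAt 𝓘(ℝ, E) (γ t₀) (γ t))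
          (chartDeriv (γ t₀) (γ t) (velocity γ t)))) t := by
  set p := γ t₀ with hp
  set P := extChartAt 𝓘(ℝ, E) p p with hP
  let c : ℝ → E := fun t ↦ extChartAt 𝓘(ℝ, E) p (γ t)
  let c' : ℝ → E := fun t ↦ chartDeriv p (γ t) (velocity γ t)
  have hm := isMetricOn_chartMetric (E := E) p
  have hPt : P ∈ (extChartAt 𝓘(ℝ, E) p).target := mem_extChartAt_target p
  have hγt₀ := (hγ.mdifferentiableAt hJ ht₀).continuousAt
  let J' : Set ℝ := J ∩ interior (γ ⁻¹' (extChartAt 𝓘(ℝ, E) p).source)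
  have hJ' : IsOpen J' := hJ.inter isOpen_interior
  have ht₀' : t₀ ∈ J' :=
    ⟨ht₀, mem_interior_iff_mem_nhds.2 (hγt₀ (extChartAt_source_mem_nhds p))⟩
  have hsrc : ∀ t ∈ J', γ t ∈ (extChartAt 𝓘(ℝ, E) p).source := fun t ht ↦
    (interior_subset ht.2 : t ∈ γ ⁻¹' (extChartAt 𝓘(ℝ, E) p).source)
  have hspray : IsSprayCurveOn (sprayOf (chartChristoffel p)) c c' J' :=
    IsGeodesicOn.isSprayCurveOn ⟨hγ.1.mono inter_subset_left, fun t ht ↦ hγ.2 t ht.1⟩ hJ' hsrc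
  have hA : ∀ᶠ t in 𝓝 t₀, ContinuousAt (fun t ↦ chartChristoffel p (c t) (c' t)) t := by
    filter_upwards [hJ'.mem_nhds ht₀'] with t ht
    have h1 : ContinuousAt (fun t ↦ chartChristoffel p (c t)) t :=
      ContinuousAt.comp (g := chartChristoffel p) (f := c)
        (hm.contDiffAt_christoffelMap ((extChartAt 𝓘(ℝ, E) p).map_source (hsrc t ht))).continuousAt
        (hspray t ht).1.continuousAt
    exact h1.clm_apply (hspray t ht).2.continuousAt
  obtain ⟨T, hT, Φ, Ψ, B, hB, hΦ, H⟩ := exists_frame hA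
  obtain ⟨Q, hQ, hcurv⟩ := exists_bilinCurvature_bound (b := ‖c' t₀‖ + 1)
    ((hm.contDiffAt_christoffelMap hPt).of_le (WithTop.coe_le_coe.2 (le_top : (1 : ℕ∞) ≤ ⊤)))
  have hc : Filter.Tendsto c (𝓝 t₀) (𝓝 P) := (hspray t₀ ht₀').1.continuousAt
  have hnear : ∀ ε > 0, ∀ᶠ t in 𝓝 t₀, ‖c t - P‖ ≤ ε := by
    intro ε hε
    filter_upwards [hc (Metric.closedBall_mem_nhds P hε)] with t ht
    exact mem_closedBall_iff_norm.1 ht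
  have hmem : ∀ᶠ t in 𝓝 t₀, t ∈ J' := hJ'.mem_nhds ht₀'
  have hev := hmem.and <|
    (hnear _ (half_pos hr)).and <| (hnear _ (half_pos hδ)).and <|
    (eventually_norm_lt (hspray t₀ ht₀').2.continuousAt).and <| hc.eventually hcurv
  obtain ⟨η, hη, hball⟩ := Metric.mem_nhds_iff.1 hev
  have hT' : ∀ t ∈ Ioo (t₀ - 3 * (min T η / 3)) (t₀ + 3 * (min T η / 3)),
      t ∈ Ioo (t₀ - T) (t₀ + T) ∧ t ∈ Metric.ball t₀ η := by
    intro t ht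
    have h1 := min_le_left T η
    have h2 := min_le_right T η
    rw [Real.ball_eq_Ioo]
    refine ⟨⟨?_, ?_⟩, ?_, ?_⟩ <;> linarith [ht.1, ht.2]
  refine ⟨min T η / 3, by positivity, Φ, Ψ, ‖c' t₀‖ + 1, B, Q, hB.le, hQ, hΦ, ?_, fun t ht ↦ ?_⟩
  · constructor
    · exact fun t ht ↦ hspray t (hball (hT' t ht).2).1
    · intro t ht
      have h1 := (hball (hT' t ht).2).1
      exact map_mem_chartSet (hsrc t h1) (hγC t h1.1)
    · exact fun t ht ↦ (hball (hT' t ht).2).2.1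
    · exact fun t ht ↦ (hball (hT' t ht).2).2.2.1
    · exact fun t ht ↦ (hball (hT' t ht).2).2.2.2.1.le
    · exact fun t ht ↦ (H t (hT' t ht).1).1
    · exact fun t ht ↦ (H t (hT' t ht).1).2.1
    · exact fun t ht ↦ (H t (hT' t ht).1).2.2.1
    · exact fun t ht ↦ (H t (hT' t ht).1).2.2.2.1
    · exact fun t ht ↦ (H t (hT' t ht).1).2.2.2.2.1
    · intro t ht w
      have h1 := hball (hT' t ht).2
      exact h1.2.2.2.2 _ w h1.2.2.2.1.le
  · have h1 := (hball (hT' t ht).2).1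
    exact ⟨h1.1, hsrc t h1, (H t (hT' t ht).1).2.2.2.2.2⟩

variable (C γ t₀) in
/-- The local facts about parallel fields and tangent cones along a geodesic, on the interval
`I` around `t₀`. -/
structure IsGoodInterval (I : Set ℝ) : Prop where
  exists_parallel : ∀ s ∈ I, ∀ v : TangentSpace 𝓘(ℝ, E) (γ s),
    ∃ V : ∀ t, TangentSpace 𝓘(ℝ, E) (γ t), IsParallelOn γ V I ∧ V s = v
  unique : ∀ V W : ∀ t, TangentSpace 𝓘(ℝ, E) (γ t), IsParallelOn γ V I → IsParallelOn γ W I →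
    ∀ s ∈ I, V s = W s → ∀ t ∈ I, V t = W t
  cone : ∀ V : ∀ t, TangentSpace 𝓘(ℝ, E) (γ t), IsParallelOn γ V I → ∀ s ∈ I,
    V s ∈ tangentCone C (γ s) → ∀ t ∈ I, V t ∈ tangentCone C (γ t)
  curvature : ∀ v ∈ chartCone C (γ t₀) (extChartAt 𝓘(ℝ, E) (γ t₀) (γ t₀)),
    bilinCurvature (chartChristoffel (γ t₀)) (extChartAt 𝓘(ℝ, E) (γ t₀) (γ t₀)) v
      (chartDeriv (γ t₀) (γ t₀) (velocity γ t₀)) (chartDeriv (γ t₀) (γ t₀) (velocity γ t₀)) ∈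
    vectorTangentCone (chartCone C (γ t₀) (extChartAt 𝓘(ℝ, E) (γ t₀) (γ t₀))) v
  add_mem : ∀ v ∈ chartCone C (γ t₀) (extChartAt 𝓘(ℝ, E) (γ t₀) (γ t₀)),
    ∀ w ∈ chartCone C (γ t₀) (extChartAt 𝓘(ℝ, E) (γ t₀) (γ t₀)),
    v + w ∈ chartCone C (γ t₀) (extChartAt 𝓘(ℝ, E) (γ t₀) (γ t₀))
  zero_mem : (0 : E) ∈ chartCone C (γ t₀) (extChartAt 𝓘(ℝ, E) (γ t₀) (γ t₀))

/-- In a chart the parallel fields near t₀ are exactly t ↦ Φ t u with u constant, which reduces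
every clause to a property of the frame. -/
theorem exists_isGoodInterval [IsRiemannianManifold 𝓘(ℝ, E) M] (hC : IsConvex E C)
    (hJ : IsOpen J) (hγ : IsGeodesicOn (E := E) γ J) (hγC : ∀ t ∈ J, γ t ∈ C) (ht₀ : t₀ ∈ J) :
    ∃ T > 0, Ioo (t₀ - T) (t₀ + T) ⊆ J ∧ IsGoodInterval (E := E) C γ t₀ (Ioo (t₀ - T) (t₀ + T)) := by
  obtain ⟨r, δ, A, hrt, hlc⟩ := exists_isLocallyConvex (E := E) hC (γ t₀)
  obtain ⟨T, hT, Φ, Ψ, b, B, Q, hB, hQ, hΦ, hf, hΨ⟩ :=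
    exists_isGeodesicFrame hJ hγ hγC ht₀ hlc.r_pos hlc.δ_pos
  set p := γ t₀ with hp
  set P := extChartAt 𝓘(ℝ, E) p p with hP
  set I := Ioo (t₀ - T) (t₀ + T) with hI
  have hm := isMetricOn_chartMetric (E := E) p
  have hPt : P ∈ (extChartAt 𝓘(ℝ, E) p).target := mem_extChartAt_target p
  have hsymm : IsSymmChristoffelOn (chartChristoffel p) (Metric.closedBall P r) :=
    ⟨fun y hy ↦ hm.isSymmChristoffelOn.diff y (hrt hy),
      fun y hy ↦ hm.isSymmChristoffelOn.symm y (hrt hy),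
      fun y hy ↦ hm.isSymmChristoffelOn.symm_fderiv y (hrt hy)⟩
  have hsub : I ⊆ Ioo (t₀ - 3 * T) (t₀ + 3 * T) := fun t ht ↦ by
    constructor <;> linarith [ht.1, ht.2]
  have ht₀I : t₀ ∈ I := by constructor <;> linarith
  have hIJ : I ⊆ J := fun t ht ↦ (hΨ t (hsub ht)).1
  have hsrc : ∀ t ∈ I, γ t ∈ (extChartAt 𝓘(ℝ, E) p).source := fun t ht ↦ (hΨ t (hsub ht)).2.1
  have hpar : ∀ V : ∀ t, TangentSpace 𝓘(ℝ, E) (γ t),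
      IsParallelOn γ V I ↔ ∀ t ∈ I, IsParallelInChart p γ V t := fun V ↦
    isParallelOn_iff (fun t ht ↦ hγ.mdifferentiableAt hJ (hIJ ht)) hsrc
  have hframe : ∀ V : ∀ t, TangentSpace 𝓘(ℝ, E) (γ t), IsParallelOn γ V I → ∃ u, ∀ t ∈ I,
      chartDeriv p (γ t) (V t) = Φ t u := by
    intro V hV
    rw [hpar] at hV
    -- The equation for Ψ is adjoint to that of parallel fields, so the frame coordinates of V are
    -- constant.
    have hconst : ∀ t ∈ I, HasDerivAt (fun t ↦ Ψ t (chartDeriv p (γ t) (V t))) 0 t := by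
      intro t ht
      refine ((hΨ t (hsub ht)).2.2.clm_apply (hV t ht)).congr_deriv ?_
      rw [ContinuousLinearMap.comp_apply, map_neg, add_neg_cancel]
    refine ⟨Ψ t₀ (chartDeriv p (γ t₀) (V t₀)), fun t ht ↦ ?_⟩
    rw [← eq_of_hasDerivAt_zero (convex_Ioo _ _) hconst ht ht₀I, hf.right_inv t (hsub ht)]
  have hinj : ∀ t ∈ I, Function.Injective (Φ t) := fun t ht ↦
    Function.LeftInverse.injective (hf.left_inv t (hsub ht))
  have hPP : ‖P - P‖ ≤ 0 := by simp
  have hPS : P ∈ chartSet C p := hf.mem t₀ (hsub ht₀I)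
  refine ⟨T, hT, hIJ, fun s hs v ↦ ?_, fun V W hV hW s hs hVW t ht ↦ ?_,
    fun V hV s hs hVs t ht ↦ ?_, fun v hv ↦ ?_, ?_, ?_⟩
  · let u := Ψ s (chartDeriv p (γ s) v)
    have hV : ∀ t ∈ I, chartDeriv p (γ t) (Function.invFun (chartDeriv p (γ t)) (Φ t u)) = Φ t u :=
      fun t ht ↦ Function.invFun_eq ((chartDeriv_bijective (hsrc t ht)).2 _)
    refine ⟨fun t ↦ Function.invFun (chartDeriv p (γ t)) (Φ t u), (hpar _).2 fun t ht ↦ ?_, ?_⟩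
    · rw [IsParallelInChart, hV t ht]
      refine (hf.parallel t (hsub ht) u).congr_of_eventuallyEq ?_
      filter_upwards [isOpen_Ioo.mem_nhds ht] with τ hτ using hV τ hτ
    · apply (chartDeriv_bijective (hsrc s hs)).1
      rw [hV s hs]
      exact hf.right_inv s (hsub hs) _
  · obtain ⟨u, hu⟩ := hframe V hV
    obtain ⟨w, hw⟩ := hframe W hW
    have huw : u = w := hinj s hs (by rw [← hu s hs, ← hw s hs, hVW])
    apply (chartDeriv_bijective (hsrc t ht)).1
    rw [hu t ht, hw t ht, huw]
  · obtain ⟨u, hu⟩ := hframe V hV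
    rw [mem_tangentCone_iff (hsrc s hs), hu s hs] at hVs
    rw [mem_tangentCone_iff (hsrc t ht), hu t ht]
    exact hf.transport_mem hlc hsymm hB hQ hs ht hVs
  · exact hf.curvature_mem hlc hsymm hB hQ hT ((hm.contDiffAt_christoffelMap hPt).of_le
      (WithTop.coe_le_coe.2 (le_top : (1 : ℕ∞) ≤ ⊤))) hΦ hv
  · exact fun v hv w hw ↦ hlc.add_mem hPS (hPP.trans (half_pos hlc.r_pos).le)
      (hPP.trans (half_pos hlc.δ_pos).le) hv hw
  · exact hlc.zero_mem hPS (hPP.trans hlc.δ_pos.le)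

end LocalFrame

/-! ### Gluing along the geodesic, and the lineality space -/

section Global

set_option linter.unusedSectionVars false

variable {E : Type*} [NormedAddCommGroup E] [NormedSpace ℝ E] [FiniteDimensional ℝ E]
  {M : Type*} [EMetricSpace M] [ChartedSpace E M] [IsManifold 𝓘(ℝ, E) ∞ M]
  [RiemannianBundle (fun (x : M) ↦ TangentSpace 𝓘(ℝ, E) x)]
  [IsContMDiffRiemannianBundle 𝓘(ℝ, E) ∞ E (fun (x : M) ↦ TangentSpace 𝓘(ℝ, E) x)]
  [IsRiemannianManifold 𝓘(ℝ, E) M]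
  {C : Set M} {I J : Set ℝ} {γ : ℝ → M} {V W : ∀ t, TangentSpace 𝓘(ℝ, E) (γ t)} {a b : ℝ}

theorem IsParallelOn.mono (h : IsParallelOn γ V J) (hI : I ⊆ J) : IsParallelOn γ V I :=
  fun t ht ↦ h t (hI ht)

theorem IsParallelOn.congr_of_eqOn (h : IsParallelOn γ V I) {t₀ : ℝ} (hI : I ∈ 𝓝 t₀)
    (hVW : ∀ t ∈ I, W t = V t) : IsParallelOn γ W {t₀} := by
  rintro _ rfl
  have h0 := mem_of_mem_nhds hI
  have h1 := h _ h0
  rw [← hVW _ h0] at h1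
  refine h1.congr_of_eventuallyEq ?_
  filter_upwards [hI] with t ht
  rw [hVW t ht]

theorem IsGeodesicOn.mono (h : IsGeodesicOn (E := E) γ J) (hI : I ⊆ J) :
    IsGeodesicOn (E := E) γ I :=
  ⟨h.1.mono hI, h.2.mono hI⟩

/-- Induction along an interval for relations which hold on good intervals. -/
theorem induction_of_isGoodInterval (hC : IsConvex E C) (hJ : IsOpen J) (hJ' : J.OrdConnected)
    (hγ : IsGeodesicOn (E := E) γ J) (hγC : ∀ t ∈ J, γ t ∈ C) (R : ℝ → ℝ → Prop)
    (htrans : ∀ s t u, s ∈ J → t ∈ J → u ∈ J → R s t → R t u → R s u)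
    (hR : ∀ t₀ T : ℝ, 0 < T → Ioo (t₀ - T) (t₀ + T) ⊆ J →
      IsGoodInterval (E := E) C γ t₀ (Ioo (t₀ - T) (t₀ + T)) →
      ∀ s ∈ Ioo (t₀ - T) (t₀ + T), ∀ t ∈ Ioo (t₀ - T) (t₀ + T), R s t)
    (ha : a ∈ J) (hb : b ∈ J) : R a b := by
  refine hJ'.isPreconnected.induction₂' R (fun t ht ↦ ?_) htrans ha hb
  obtain ⟨T, hT, hTJ, hgood⟩ := exists_isGoodInterval hC hJ hγ hγC ht
  have h0 : t ∈ Ioo (t - T) (t + T) := by constructor <;> linarith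
  filter_upwards [mem_nhdsWithin_of_mem_nhds (isOpen_Ioo.mem_nhds h0)] with s hs
  exact ⟨hR t T hT hTJ hgood t h0 s hs, hR t T hT hTJ hgood s hs t h0⟩

theorem IsParallelOn.eq_of_eq (hC : IsConvex E C) (hJ : IsOpen J) (hJ' : J.OrdConnected)
    (hγ : IsGeodesicOn (E := E) γ J) (hγC : ∀ t ∈ J, γ t ∈ C) (hV : IsParallelOn γ V J)
    (hW : IsParallelOn γ W J) (ha : a ∈ J) (hb : b ∈ J) (h : V a = W a) : V b = W b :=
  induction_of_isGoodInterval hC hJ hJ' hγ hγC (fun s t ↦ V s = W s → V t = W t)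
    (fun _ _ _ _ _ _ h1 h2 h3 ↦ h2 (h1 h3))
    (fun _ _ _ hTJ hg s hs t ht hst ↦
      hg.unique V W (hV.mono hTJ) (hW.mono hTJ) s hs hst t ht) ha hb h

theorem IsParallelOn.mem_tangentCone (hC : IsConvex E C) (hJ : IsOpen J) (hJ' : J.OrdConnected)
    (hγ : IsGeodesicOn (E := E) γ J) (hγC : ∀ t ∈ J, γ t ∈ C) (hV : IsParallelOn γ V J)
    (ha : a ∈ J) (hb : b ∈ J) (h : V a ∈ tangentCone C (γ a)) : V b ∈ tangentCone C (γ b) :=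
  induction_of_isGoodInterval hC hJ hJ' hγ hγC
    (fun s t ↦ V s ∈ tangentCone C (γ s) → V t ∈ tangentCone C (γ t))
    (fun _ _ _ _ _ _ h1 h2 h3 ↦ h2 (h1 h3))
    (fun _ _ _ hTJ hg s hs t ht hst ↦ hg.cone V (hV.mono hTJ) s hs hst t ht) ha hb h

/-- Parallel fields extend the union of two intervals. -/
theorem exists_isParallelOn_union (hC : IsConvex E C) {I₁ I₂ : Set ℝ} (h₁ : IsOpen I₁)
    (h₁' : I₁.OrdConnected) (h₂ : IsOpen I₂) (h₂' : I₂.OrdConnected)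
    (hγ : IsGeodesicOn (E := E) γ I₁) (hγC : ∀ t ∈ I₁, γ t ∈ C) (hV : IsParallelOn γ V I₁)
    (hW : IsParallelOn γ W I₂) (ha : a ∈ I₁ ∩ I₂) (h : V a = W a) :
    ∃ V' : ∀ t, TangentSpace 𝓘(ℝ, E) (γ t), IsParallelOn γ V' (I₁ ∪ I₂) ∧ ∀ t ∈ I₁, V' t = V t := by
  classical
  let V' : ∀ t, TangentSpace 𝓘(ℝ, E) (γ t) := fun t ↦ if t ∈ I₁ then V t else W t
  have e₁ : ∀ t ∈ I₁, V' t = V t := fun t ht ↦ if_pos ht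
  have e₂ : ∀ t ∈ I₂, V' t = W t := by
    intro t ht
    by_cases ht₁ : t ∈ I₁
    · rw [e₁ t ht₁]
      exact IsParallelOn.eq_of_eq hC (h₁.inter h₂) (h₁'.inter h₂') (hγ.mono inter_subset_left)
        (fun t ht ↦ hγC t ht.1) (hV.mono inter_subset_left) (hW.mono inter_subset_right) ha
        ⟨ht₁, ht⟩ h
    · exact if_neg ht₁
  refine ⟨V', fun t ht ↦ ?_, e₁⟩
  rcases ht with ht | ht
  · exact hV.congr_of_eqOn (h₁.mem_nhds ht) e₁ t rfl
  · exact hW.congr_of_eqOn (h₂.mem_nhds ht) e₂ t rfl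

/-- The relation carried along J asks only for a field on some open subinterval containing both
times. It holds on good intervals and is transitive by gluing. -/
theorem exists_isParallelOn_subinterval (hC : IsConvex E C) (hJ : IsOpen J)
    (hJ' : J.OrdConnected) (hγ : IsGeodesicOn (E := E) γ J) (hγC : ∀ t ∈ J, γ t ∈ C)
    (ha : a ∈ J) (hb : b ∈ J) (v : TangentSpace 𝓘(ℝ, E) (γ a)) :
    ∃ I : Set ℝ, IsOpen I ∧ I.OrdConnected ∧ I ⊆ J ∧ a ∈ I ∧ b ∈ I ∧
      ∃ V : ∀ t, TangentSpace 𝓘(ℝ, E) (γ t), IsParallelOn γ V I ∧ V a = v := by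
  refine induction_of_isGoodInterval hC hJ hJ' hγ hγC
    (fun a b ↦ ∀ v : TangentSpace 𝓘(ℝ, E) (γ a), ∃ I : Set ℝ, IsOpen I ∧ I.OrdConnected ∧ I ⊆ J ∧
      a ∈ I ∧ b ∈ I ∧ ∃ V : ∀ t, TangentSpace 𝓘(ℝ, E) (γ t), IsParallelOn γ V I ∧ V a = v)
    ?_ ?_ ha hb v
  · intro s t u _ _ _ h1 h2 v
    obtain ⟨I₁, o₁, c₁, j₁, s₁, t₁, V₁, p₁, rfl⟩ := h1 v
    obtain ⟨I₂, o₂, c₂, j₂, s₂, t₂, V₂, p₂, hv⟩ := h2 (V₁ t)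
    obtain ⟨V, hV, hVs⟩ := exists_isParallelOn_union hC o₁ c₁ o₂ c₂ (hγ.mono j₁)
      (fun t ht ↦ hγC t (j₁ ht)) p₁ p₂ ⟨t₁, s₂⟩ hv.symm
    refine ⟨I₁ ∪ I₂, o₁.union o₂, ?_, union_subset j₁ j₂, Or.inl s₁, Or.inr t₂, V, hV, hVs s s₁⟩
    exact (IsPreconnected.union t t₁ s₂ c₁.isPreconnected c₂.isPreconnected).ordConnected
  · intro t₀ T hT hTJ hg s hs t ht v
    exact ⟨_, isOpen_Ioo, ordConnected_Ioo, hTJ, hs, ht, hg.exists_parallel s hs v⟩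

/-- The value at t is taken from a subinterval that reaches t. Any two of these intervals meet in an
interval containing a, where both fields equal v, so uniqueness makes the values consistent. -/
theorem exists_isParallelOn (hC : IsConvex E C) (hJ : IsOpen J)
    (hJ' : J.OrdConnected) (hγ : IsGeodesicOn (E := E) γ J) (hγC : ∀ t ∈ J, γ t ∈ C)
    (ha : a ∈ J) (v : TangentSpace 𝓘(ℝ, E) (γ a)) :
    ∃ V : ∀ t, TangentSpace 𝓘(ℝ, E) (γ t), IsParallelOn γ V J ∧ V a = v := by
  classical
  have key := fun b hb ↦ exists_isParallelOn_subinterval hC hJ hJ' hγ hγC ha (b := b) hb v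
  choose I ho hc hIJ haI hbI V hV hVa using key
  let V' : ∀ t, TangentSpace 𝓘(ℝ, E) (γ t) := fun t ↦ if ht : t ∈ J then V t ht t else 0
  have e : ∀ t (ht : t ∈ J), ∀ s ∈ I t ht, V' s = V t ht s := by
    intro t ht s hs
    have hsJ := hIJ t ht hs
    have h1 : V' s = V s hsJ s := dif_pos hsJ
    rw [h1]
    refine IsParallelOn.eq_of_eq (a := a) hC ((ho s hsJ).inter (ho t ht))
      ((hc s hsJ).inter (hc t ht)) (hγ.mono (inter_subset_left.trans (hIJ s hsJ)))
      (fun τ hτ ↦ hγC τ (hIJ t ht hτ.2)) ((hV s hsJ).mono inter_subset_left)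
      ((hV t ht).mono inter_subset_right) ⟨haI s hsJ, haI t ht⟩ ⟨hbI s hsJ, hs⟩ ?_
    rw [hVa, hVa]
  refine ⟨V', fun t ht ↦ ?_, ?_⟩
  · exact (hV t ht).congr_of_eqOn ((ho t ht).mem_nhds (hbI t ht)) (e t ht) t rfl
  · rw [e a ha a (haI a ha), hVa]

/-- Cone invariance holds in both directions of time, so a preimage in the cone is found by
translating back from b to a. -/
theorem exists_isParallelTranslation_bijOn (hC : IsConvex E C) (hJ : IsOpen J)
    (hJ' : J.OrdConnected) (hγ : IsGeodesicOn (E := E) γ J) (hγC : ∀ t ∈ J, γ t ∈ C)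
    (ha : a ∈ J) (hb : b ∈ J) :
    ∃ P : TangentSpace 𝓘(ℝ, E) (γ a) → TangentSpace 𝓘(ℝ, E) (γ b),
      IsParallelTranslation γ J a b P ∧
        BijOn P (tangentCone C (γ a)) (tangentCone C (γ b)) := by
  choose V hV hVa using exists_isParallelOn hC hJ hJ' hγ hγC ha
  have hP : IsParallelTranslation γ J a b fun v ↦ V v b := by
    refine fun v w ↦ ⟨?_, fun h ↦ ⟨V v, hV v, hVa v, h⟩⟩
    rintro ⟨W, hW, rfl, rfl⟩
    exact (hV _).eq_of_eq hC hJ hJ' hγ hγC hW ha hb (hVa _)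
  refine ⟨_, hP, fun v hv ↦ ?_, fun v _ w _ hvw ↦ ?_, fun w hw ↦ ?_⟩
  · exact (hV v).mem_tangentCone hC hJ hJ' hγ hγC ha hb (by rwa [hVa])
  · rw [← hVa v, ← hVa w]
    exact (hV v).eq_of_eq hC hJ hJ' hγ hγC (hV w) hb ha hvw
  · obtain ⟨W, hW, rfl⟩ := exists_isParallelOn hC hJ hJ' hγ hγC hb w
    exact ⟨W a, hW.mem_tangentCone hC hJ hJ' hγ hγC hb ha hw, (hP _ _).1 ⟨W, hW, rfl, rfl⟩⟩

theorem mem_tangentCone_self_iff (p : M) (v : TangentSpace 𝓘(ℝ, E) p) :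
    v ∈ tangentCone C p ↔ (v : E) ∈ chartCone C p (extChartAt 𝓘(ℝ, E) p p) := by
  rw [mem_tangentCone_iff (mem_extChartAt_source p), chartDeriv_self]
  exact Iff.rfl

theorem tangentCone_eq_chartCone (p : M) :
    tangentCone (E := E) C p = chartCone C p (extChartAt 𝓘(ℝ, E) p p) :=
  Set.ext fun v ↦ mem_tangentCone_self_iff p v

theorem jacobiOperator_eq (p : M) (u v : TangentSpace 𝓘(ℝ, E) p) :
    jacobiOperator p u v = (bilinCurvature (E := E) (chartChristoffel p)
      (extChartAt 𝓘(ℝ, E) p p) v (chartDeriv p p u) (chartDeriv p p u) : E) := by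
  rw [chartDeriv_self]
  exact IsMetricOn.coordCurvature_eq (E := E) (isMetricOn_chartMetric p)
    (mem_extChartAt_target (I := 𝓘(ℝ, E)) p) v u u

/-- If v + tw and -v lie in K, so does their sum tw, and hence w. -/
theorem vectorTangentCone_subset {K : Set E} (hK : IsClosed K)
    (hadd : ∀ v ∈ K, ∀ w ∈ K, v + w ∈ K) (hsmul : ∀ v ∈ K, ∀ a : ℝ, 0 ≤ a → a • v ∈ K)
    {v : E} (hv : -v ∈ K) : vectorTangentCone K v ⊆ K := by
  refine closure_minimal ?_ hK
  rintro w ⟨ε, hε, h⟩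
  have h1 := hadd _ (h (ε / 2) ⟨by positivity, by linarith⟩) _ hv
  have h2 := hsmul _ h1 (2 / ε) (by positivity)
  convert h2 using 1
  rw [add_neg_cancel_comm, smul_smul]
  field_simp
  simp

theorem bilinCurvature_neg (Γ : E → E →L[ℝ] E →L[ℝ] E) (y u v : E) :
    bilinCurvature Γ y (-v) u u = -bilinCurvature Γ y v u u := by
  rw [← neg_one_smul ℝ v, ← neg_one_smul ℝ (bilinCurvature Γ y v u u)]
  simp only [bilinCurvature, map_smul_normed (W := E →L[ℝ] E →L[ℝ] E), map_smul, smul_apply]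
  module

/-- A closed convex cone contains a largest linear subspace, invariant under odd tangent maps. -/
theorem exists_isGreatest_submodule {K : Set E} (hK : IsClosed K) (h0 : (0 : E) ∈ K)
    (hadd : ∀ v ∈ K, ∀ w ∈ K, v + w ∈ K) (hsmul : ∀ v ∈ K, ∀ a : ℝ, 0 ≤ a → a • v ∈ K)
    {R : E → E} (hneg : ∀ v, R (-v) = -R v) (hR : ∀ v ∈ K, R v ∈ vectorTangentCone K v) :
    ∃ L : Submodule ℝ E, IsGreatest {L' : Submodule ℝ E | (L' : Set E) ⊆ K} L ∧
      ∀ v ∈ L, R v ∈ L := by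
  -- The subspace is K ∩ -K; multiplication by a negative scalar exchanges the two conditions.
  let L : Submodule ℝ E :=
    { carrier := {v | v ∈ K ∧ -v ∈ K}
      add_mem' := fun {v w} hv hw ↦ ⟨hadd v hv.1 w hw.1, by
        rw [neg_add]
        exact hadd _ hv.2 _ hw.2⟩
      zero_mem' := ⟨h0, by rwa [neg_zero]⟩
      smul_mem' := fun c v hv ↦ by
        rcases le_total 0 c with hc | hc
        · exact ⟨hsmul _ hv.1 c hc, by rw [← smul_neg]; exact hsmul _ hv.2 c hc⟩
        · refine ⟨?_, ?_⟩
          · rw [← neg_smul_neg]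
            exact hsmul _ hv.2 (-c) (neg_nonneg.2 hc)
          · rw [← neg_smul]
            exact hsmul _ hv.1 (-c) (neg_nonneg.2 hc) }
  refine ⟨L, ⟨fun v hv ↦ hv.1, fun L' hL' v hv ↦ ⟨hL' hv, hL' (L'.neg_mem hv)⟩⟩, fun v hv ↦ ?_⟩
  have hmem : ∀ w ∈ K, -w ∈ K → R w ∈ K := fun w hw hw' ↦
    vectorTangentCone_subset hK hadd hsmul hw' (hR w hw)
  exact ⟨hmem v hv.1 hv.2, by rw [← hneg]; exact hmem _ hv.2 (by rw [neg_neg]; exact hv.1)⟩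

end Global

end RiemConvex

end

/-! ### The main theorem -/

theorem mainTheorem3
    {E : Type*} [NormedAddCommGroup E] [NormedSpace ℝ E] [FiniteDimensional ℝ E]
    {M : Type*} [EMetricSpace M] [ChartedSpace E M] [IsManifold 𝓘(ℝ, E) ∞ M]
    [RiemannianBundle (fun (x : M) ↦ TangentSpace 𝓘(ℝ, E) x)]
    [IsContMDiffRiemannianBundle 𝓘(ℝ, E) ∞ E (fun (x : M) ↦ TangentSpace 𝓘(ℝ, E) x)]
    [IsRiemannianManifold 𝓘(ℝ, E) M]
    (C : Set M) (hC : IsClosed C) (hconv : RiemConvex.IsConvex E C)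
    (J : Set ℝ) (hJ : IsOpen J) (hJ' : J.OrdConnected)
    (γ : ℝ → M) (hγ : RiemConvex.IsGeodesicOn (E := E) γ J) (hγC : ∀ t ∈ J, γ t ∈ C) :
    -- parallel translation along `γ` restricts to a bijection between the tangent cones
    (∀ a ∈ J, ∀ b ∈ J, ∃ P : TangentSpace 𝓘(ℝ, E) (γ a) → TangentSpace 𝓘(ℝ, E) (γ b),
      RiemConvex.IsParallelTranslation γ J a b P ∧
        Set.BijOn P (RiemConvex.tangentCone C (γ a)) (RiemConvex.tangentCone C (γ b))) ∧
    -- `R²_{γ'(a)} v` lies in the tangent cone at `v` of the tangent cone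
    (∀ a ∈ J, ∀ v ∈ RiemConvex.tangentCone (E := E) C (γ a),
      RiemConvex.jacobiOperator (γ a) (RiemConvex.velocity γ a) v ∈
        RiemConvex.vectorTangentCone (RiemConvex.tangentCone (E := E) C (γ a)) v) ∧
    -- the maximal linear subspace of the tangent cone is invariant under `R²_{γ'(a)}`
    (∀ a ∈ J, ∃ L : Submodule ℝ (TangentSpace 𝓘(ℝ, E) (γ a)),
      IsGreatest {L' : Submodule ℝ (TangentSpace 𝓘(ℝ, E) (γ a)) |
        (L' : Set (TangentSpace 𝓘(ℝ, E) (γ a))) ⊆ RiemConvex.tangentCone C (γ a)} L ∧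
      ∀ v ∈ L, RiemConvex.jacobiOperator (γ a) (RiemConvex.velocity γ a) v ∈ L) := by
  refine ⟨fun a ha b hb ↦
    RiemConvex.exists_isParallelTranslation_bijOn hconv hJ hJ' hγ hγC ha hb, ?_⟩
  have key : ∀ a ∈ J, ∃ I, RiemConvex.IsGoodInterval (E := E) C γ a I := fun a ha ↦
    let ⟨_, _, _, hg⟩ := RiemConvex.exists_isGoodInterval hconv hJ hγ hγC ha
    ⟨_, hg⟩
  have hcurv : ∀ a ∈ J, ∀ v ∈ RiemConvex.tangentCone (E := E) C (γ a),
      RiemConvex.jacobiOperator (γ a) (RiemConvex.velocity γ a) v ∈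
        RiemConvex.vectorTangentCone (RiemConvex.tangentCone (E := E) C (γ a)) v := by
    intro a ha v hv
    obtain ⟨I, hg⟩ := key a ha
    rw [RiemConvex.tangentCone_eq_chartCone] at hv ⊢
    rw [RiemConvex.jacobiOperator_eq]
    exact hg.curvature v hv
  refine ⟨hcurv, fun a ha ↦ ?_⟩
  obtain ⟨I, hg⟩ := key a ha
  obtain ⟨L, ⟨hL, hL'⟩, hLR⟩ := RiemConvex.exists_isGreatest_submodule isClosed_closure hg.zero_mem
    hg.add_mem (fun v hv c hc ↦ RiemConvex.smul_mem_chartCone hv hc)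
    (fun v ↦ RiemConvex.bilinCurvature_neg _ _ _ v) hg.curvature
  refine ⟨L, ⟨fun v hv ↦ (RiemConvex.mem_tangentCone_self_iff _ v).2 (hL hv), fun L₁ hL₁ ↦ hL'
    fun v hv ↦ (RiemConvex.mem_tangentCone_self_iff _ v).1 (hL₁ hv)⟩, fun v hv ↦ ?_⟩
  rw [RiemConvex.jacobiOperator_eq]
  exact hLR v hv
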